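/- Let $K$ be an algebraically closed field of characteristic $0$. Let $H_4=K\langle a,b\rangle/(a^2-1,\,b^2,\,ab+ba)$ be the Sweedler algebra, with comultiplication $\Delta(a)=a\otimes a$, $\Delta(b)=b\otimes 1+a\otimes b$, and put $H=H_4\otimes H_4$, with the tensor product bialgebra structure and the generators $g=a\otimes 1$, $h=1\otimes a$, $x=b\otimes 1$, $y=1\otimes b$. Modules are left $H$-modules, and $\otimes$ denotes the tensor product over $K$ with $H$ acting through $\Delta$. For signs $s_1,s_2\in\{+,-\}$ let $S_{s_1s_2}$ be the one-dimensional module on which $g,h$ act as $s_1,s_2$ and $x,y$ act as $0$. For a module $A$ write $A_{s_1s_2}=A\otimes S_{s_1s_2}$, so $A_{++}\cong A$. Let $P=He_1$ with $e_1=\frac14(1+g+h+gh)$, the projective cover of $S_{++}$. For integers $r\ge 1$ and $\eta\in K^\times$ define the following modules by a basis, in which $x$ and $y$ act as $0$ on all $v_j$ and on those $u_i$ for which no value is given. - $M(r)$: basis $u_1,\dots,u_r,v_1,\dots,v_{r+1}$; $xu_i=v_i$, $yu_i=v_{i+1}$ for $1\le i\le r$. - $N(r)$: basis $u_1,\dots,u_r,v_1,\dots,v_r$;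 $xu_i=v_i$ for $1\le i\le r$, $yu_i=v_{i+1}$ for $1\le i<r$. - $W(r)$: basis $u_1,\dots,u_{r+1},v_1,\dots,v_r$; $yu_i=v_i$, $xu_{i+1}=v_i$ for $1\le i\le r$. - $N'(r)$: basis $u_1,\dots,u_r,v_1,\dots,v_r$; $yu_i=v_i$ for $1\le i\le r$, $xu_{i+1}=v_i$ for $1\le i<r$. - $C(r,\eta)$: basis $u_1,\dots,u_{2r},v_1,\dots,v_{2r}$; $xu_i=v_i$ for $1\le i\le 2r$, and $yu_{2i}=v_{2i-1}$, $yu_{2i-1}=\eta v_{2i}+v_{2i-2}$ for $1\le i\le r$, where $v_0=0$. In all five families $g$ and $h$ act on each basis vector as signs $(s_1,s_2)$. In $M(r),N(r),W(r),N'(r)$ the signs of $u_i$ are $(+,+)$ for odd $i$ and $(-,-)$ for even $i$; in $M(r),N(r)$ the signs of $v_j$ are $(-,+)$ for odd $j$ and $(+,-)$ for even $j$; in $W(r),N'(r)$ they are $(+,-)$ for odd $j$ and $(-,+)$ for even $j$. In $C(r,\eta)$ the signs of $u_i$ are $(-,-)$ for odd $i$ and $(+,+)$ for even $i$, and those of $v_j$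 are $(+,-)$ for odd $j$ and $(-,+)$ for even $j$. Write $|n|=-$ if $n$ is odd and $|n|=+$ if $n$ is even, and put $m=\min\{r,s\}$, $n=\max\{r,s\}$. **Theorem.** For all integers $r,s\ge 1$ and all $\eta,\gamma\in K^\times$: (1) $P\otimes P\cong P\oplus P_{--}\oplus P_{+-}\oplus P_{-+}$. (2) $M(r)\otimes P\cong P^{\lceil r/2\rceil}\oplus P_{--}^{\lfloor r/2\rfloor}\oplus P_{+-}^{\lceil r/2\rceil}\oplus P_{-+}^{\lceil (r+1)/2\rceil}$ and $W(r)\otimes P\cong P^{\lceil (r+1)/2\rceil}\oplus P_{--}^{\lceil r/2\rceil}\oplus P_{+-}^{\lceil r/2\rceil}\oplus P_{-+}^{\lfloor r/2\rfloor}$. (3) $N(r)\otimes P\cong P^{\lceil r/2\rceil}\oplus P_{--}^{\lfloor r/2\rfloor}\oplus P_{+-}^{\lfloor r/2\rfloor}\oplus P_{-+}^{\lceil r/2\rceil}$, $N'(r)\otimes P\cong P^{\lceil r/2\rceil}\oplus P_{--}^{\lfloor r/2\rfloor}\oplus P_{+-}^{\lceil r/2\rceil}\oplus P_{-+}^{\lfloor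 r/2\rfloor}$, $C(r,\eta)\otimes P\cong P^{r}\oplus P_{--}^{r}\oplus P_{+-}^{r}\oplus P_{-+}^{r}$, and $C(r,\eta)\otimes S_{--}\cong C(r,\eta)$. (4) $M(r)\otimes M(s)\cong P^{\lceil rs/2\rceil}\oplus P_{--}^{\lfloor rs/2\rfloor}\oplus M(r+s)_{-+}$. (5) $W(r)\otimes W(s)\cong P^{\lfloor rs/2\rfloor}\oplus P_{--}^{\lceil rs/2\rceil}\oplus W(r+s)$. (6) $M(r)\otimes W(s)\cong P^{\lceil r(s+1)/2\rceil}\oplus P_{--}^{\lfloor r(s+1)/2\rfloor}\oplus W(s-r)_{|r-1|,|r|}$ if $r<s$; $M(r)\otimes W(s)\cong P^{r(r+1)/2}\oplus P_{--}^{r(r+1)/2}\oplus S_{|r-1|,|r|}$ if $r=s$; $M(r)\otimes W(s)\cong P^{\lceil (r+1)s/2\rceil}\oplus P_{--}^{\lfloor (r+1)s/2\rfloor}\oplus M(r-s)_{|s|,|s|}$ if $r>s$. (7) $M(r)\otimes C(s,\eta)\cong P^{rs}\oplus P_{--}^{rs}\oplus C(s,\eta)_{+-}$. (8) $W(r)\otimes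 C(s,\eta)\cong P^{rs}\oplus P_{--}^{rs}\oplus C(s,\eta)$. (9) $M(r)\otimes N(s)\cong P^{\lceil rs/2\rceil}\oplus P_{--}^{\lfloor rs/2\rfloor}\oplus N(s)_{-+}$ and $M(r)\otimes N'(s)\cong P^{\lceil rs/2\rceil}\oplus P_{--}^{\lfloor rs/2\rfloor}\oplus N'(s)_{|r-1|,|r|}$. (10) $W(r)\otimes N(s)\cong P^{\lceil rs/2\rceil}\oplus P_{--}^{\lfloor rs/2\rfloor}\oplus N(s)_{|r|,|r|}$ and $W(r)\otimes N'(s)\cong P^{\lfloor rs/2\rfloor}\oplus P_{--}^{\lceil rs/2\rceil}\oplus N'(s)$. (11) $C(r,\eta)\otimes C(s,\gamma)\cong P^{2rs}\oplus P_{--}^{2rs}$ if $\eta\ne\gamma$, and $C(r,\eta)\otimes C(s,\gamma)\cong P^{2rs-m}\oplus P_{--}^{2rs-m}\oplus C(m,\eta)\oplus C(m,\eta)_{+-}$ if $\eta=\gamma$. (12) $N(r)\otimes N(s)\cong P^{\lceil (rs-m)/2\rceil}\oplus P_{--}^{\lfloor (rs-m)/2\rfloor}\oplus N(m)_{|n-1|,|n-1|}\oplus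 N(m)_{-+}$. (13) $N'(r)\otimes N'(s)\cong P^{\lfloor (rs-m)/2\rfloor}\oplus P_{--}^{\lceil (rs-m)/2\rceil}\oplus N'(m)\oplus N'(m)_{|n-1|,|n|}$. (14) $N(r)\otimes N'(s)\cong P^{\lceil rs/2\rceil}\oplus P_{--}^{\lfloor rs/2\rfloor}$, and $C(r,\eta)\otimes N(s)\cong C(r,\eta)\otimes N'(s)\cong P^{rs}\oplus P_{--}^{rs}$. -/

import Mathlib

open scoped TensorProduct

universe u

noncomputable section

/-! ### The Sweedler algebra -/

/-- The two generators of the Sweedler algebra. -/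
inductive SweedlerGen : Type
  | a : SweedlerGen
  | b : SweedlerGen

/-- The relations `a² = 1`, `b² = 0`, `ab + ba = 0`. -/
inductive SweedlerRel (K : Type u) [Field K] :
    FreeAlgebra K SweedlerGen → FreeAlgebra K SweedlerGen → Prop
  | aa : SweedlerRel K (FreeAlgebra.ι K SweedlerGen.a * FreeAlgebra.ι K SweedlerGen.a) 1
  | bb : SweedlerRel K (FreeAlgebra.ι K SweedlerGen.b * FreeAlgebra.ι K SweedlerGen.b) 0
  | ab : SweedlerRel K (FreeAlgebra.ι K SweedlerGen.a * FreeAlgebra.ι K SweedlerGen.b +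
      FreeAlgebra.ι K SweedlerGen.b * FreeAlgebra.ι K SweedlerGen.a) 0

/-- The Sweedler algebra `H₄ = K⟨a, b⟩ / (a² - 1, b², ab + ba)`. -/
def H4 (K : Type u) [Field K] : Type u := RingQuot (SweedlerRel K)

namespace H4

variable (K : Type u) [Field K]

instance instRing : Ring (H4 K) := inferInstanceAs (Ring (RingQuot (SweedlerRel K)))

instance instAlgebra : Algebra K (H4 K) := inferInstanceAs (Algebra K (RingQuot (SweedlerRel K)))

/-- The quotient map from the free algebra. -/
def mk : FreeAlgebra K SweedlerGen →ₐ[K] H4 K := RingQuot.mkAlgHom K (SweedlerRel K)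

/-- The generator `a` of `H₄`. -/
def a : H4 K := mk K (FreeAlgebra.ι K SweedlerGen.a)

/-- The generator `b` of `H₄`. -/
def b : H4 K := mk K (FreeAlgebra.ι K SweedlerGen.b)

theorem a_mul_a : a K * a K = 1 := by
  have h := RingQuot.mkAlgHom_rel K (SweedlerRel.aa (K := K))
  rw [map_mul, map_one] at h
  exact h

theorem b_mul_b : b K * b K = 0 := by
  have h := RingQuot.mkAlgHom_rel K (SweedlerRel.bb (K := K))
  rw [map_mul, map_zero] at h
  exact h

theorem a_mul_b_add : a K * b K + b K * a K = 0 := by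
  have h := RingQuot.mkAlgHom_rel K (SweedlerRel.ab (K := K))
  rw [map_add, map_mul, map_mul, map_zero] at h
  exact h

variable {K}

/-- The universal property of `H₄`: a pair of elements that satisfy the defining relations
determines an algebra homomorphism. -/
def lift {A : Type*} [Ring A] [Algebra K A] (x y : A) (hx : x * x = 1) (hy : y * y = 0)
    (hxy : x * y + y * x = 0) : H4 K →ₐ[K] A :=
  RingQuot.liftAlgHom K
    ⟨FreeAlgebra.lift K (fun i => match i with
      | SweedlerGen.a => x
      | SweedlerGen.b => y), by
      intro p q h
      cases h <;> simp [hx, hy, hxy]⟩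

@[simp] theorem lift_a {A : Type*} [Ring A] [Algebra K A] (x y : A) (hx : x * x = 1)
    (hy : y * y = 0) (hxy : x * y + y * x = 0) : lift (K := K) x y hx hy hxy (a K) = x := by
  simp only [lift, a, mk]
  erw [RingQuot.liftAlgHom_mkAlgHom_apply]
  simp

@[simp] theorem lift_b {A : Type*} [Ring A] [Algebra K A] (x y : A) (hx : x * x = 1)
    (hy : y * y = 0) (hxy : x * y + y * x = 0) : lift (K := K) x y hx hy hxy (b K) = y := by
  simp only [lift, b, mk]
  erw [RingQuot.liftAlgHom_mkAlgHom_apply]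
  simp

theorem algHom_ext {A : Type*} [Ring A] [Algebra K A] {f g : H4 K →ₐ[K] A}
    (ha : f (a K) = g (a K)) (hb : f (b K) = g (b K)) : f = g := by
  apply RingQuot.ringQuot_ext'
  apply FreeAlgebra.hom_ext
  funext i
  cases i
  · exact ha
  · exact hb

variable (K)

/-- The comultiplication `Δ(a) = a ⊗ a`, `Δ(b) = b ⊗ 1 + a ⊗ b`. -/
def comulHom : H4 K →ₐ[K] H4 K ⊗[K] H4 K :=
  lift (a K ⊗ₜ a K) (b K ⊗ₜ 1 + a K ⊗ₜ b K)
    (by simp [a_mul_a, Algebra.TensorProduct.one_def])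
    (by
      have h : a K * b K = -(b K * a K) := eq_neg_of_add_eq_zero_left (a_mul_b_add K)
      simp [add_mul, mul_add, b_mul_b, h, TensorProduct.neg_tmul])
    (by
      have h : a K * b K = -(b K * a K) := eq_neg_of_add_eq_zero_left (a_mul_b_add K)
      simp only [add_mul, mul_add, Algebra.TensorProduct.tmul_mul_tmul, a_mul_a, h, mul_one, one_mul,
        TensorProduct.neg_tmul, TensorProduct.tmul_neg]
      abel)

/-- The counit `ε(a) = 1`, `ε(b) = 0`. -/
def counitHom : H4 K →ₐ[K] K :=
  lift 1 0 (by simp) (by simp) (by simp)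

instance instBialgebra : Bialgebra K (H4 K) :=
  Bialgebra.ofAlgHom (comulHom K) (counitHom K)
    (by
      apply algHom_ext <;>
        simp [comulHom, TensorProduct.add_tmul, TensorProduct.tmul_add,
          Algebra.TensorProduct.one_def, add_assoc])
    (by apply algHom_ext <;> simp [comulHom, counitHom])
    (by apply algHom_ext <;> simp [comulHom, counitHom])

end H4

/-! ### The bialgebra `H₄ ⊗ H₄` and its modules -/

/-- The tensor product `H₄ ⊗ H₄`, with the tensor product bialgebra structure. -/
abbrev HH (K : Type u) [Field K] : Type u := H4 K ⊗[K] H4 K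

namespace HH

variable (K : Type u) [Field K]

/-- The generator `g = a ⊗ 1`. -/
def g : HH K := H4.a K ⊗ₜ 1

/-- The generator `h = 1 ⊗ a`. -/
def h : HH K := 1 ⊗ₜ H4.a K

/-- The generator `x = b ⊗ 1`. -/
def x : HH K := H4.b K ⊗ₜ 1

/-- The generator `y = 1 ⊗ b`. -/
def y : HH K := 1 ⊗ₜ H4.b K

/-- The primitive idempotent `e₁ = (1 + g + h + gh) / 4`, on which `g` and `h` act as `1`. -/
def e₁ : HH K := (4 : K)⁻¹ • (1 + g K + h K + g K * h K)

theorem h4_commute {A : Type*} [Ring A] [Algebra K A] (f : H4 K →ₐ[K] A) (z : A)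
    (ha : Commute (f (H4.a K)) z) (hb : Commute (f (H4.b K)) z) (w : H4 K) :
    Commute (f w) z := by
  obtain ⟨w, rfl⟩ := RingQuot.mkAlgHom_surjective K (SweedlerRel K) w
  induction w using FreeAlgebra.induction with
  | grade0 r =>
    rw [AlgHom.commutes]
    erw [AlgHom.commutes]
    exact Algebra.commutes r z
  | grade1 i =>
    cases i
    · exact ha
    · exact hb
  | mul p q hp hq =>
    rw [map_mul]
    erw [map_mul]
    exact hp.mul_left hq
  | add p q hp hq =>
    rw [map_add]
    erw [map_add]
    exact hp.add_left hq

end HH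

/-- A left module over `H₄ ⊗ H₄`: a `K`-vector space with an algebra homomorphism from `H₄ ⊗ H₄` to
its endomorphism algebra. -/
structure HHModule (K : Type u) [Field K] where
  carrier : Type u
  [addCommGroup : AddCommGroup carrier]
  [module : Module K carrier]
  ρ : HH K →ₐ[K] Module.End K carrier

attribute [instance] HHModule.addCommGroup HHModule.module

namespace HHModule

variable {K : Type u} [Field K]

/-- Isomorphism of modules: a linear bijection that commutes with the action of `H₄ ⊗ H₄`. -/
def Iso (A B : HHModule K) : Prop :=
  ∃ e : A.carrier ≃ₗ[K] B.carrier, ∀ (w : HH K) (v : A.carrier), e (A.ρ w v) = B.ρ w (e v)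

/-- The direct sum of two modules. -/
def sum (A B : HHModule K) : HHModule K where
  carrier := A.carrier × B.carrier
  ρ := AlgHom.ofLinearMap
    ((LinearMap.prodMapLinear K A.carrier B.carrier A.carrier B.carrier K).comp
      (A.ρ.toLinearMap.prod B.ρ.toLinearMap))
    (by ext <;> simp)
    (by intro p q; ext <;> simp)

/-- The direct sum of `n` copies of a module. -/
def power (A : HHModule K) (n : ℕ) : HHModule K where
  carrier := Fin n → A.carrier
  ρ := AlgHom.ofLinearMap
    { toFun := fun w => LinearMap.pi fun i => (A.ρ w).comp (LinearMap.proj i)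
      map_add' := by intro p q; ext; simp
      map_smul' := by intro p q; ext; simp }
    (by ext; simp)
    (by intro p q; ext; simp)

/-- The tensor product of two modules, on which `H₄ ⊗ H₄` acts through its comultiplication. -/
def tensor (A B : HHModule K) : HHModule K where
  carrier := A.carrier ⊗[K] B.carrier
  ρ := (Module.endTensorEndAlgHom (R := K) (S := K) (A := K)).comp
    ((Algebra.TensorProduct.map A.ρ B.ρ).comp (Bialgebra.comulAlgHom K (HH K)))

/-- The algebra homomorphism that sends the generators `g`, `h`, `x`, `y` to operators `G`, `H`, `X`,
`Y` which satisfy the same relations. -/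
def opsHom {V : Type u} [AddCommGroup V] [Module K V] (G H X Y : Module.End K V)
    (hG : G * G = 1) (hX : X * X = 0) (hGX : G * X + X * G = 0)
    (hH : H * H = 1) (hY : Y * Y = 0) (hHY : H * Y + Y * H = 0)
    (hGH : G * H = H * G) (hGY : G * Y = Y * G) (hXH : X * H = H * X) (hXY : X * Y = Y * X) :
    HH K →ₐ[K] Module.End K V :=
  Algebra.TensorProduct.lift (H4.lift G X hG hX hGX) (H4.lift H Y hH hY hHY) (by
    intro p q
    refine HH.h4_commute K _ _ ?_ ?_ p <;> rw [Commute.symm_iff] <;>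
      refine HH.h4_commute K _ _ ?_ ?_ q <;> simp [Commute, SemiconjBy, hGH, hGY, hXH, hXY])

section

variable {V : Type u} [AddCommGroup V] [Module K V] (G H X Y : Module.End K V)
  (hG : G * G = 1) (hX : X * X = 0) (hGX : G * X + X * G = 0)
  (hH : H * H = 1) (hY : Y * Y = 0) (hHY : H * Y + Y * H = 0)
  (hGH : G * H = H * G) (hGY : G * Y = Y * G) (hXH : X * H = H * X) (hXY : X * Y = Y * X)

theorem opsHom_g : opsHom G H X Y hG hX hGX hH hY hHY hGH hGY hXH hXY (HH.g K) = G := by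
  simp [opsHom, HH.g]

theorem opsHom_h : opsHom G H X Y hG hX hGX hH hY hHY hGH hGY hXH hXY (HH.h K) = H := by
  simp [opsHom, HH.h]

theorem opsHom_x : opsHom G H X Y hG hX hGX hH hY hHY hGH hGY hXH hXY (HH.x K) = X := by
  simp [opsHom, HH.x]

theorem opsHom_y : opsHom G H X Y hG hX hGX hH hY hHY hGH hGY hXH hXY (HH.y K) = Y := by
  simp [opsHom, HH.y]

end

/-! ### Simple and projective modules -/

/-- The one-dimensional module `S(s, t)`: `g` acts as `s`, `h` as `t`, and `x`, `y` act as `0`. -/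
def S (K : Type u) [Field K] (s t : ℤˣ) : HHModule K where
  carrier := K
  ρ := opsHom (((s : ℤ) : K) • 1) (((t : ℤ) : K) • 1) 0 0
    (by
      rw [smul_mul_smul_comm, ← Int.cast_mul, ← Units.val_mul, Int.units_mul_self]
      simp)
    (by simp) (by simp)
    (by
      rw [smul_mul_smul_comm, ← Int.cast_mul, ← Units.val_mul, Int.units_mul_self]
      simp)
    (by simp) (by simp)
    (by rw [smul_mul_smul_comm, smul_mul_smul_comm, mul_comm])
    (by simp) (by simp) (by simp)

/-- The twist `A_{s t} = A ⊗ S(s, t)`. -/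
def twist (A : HHModule K) (s t : ℤˣ) : HHModule K := tensor A (S K s t)

/-- The principal indecomposable module `P`, that is, the left ideal of `H₄ ⊗ H₄` generated by
`e₁`. It is the projective cover of the trivial module `S(1, 1)`. -/
def P (K : Type u) [Field K] : HHModule K where
  carrier := ↥(Ideal.span {HH.e₁ K} : Ideal (HH K))
  ρ := Algebra.lsmul K K _

/-! ### Modules of Loewy length two -/

/-- The operator on `ι → K` that multiplies the `i`-th basis vector by the sign `σ i`. -/
def diagOp {ι : Type} (K : Type u) [Field K] (σ : ι → ℤˣ) : Module.End K (ι → K) :=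
  LinearMap.pi fun i => ((σ i : ℤ) : K) • LinearMap.proj i

theorem diagOp_mul_self {ι : Type} (σ : ι → ℤˣ) : diagOp K σ * diagOp K σ = 1 := by
  refine LinearMap.ext fun v => funext fun i => ?_
  simp only [diagOp, Module.End.mul_apply, LinearMap.pi_apply, LinearMap.smul_apply,
    LinearMap.proj_apply, smul_eq_mul, Module.End.one_apply]
  rw [← mul_assoc, ← Int.cast_mul, ← Units.val_mul, Int.units_mul_self]
  simp

theorem diagOp_commute {ι : Type} (σ τ : ι → ℤˣ) : Commute (diagOp K σ) (diagOp K τ) := by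
  refine LinearMap.ext fun v => funext fun i => ?_
  simp only [diagOp, Module.End.mul_apply, LinearMap.pi_apply, LinearMap.smul_apply,
    LinearMap.proj_apply, smul_eq_mul]
  ring

/-- If `M j i ≠ 0` only for `τ j = c σ i`, then `diag(τ) M = c M diag(σ)`. -/
theorem diagOp_comp_mulVec {p q : Type} [Fintype p] (σ : p → ℤˣ) (τ : q → ℤˣ) (c : ℤˣ)
    (M : Matrix q p K) (hM : ∀ j i, M j i ≠ 0 → τ j = c * σ i) (v : p → K) :
    diagOp K τ (M.mulVec v) = ((c : ℤ) : K) • M.mulVec (diagOp K σ v) := by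
  funext j
  simp only [diagOp, LinearMap.pi_apply, LinearMap.smul_apply, LinearMap.proj_apply, smul_eq_mul,
    Pi.smul_apply, Matrix.mulVec, dotProduct, Finset.mul_sum]
  refine Finset.sum_congr rfl fun i _ => ?_
  by_cases h : M j i = 0
  · simp [h]
  · rw [hM j i h]
    push_cast
    ring

/-- The module with basis `u_i` (`i : p`) and `v_j` (`j : q`), where `g`, `h` act on `u_i` as the
signs `gU i`, `hU i` and on `v_j` as the signs `gV j`, `hV j`, and
`x u_i = ∑ j, X j i • v_j`, `y u_i = ∑ j, Y j i • v_j`, `x v_j = y v_j = 0`. -/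
def layered {p q : Type} [Fintype p] (gU hU : p → ℤˣ) (gV hV : q → ℤˣ) (X Y : Matrix q p K)
    (hX : ∀ j i, X j i ≠ 0 → gV j = -gU i ∧ hV j = hU i)
    (hY : ∀ j i, Y j i ≠ 0 → gV j = gU i ∧ hV j = -hU i) : HHModule K where
  carrier := (p → K) × (q → K)
  ρ := opsHom
    ((diagOp K gU).prodMap (diagOp K gV))
    ((diagOp K hU).prodMap (diagOp K hV))
    ((LinearMap.inr K (p → K) (q → K)).comp (X.mulVecLin.comp (LinearMap.fst K _ _)))
    ((LinearMap.inr K (p → K) (q → K)).comp (Y.mulVecLin.comp (LinearMap.fst K _ _)))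
    (by rw [LinearMap.prodMap_mul, diagOp_mul_self, diagOp_mul_self, LinearMap.prodMap_one])
    (by refine LinearMap.ext fun v => ?_; simp)
    (by
      refine LinearMap.ext fun v => ?_
      have h := diagOp_comp_mulVec gU gV (-1) X (fun j i hji => by simp [(hX j i hji).1]) v.1
      simp [h])
    (by rw [LinearMap.prodMap_mul, diagOp_mul_self, diagOp_mul_self, LinearMap.prodMap_one])
    (by refine LinearMap.ext fun v => ?_; simp)
    (by
      refine LinearMap.ext fun v => ?_
      have h := diagOp_comp_mulVec hU hV (-1) Y (fun j i hji => by simp [(hY j i hji).2]) v.1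
      simp [h])
    (by
      rw [LinearMap.prodMap_mul, LinearMap.prodMap_mul, (diagOp_commute gU hU).eq,
        (diagOp_commute gV hV).eq])
    (by
      refine LinearMap.ext fun v => ?_
      have h := diagOp_comp_mulVec gU gV 1 Y (fun j i hji => by simp [(hY j i hji).1]) v.1
      simp [h])
    (by
      refine LinearMap.ext fun v => ?_
      have h := diagOp_comp_mulVec hU hV 1 X (fun j i hji => by simp [(hX j i hji).2]) v.1
      simp [h])
    (by refine LinearMap.ext fun v => ?_; simp)

/-- The sign `(-1)^i`. -/
abbrev sgn (i : ℕ) : ℤˣ := (-1) ^ i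

/-- The string module with basis `u_0, …, u_{m-1}`, `v_0, …, v_{n-1}` and
`x u_i = v_i`, `y u_i = v_{i+1}` (where `v_j = 0` for `j ≥ n`), in which `u_0` has the signs
`(+, +)`; so `u_i` has the signs `((-1)^i, (-1)^i)` and `v_j` the signs `(-(-1)^j, (-1)^j)`. -/
def stringX (K : Type u) [Field K] (m n : ℕ) : HHModule K :=
  layered (p := Fin m) (q := Fin n)
    (fun i => sgn i) (fun i => sgn i) (fun j => -sgn j) (fun j => sgn j)
    (Matrix.of fun j i => if (j : ℕ) = i then 1 else 0)
    (Matrix.of fun j i => if (j : ℕ) = i + 1 then 1 else 0)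
    (by
      intro j i h
      have h' : (j : ℕ) = i := by by_contra hne; exact h (by simp [hne])
      simp [h'])
    (by
      intro j i h
      have h' : (j : ℕ) = i + 1 := by by_contra hne; exact h (by simp [hne])
      simp [h', sgn, pow_succ])

/-- The string module with basis `u_0, …, u_{m-1}`, `v_0, …, v_{n-1}` and
`y u_i = v_i`, `x u_{i+1} = v_i`, `x u_0 = 0` (where `v_j = 0` for `j ≥ n`), in which `u_0` has the
signs `(+, +)`; so `u_i` has the signs `((-1)^i, (-1)^i)` and `v_j` the signs
`((-1)^j, -(-1)^j)`. -/
def stringY (K : Type u) [Field K] (m n : ℕ) : HHModule K :=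
  layered (p := Fin m) (q := Fin n)
    (fun i => sgn i) (fun i => sgn i) (fun j => sgn j) (fun j => -sgn j)
    (Matrix.of fun j i => if (j : ℕ) + 1 = i then 1 else 0)
    (Matrix.of fun j i => if (j : ℕ) = i then 1 else 0)
    (by
      intro j i h
      have h' : (j : ℕ) + 1 = i := by by_contra hne; exact h (by simp [hne])
      simp [← h', sgn, pow_succ])
    (by
      intro j i h
      have h' : (j : ℕ) = i := by by_contra hne; exact h (by simp [hne])
      simp [h'])

/-- `M(r)`, of dimension `2r + 1`: basis `u_1, …, u_r`, `v_1, …, v_{r+1}`, with `x u_i = v_i`,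
`y u_i = v_{i+1}`. -/
def M (K : Type u) [Field K] (r : ℕ) : HHModule K := stringX K r (r + 1)

/-- `N(r)`, of dimension `2r`: basis `u_1, …, u_r`, `v_1, …, v_r`, with `x u_i = v_i`,
`y u_i = v_{i+1}` for `i < r`, `y u_r = 0`. -/
def N (K : Type u) [Field K] (r : ℕ) : HHModule K := stringX K r r

/-- `W(r)`, of dimension `2r + 1`: basis `u_1, …, u_{r+1}`, `v_1, …, v_r`, with `y u_i = v_i` and
`x u_{i+1} = v_i` for `i ≤ r`, `x u_1 = 0`, `y u_{r+1} = 0`. -/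
def W (K : Type u) [Field K] (r : ℕ) : HHModule K := stringY K (r + 1) r

/-- `N'(r)`, of dimension `2r`: basis `u_1, …, u_r`, `v_1, …, v_r`, with `y u_i = v_i`,
`x u_{i+1} = v_i` for `i < r`, `x u_1 = 0`. -/
def N' (K : Type u) [Field K] (r : ℕ) : HHModule K := stringY K r r

/-- The band module `C(r, η)`, of dimension `4r`: basis `u_1, …, u_{2r}`, `v_1, …, v_{2r}`, with
`x u_i = v_i`, `y u_{2i} = v_{2i-1}`, `y u_{2i-1} = η v_{2i} + v_{2i-2}` (where `v_0 = 0`), in which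
`u_{2i-1}`, `u_{2i}` have the signs `(-, -)`, `(+, +)`. In the code the indices start at `0`, so that
`y u_i = v_{i-1}` plus, for even `i`, `η v_{i+1}`. -/
def C (K : Type u) [Field K] (r : ℕ) (η : Kˣ) : HHModule K :=
  layered (p := Fin (2 * r)) (q := Fin (2 * r))
    (fun i => -sgn i) (fun i => -sgn i) (fun j => sgn j) (fun j => -sgn j)
    (Matrix.of fun j i => if (j : ℕ) = i then 1 else 0)
    (Matrix.of fun j i =>
      if (j : ℕ) + 1 = i then 1 else if (j : ℕ) = i + 1 ∧ Even (i : ℕ) then (η : K) else 0)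
    (by
      intro j i h
      have h' : (j : ℕ) = i := by by_contra hne; exact h (by simp [hne])
      simp [h'])
    (by
      intro j i h
      have h' : (j : ℕ) + 1 = i ∨ (j : ℕ) = i + 1 := by
        by_contra hne
        push Not at hne
        exact h (by simp [hne.1, hne.2])
      rcases h' with h' | h'
      · simp [← h', sgn, pow_succ]
      · simp [h', sgn, pow_succ])

end HHModule

end

infix:50 " ≅ₕ " => HHModule.Iso
infixr:60 " ⊕ₕ " => HHModule.sum
infixr:70 " ⊗ₕ " => HHModule.tensor
infix:80 " ^⊕ " => HHModule.power

/-!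
A module over `H₄ ⊗ H₄` is a vector space with two commuting involutions `g`, `h` and two
commuting square-zero operators `x`, `y` such that `x` is odd for `g` and even for `h`, and `y` is
even for `g` and odd for `h`. On a tensor product, `x` acts as `x ⊗ 1 + g ⊗ x` and `y` as
`y ⊗ 1 + h ⊗ y`.

The projective module `P_{s t}` has the basis `e`, `xe`, `ye`, `xye`, where `e` is free apart from
its signs `(s, t)`. So a homogeneous vector `w` of a module `T` defines a homomorphism from
`P_{s t}` to `T`. All decompositions follow from one criterion (`HHModule.splitting`): homogeneous
vectors `w_i` and a homomorphism `φ : B → T` from a module with `xy = 0` define an isomorphism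
`(⨁ P) ⊕ B ≅ T` if the dimensions agree and if the `xy w_i` are linearly independent modulo the
image of the socle of `B`, on which `φ` is injective. In this way every decomposition is reduced
to the choice of `w_i` and `φ`, and to linear algebra in the socle.

All of `M`, `N`, `W`, `N'`, `C` have an upper layer `u_i` and a lower layer `v_j`, with signs
which alternate along both layers (`HHModule.Layer`). For two such modules, up to sign
`xy (u_i ⊗ u'_j) = y u_i ⊗ x u'_j + x u_i ⊗ y u'_j`, and the signs of `u_i ⊗ u'_j` are those of a
chessboard, so that a rectangle of such vectors contributes `P` and `P_{--}` in equal numbers, up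
to rounding (`HHModule.splitting_grid`, `HHModule.Layer.isBoard`). The complements are as follows,
where `u_i`, `v_j` belong to the first factor `A` and `u'_i`, `v'_j` to the second factor `B`.

* `M ⊗ M`: the modules `v_0 ⊗ B` and `A ⊗ v'_n` for the last vector `v'_n`, which meet in one
  vector.
* `M ⊗ N`, `M ⊗ C`: the module `v_0 ⊗ B`.
* `W ⊗ W`: the sums of `u_i ⊗ u'_j` along the antidiagonals of the whole grid.
* `M ⊗ W`: the end of `v_0 ⊗ B` with one corrected vector, or sums of `u_i ⊗ u'_j` along
  antidiagonals, depending on which of the two parameters is larger.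
* For `N` and `C` the operator `x` identifies the two layers, and then `y` becomes an operator
  `J`, which is nilpotent for `N`, and for which `J² - η` is nilpotent for `C`. With it, the
  vectors `∑ u_i ⊗ J^(m - i) b` for `b ∈ B` form the complement in `W ⊗ N` and `W ⊗ C`, and
  `N ⊗ N` and `C ⊗ C` with equal parameters have the complement `A ⊗ v'_0` and a second one with
  the upper layer `∑ u_i ⊗ p_l(J) u'_{n-1-i}`, for the polynomials `p_l` with
  `p_l(J) u'_0 = u'_l`.
* There is no complement in the other cases. For `C ⊗ C` with different parameters and for
  `C ⊗ N`, the map from `v_i ⊗ v'_j` to `xy` of the chessboard is `J ⊗ 1 + 1 ⊗ J'`, which is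
  invertible as `J² ⊗ 1 - 1 ⊗ J'²` is. For `N ⊗ N'` and `C ⊗ N'` it is `1 + J ⊗ D` with `D`
  nilpotent.

The remaining products follow by exchanging `(g, x)` with `(h, y)`, which interchanges the shapes
of `N` and `N'` and keeps those of `M` and `W` up to the order of the basis, and by the symmetry
of the tensor product, which is given by a braiding. The operator `J` is also the isomorphism
`C(r, η) ⊗ S_{--} ≅ C(r, η)`.
-/

noncomputable section

/-! ### Generators and the operators they induce -/

namespace HH

variable {K : Type u} [Field K]

/-- Induction over `H₄ ⊗ H₄`: the algebra is generated by `g`, `h`, `x`, `y`. -/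
theorem gen_induction {p : HH K → Prop} (hK : ∀ c, p (algebraMap K (HH K) c))
    (hg : p (HH.g K)) (hh : p (HH.h K)) (hx : p (HH.x K)) (hy : p (HH.y K))
    (hadd : ∀ v w, p v → p w → p (v + w)) (hmul : ∀ v w, p v → p w → p (v * w))
    (w : HH K) : p w := by
  have key : ∀ (f : H4 K →ₐ[K] HH K), p (f (H4.a K)) → p (f (H4.b K)) → ∀ v, p (f v) := by
    intro f ha hb v
    obtain ⟨v, rfl⟩ := RingQuot.mkAlgHom_surjective K (SweedlerRel K) v
    change p ((f.comp (H4.mk K)) v)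
    induction v using FreeAlgebra.induction with
    | grade0 r => rw [AlgHom.commutes]; exact hK r
    | grade1 i =>
      cases i
      · exact ha
      · exact hb
    | mul a b ha hb => rw [map_mul]; exact hmul _ _ ha hb
    | add a b ha hb => rw [map_add]; exact hadd _ _ ha hb
  induction w using TensorProduct.induction_on with
  | zero => simpa using hK 0
  | tmul a b =>
    have h : a ⊗ₜ[K] b = (a ⊗ₜ[K] (1 : H4 K)) * ((1 : H4 K) ⊗ₜ[K] b) := by simp
    rw [h]
    exact hmul _ _ (key Algebra.TensorProduct.includeLeft hg hx a)
      (key Algebra.TensorProduct.includeRight hh hy b)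
  | add a b ha hb => exact hadd _ _ ha hb

theorem g_mul_g : HH.g K * HH.g K = 1 := by
  simp [HH.g, H4.a_mul_a, Algebra.TensorProduct.one_def]

theorem h_mul_h : HH.h K * HH.h K = 1 := by
  simp [HH.h, H4.a_mul_a, Algebra.TensorProduct.one_def]

theorem x_mul_x : HH.x K * HH.x K = 0 := by
  simp [HH.x, H4.b_mul_b]

theorem y_mul_y : HH.y K * HH.y K = 0 := by
  simp [HH.y, H4.b_mul_b]

theorem g_mul_x : HH.g K * HH.x K = -(HH.x K * HH.g K) := by
  have h : H4.a K * H4.b K = -(H4.b K * H4.a K) := eq_neg_of_add_eq_zero_left (H4.a_mul_b_add K)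
  simp [HH.g, HH.x, h, TensorProduct.neg_tmul]

theorem h_mul_y : HH.h K * HH.y K = -(HH.y K * HH.h K) := by
  have h : H4.a K * H4.b K = -(H4.b K * H4.a K) := eq_neg_of_add_eq_zero_left (H4.a_mul_b_add K)
  simp [HH.h, HH.y, h, TensorProduct.tmul_neg]

theorem g_mul_h : HH.g K * HH.h K = HH.h K * HH.g K := by simp [HH.g, HH.h]

theorem g_mul_y : HH.g K * HH.y K = HH.y K * HH.g K := by simp [HH.g, HH.y]

theorem h_mul_x : HH.h K * HH.x K = HH.x K * HH.h K := by simp [HH.h, HH.x]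

theorem x_mul_y : HH.x K * HH.y K = HH.y K * HH.x K := by simp [HH.x, HH.y]

end HH

namespace HHModule

variable {K : Type u} [Field K]

/-- The operator by which `g` acts. -/
def opG (A : HHModule K) : Module.End K A.carrier := A.ρ (HH.g K)

/-- The operator by which `h` acts. -/
def opH (A : HHModule K) : Module.End K A.carrier := A.ρ (HH.h K)

/-- The operator by which `x` acts. -/
def opX (A : HHModule K) : Module.End K A.carrier := A.ρ (HH.x K)

/-- The operator by which `y` acts. -/
def opY (A : HHModule K) : Module.End K A.carrier := A.ρ (HH.y K)

section relations

variable (A : HHModule K) (a : A.carrier)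

@[simp] theorem opG_opG : A.opG (A.opG a) = a := by
  simp only [opG, ← Module.End.mul_apply, ← map_mul, HH.g_mul_g, map_one, Module.End.one_apply]

@[simp] theorem opH_opH : A.opH (A.opH a) = a := by
  simp only [opH, ← Module.End.mul_apply, ← map_mul, HH.h_mul_h, map_one, Module.End.one_apply]

@[simp] theorem opX_opX : A.opX (A.opX a) = 0 := by
  simp only [opX, ← Module.End.mul_apply, ← map_mul, HH.x_mul_x, map_zero, LinearMap.zero_apply]

@[simp] theorem opY_opY : A.opY (A.opY a) = 0 := by
  simp only [opY, ← Module.End.mul_apply, ← map_mul, HH.y_mul_y, map_zero, LinearMap.zero_apply]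

theorem opG_opX : A.opG (A.opX a) = -A.opX (A.opG a) := by
  simp only [opG, opX, ← Module.End.mul_apply, ← map_mul, HH.g_mul_x, map_neg, LinearMap.neg_apply]

theorem opH_opY : A.opH (A.opY a) = -A.opY (A.opH a) := by
  simp only [opH, opY, ← Module.End.mul_apply, ← map_mul, HH.h_mul_y, map_neg, LinearMap.neg_apply]

theorem opG_opH : A.opG (A.opH a) = A.opH (A.opG a) := by
  simp only [opG, opH, ← Module.End.mul_apply, ← map_mul, HH.g_mul_h]

theorem opG_opY : A.opG (A.opY a) = A.opY (A.opG a) := by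
  simp only [opG, opY, ← Module.End.mul_apply, ← map_mul, HH.g_mul_y]

theorem opH_opX : A.opH (A.opX a) = A.opX (A.opH a) := by
  simp only [opH, opX, ← Module.End.mul_apply, ← map_mul, HH.h_mul_x]

theorem opY_opX : A.opY (A.opX a) = A.opX (A.opY a) := by
  simp only [opX, opY, ← Module.End.mul_apply, ← map_mul, HH.x_mul_y]

end relations

/-- A linear map is a homomorphism of modules if it commutes with the four generators. -/
structure IsHom (A B : HHModule K) (φ : A.carrier →ₗ[K] B.carrier) : Prop where
  g : ∀ a, φ (A.opG a) = B.opG (φ a)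
  h : ∀ a, φ (A.opH a) = B.opH (φ a)
  x : ∀ a, φ (A.opX a) = B.opX (φ a)
  y : ∀ a, φ (A.opY a) = B.opY (φ a)

theorem IsHom.map_ρ {A B : HHModule K} {φ : A.carrier →ₗ[K] B.carrier} (hφ : IsHom A B φ)
    (w : HH K) : ∀ a, φ (A.ρ w a) = B.ρ w (φ a) := by
  induction w using HH.gen_induction with
  | hK c => intro a; simp [Algebra.algebraMap_eq_smul_one]
  | hg => exact hφ.g
  | hh => exact hφ.h
  | hx => exact hφ.x
  | hy => exact hφ.y
  | hadd v w hv hw => intro a; simp [hv, hw]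
  | hmul v w hv hw => intro a; simp [hv, hw]

theorem Iso.of_isHom {A B : HHModule K} (e : A.carrier ≃ₗ[K] B.carrier)
    (he : IsHom A B e.toLinearMap) : A ≅ₕ B :=
  ⟨e, fun w a => he.map_ρ w a⟩

theorem Iso.exists_isHom {A B : HHModule K} (e : A ≅ₕ B) :
    ∃ e : A.carrier ≃ₗ[K] B.carrier, IsHom A B e.toLinearMap := by
  obtain ⟨e, he⟩ := e
  exact ⟨e, ⟨he _, he _, he _, he _⟩⟩

theorem Iso.refl (A : HHModule K) : A ≅ₕ A := ⟨LinearEquiv.refl K _, fun _ _ => rfl⟩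

theorem Iso.symm {A B : HHModule K} : A ≅ₕ B → B ≅ₕ A := by
  rintro ⟨e, he⟩
  exact ⟨e.symm, fun w v => by rw [LinearEquiv.symm_apply_eq, he, LinearEquiv.apply_symm_apply]⟩

theorem Iso.trans {A B C : HHModule K} : A ≅ₕ B → B ≅ₕ C → A ≅ₕ C := by
  rintro ⟨e, he⟩ ⟨f, hf⟩
  exact ⟨e.trans f, fun w v => by simp [he, hf]⟩

/-! ### Direct sums and products -/

theorem Iso.sum {A A' B B' : HHModule K} : A ≅ₕ A' → B ≅ₕ B' → A ⊕ₕ B ≅ₕ A' ⊕ₕ B' := by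
  rintro ⟨e, he⟩ ⟨f, hf⟩
  exact ⟨e.prodCongr f, fun w v => Prod.ext (he w v.1) (hf w v.2)⟩

theorem sum_assoc (A B C : HHModule K) : (A ⊕ₕ B) ⊕ₕ C ≅ₕ A ⊕ₕ B ⊕ₕ C :=
  ⟨LinearEquiv.prodAssoc K A.carrier B.carrier C.carrier, fun _ _ => rfl⟩

theorem sum_comm (A B : HHModule K) : A ⊕ₕ B ≅ₕ B ⊕ₕ A :=
  ⟨LinearEquiv.prodComm K A.carrier B.carrier, fun _ _ => rfl⟩

/-- The direct product of a family of modules. -/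
def pi {ι : Type} (A : ι → HHModule K) : HHModule K where
  carrier := ∀ i, (A i).carrier
  ρ := AlgHom.ofLinearMap
    { toFun := fun w => LinearMap.pi fun i => ((A i).ρ w).comp (LinearMap.proj i)
      map_add' := by intro p q; ext; simp
      map_smul' := by intro p q; ext; simp }
    (by ext; simp)
    (by intro p q; ext; simp)

theorem Iso.power {A B : HHModule K} (n : ℕ) : A ≅ₕ B → A ^⊕ n ≅ₕ B ^⊕ n := by
  rintro ⟨e, he⟩
  exact ⟨LinearEquiv.piCongrRight fun _ => e, fun w v => funext fun i => he w (v i)⟩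

theorem pi_const_iso (A : HHModule K) (n : ℕ) : pi (fun _ : Fin n => A) ≅ₕ A ^⊕ n :=
  ⟨LinearEquiv.refl K _, fun _ _ => rfl⟩

theorem pi_reindex {ι κ : Type} (e : κ ≃ ι) (A : ι → HHModule K) :
    pi A ≅ₕ pi fun k => A (e k) :=
  ⟨(LinearEquiv.piCongrLeft K (fun i => (A i).carrier) e).symm, fun _ _ => rfl⟩

theorem pi_sum {ι κ : Type} (A : ι ⊕ κ → HHModule K) :
    pi A ≅ₕ pi (fun i => A (.inl i)) ⊕ₕ pi (fun k => A (.inr k)) :=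
  ⟨LinearEquiv.sumPiEquivProdPi K ι κ fun i => (A i).carrier, fun _ _ => rfl⟩

/-! ### Tensor products -/

section tensor

variable {A B : HHModule K}

/-- The pure tensor of two vectors, as a bilinear map into the tensor product module. -/
def tm : A.carrier →ₗ[K] B.carrier →ₗ[K] (A ⊗ₕ B).carrier :=
  TensorProduct.mk K A.carrier B.carrier

theorem tensor_induction {p : (A ⊗ₕ B).carrier → Prop} (h0 : p 0) (ht : ∀ a b, p (tm a b))
    (ha : ∀ v w, p v → p w → p (v + w)) (z : (A ⊗ₕ B).carrier) : p z :=
  TensorProduct.induction_on (motive := p) z h0 ht ha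

theorem tensor_ρ (w : HH K) : (A ⊗ₕ B).ρ w =
    Module.endTensorEndAlgHom (R := K) (S := K) (A := K)
      (Algebra.TensorProduct.map A.ρ B.ρ (Coalgebra.comul (R := K) w)) := rfl

theorem comul_a : Coalgebra.comul (R := K) (H4.a K) = H4.a K ⊗ₜ[K] H4.a K := by
  change H4.comulHom K (H4.a K) = _
  simp [H4.comulHom]

theorem comul_b : Coalgebra.comul (R := K) (H4.b K) =
    H4.b K ⊗ₜ[K] 1 + H4.a K ⊗ₜ[K] H4.b K := by
  change H4.comulHom K (H4.b K) = _
  simp [H4.comulHom]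

theorem comul_one : Coalgebra.comul (R := K) (1 : H4 K) = 1 ⊗ₜ[K] 1 := by
  rw [Bialgebra.comul_one, Algebra.TensorProduct.one_def]

@[simp] theorem opG_tm (a : A.carrier) (b : B.carrier) :
    (A ⊗ₕ B).opG (tm a b) = tm (A.opG a) (B.opG b) := by
  unfold opG
  rw [tensor_ρ, HH.g, TensorProduct.comul_tmul, comul_a, comul_one]
  rfl

@[simp] theorem opH_tm (a : A.carrier) (b : B.carrier) :
    (A ⊗ₕ B).opH (tm a b) = tm (A.opH a) (B.opH b) := by
  unfold opH
  rw [tensor_ρ, HH.h, TensorProduct.comul_tmul, comul_a, comul_one]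
  rfl

@[simp] theorem opX_tm (a : A.carrier) (b : B.carrier) :
    (A ⊗ₕ B).opX (tm a b) = tm (A.opX a) b + tm (A.opG a) (B.opX b) := by
  unfold opX opG
  rw [tensor_ρ, HH.x, TensorProduct.comul_tmul, comul_b, comul_one, TensorProduct.add_tmul]
  simp only [map_add]
  simp only [TensorProduct.AlgebraTensorModule.tensorTensorTensorComm_tmul,
    Algebra.TensorProduct.map_tmul]
  have h1 : (1 : H4 K) ⊗ₜ[K] (1 : H4 K) = (1 : HH K) := rfl
  rw [h1, map_one]
  rfl

@[simp] theorem opY_tm (a : A.carrier) (b : B.carrier) :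
    (A ⊗ₕ B).opY (tm a b) = tm (A.opY a) b + tm (A.opH a) (B.opY b) := by
  unfold opY opH
  rw [tensor_ρ, HH.y, TensorProduct.comul_tmul, comul_b, comul_one, TensorProduct.tmul_add]
  simp only [map_add]
  simp only [TensorProduct.AlgebraTensorModule.tensorTensorTensorComm_tmul,
    Algebra.TensorProduct.map_tmul]
  have h1 : (1 : H4 K) ⊗ₜ[K] (1 : H4 K) = (1 : HH K) := rfl
  rw [h1, map_one]
  rfl

/-- Contraction of the left factor of a tensor product by a functional. -/
def lc (f : A.carrier →ₗ[K] K) : (A ⊗ₕ B).carrier →ₗ[K] B.carrier :=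
  TensorProduct.lift ((LinearMap.lsmul K B.carrier).comp f)

/-- Contraction of the right factor of a tensor product by a functional. -/
def rc (f : B.carrier →ₗ[K] K) : (A ⊗ₕ B).carrier →ₗ[K] A.carrier :=
  TensorProduct.lift ((LinearMap.lsmul K A.carrier).comp f).flip

@[simp] theorem lc_tm (f : A.carrier →ₗ[K] K) (a : A.carrier) (b : B.carrier) :
    lc f (tm a b) = f a • b := rfl

@[simp] theorem rc_tm (f : B.carrier →ₗ[K] K) (a : A.carrier) (b : B.carrier) :
    rc f (tm a b) = f b • a := rfl

/-- The tensor product of two linear maps. -/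
def tmap {A' B' : HHModule K} (f : A.carrier →ₗ[K] A'.carrier) (g : B.carrier →ₗ[K] B'.carrier) :
    (A ⊗ₕ B).carrier →ₗ[K] (A' ⊗ₕ B').carrier :=
  TensorProduct.map f g

@[simp] theorem tmap_tm {A' B' : HHModule K} (f : A.carrier →ₗ[K] A'.carrier)
    (g : B.carrier →ₗ[K] B'.carrier) (a : A.carrier) (b : B.carrier) :
    tmap f g (tm a b) = tm (f a) (g b) := rfl

theorem finrank_tensor : Module.finrank K (A ⊗ₕ B).carrier =
    Module.finrank K A.carrier * Module.finrank K B.carrier :=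
  Module.finrank_tensorProduct

theorem finite_tensor [Module.Finite K A.carrier] [Module.Finite K B.carrier] :
    Module.Finite K (A ⊗ₕ B).carrier :=
  inferInstanceAs (Module.Finite K (A.carrier ⊗[K] B.carrier))

/-- Commutation with the generators has to be checked on pure tensors only. -/
theorem isHom_of_tm {C : HHModule K} (φ : (A ⊗ₕ B).carrier →ₗ[K] C.carrier)
    (hg : ∀ a b, φ (tm (A.opG a) (B.opG b)) = C.opG (φ (tm a b)))
    (hh : ∀ a b, φ (tm (A.opH a) (B.opH b)) = C.opH (φ (tm a b)))
    (hx : ∀ a b, φ (tm (A.opX a) b) + φ (tm (A.opG a) (B.opX b)) = C.opX (φ (tm a b)))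
    (hy : ∀ a b, φ (tm (A.opY a) b) + φ (tm (A.opH a) (B.opY b)) = C.opY (φ (tm a b))) :
    IsHom (A ⊗ₕ B) C φ := by
  constructor <;> intro z <;> induction z using tensor_induction with
    | h0 => simp only [map_zero]
    | ht a b => simp only [opG_tm, opH_tm, opX_tm, opY_tm, map_add, hg, hh, hx, hy]
    | ha v w hv hw => simp only [map_add, hv, hw]

/-- The tensor product of two linear equivalences. -/
def tequiv {A' B' : HHModule K} (e : A.carrier ≃ₗ[K] A'.carrier) (f : B.carrier ≃ₗ[K] B'.carrier) :
    (A ⊗ₕ B).carrier ≃ₗ[K] (A' ⊗ₕ B').carrier :=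
  TensorProduct.congr e f

@[simp] theorem tequiv_tm {A' B' : HHModule K} (e : A.carrier ≃ₗ[K] A'.carrier)
    (f : B.carrier ≃ₗ[K] B'.carrier) (a : A.carrier) (b : B.carrier) :
    tequiv e f (tm a b) = tm (e a) (f b) := rfl

theorem Iso.tensor {A' B' : HHModule K} (h : A ≅ₕ A') (h' : B ≅ₕ B') : A ⊗ₕ B ≅ₕ A' ⊗ₕ B' := by
  obtain ⟨e, he⟩ := h.exists_isHom
  obtain ⟨f, hf⟩ := h'.exists_isHom
  have e1 := he.g; have e2 := he.h; have e3 := he.x; have e4 := he.y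
  have f1 := hf.g; have f2 := hf.h; have f3 := hf.x; have f4 := hf.y
  simp only [LinearEquiv.coe_coe] at e1 e2 e3 e4 f1 f2 f3 f4
  refine Iso.of_isHom (tequiv e f) (isHom_of_tm _ ?_ ?_ ?_ ?_) <;> intro a b <;>
    simp [e1, e2, e3, e4, f1, f2, f3, f4]

/-! ### The symmetry of the tensor product -/

/-- The flip of the two factors. -/
def flip : (A ⊗ₕ B).carrier →ₗ[K] (B ⊗ₕ A).carrier :=
  (TensorProduct.comm K A.carrier B.carrier).toLinearMap

@[simp] theorem flip_tm (a : A.carrier) (b : B.carrier) : flip (tm a b) = tm b a := rfl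

/-- The sign `(-1)^(|a| |b|)` on `a ⊗ b`, for the gradings given by involutions `S` and `T`. -/
def superSign (S : Module.End K A.carrier) (T : Module.End K B.carrier) :
    Module.End K (A ⊗ₕ B).carrier :=
  (2 : K)⁻¹ • (tmap LinearMap.id LinearMap.id + tmap S LinearMap.id + tmap LinearMap.id T - tmap S T)

theorem superSign_tm (S : Module.End K A.carrier) (T : Module.End K B.carrier) (a : A.carrier)
    (b : B.carrier) : superSign S T (tm a b) =
      (2 : K)⁻¹ • (tm a b + tm (S a) b + tm a (T b) - tm (S a) (T b)) := rfl

/-- The braiding `A ⊗ B → B ⊗ A`: the flip with the signs of both gradings. It comes from the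
triangular structure `½(1 ⊗ 1 + 1 ⊗ a + a ⊗ 1 - a ⊗ a)` of each factor `H₄`. -/
def braid : (A ⊗ₕ B).carrier →ₗ[K] (B ⊗ₕ A).carrier :=
  flip ∘ₗ superSign A.opG B.opG ∘ₗ superSign A.opH B.opH

theorem braid_isHom : IsHom (A ⊗ₕ B) (B ⊗ₕ A) braid := by
  refine isHom_of_tm _ ?_ ?_ ?_ ?_ <;> intro a b <;>
    simp only [braid, LinearMap.comp_apply, superSign_tm, map_smul, map_add, map_sub, flip_tm,
      opG_tm, opH_tm, opX_tm, opY_tm, opG_opG, opH_opH, opG_opX, opH_opY, opG_opH, opG_opY,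
      opH_opX, map_neg, LinearMap.neg_apply] <;> module

theorem braid_braid [CharZero K] (z : (A ⊗ₕ B).carrier) : braid (braid z) = z := by
  induction z using tensor_induction with
  | h0 => simp only [map_zero]
  | ht a b =>
    simp only [braid, LinearMap.comp_apply, superSign_tm, map_smul, map_add, map_sub, flip_tm,
      opG_opG, opH_opH, opG_opH]
    match_scalars <;> field_simp <;> norm_num
  | ha v w hv hw => simp only [map_add, hv, hw]

theorem tensor_comm [CharZero K] : A ⊗ₕ B ≅ₕ B ⊗ₕ A :=
  Iso.of_isHom (LinearEquiv.ofLinearMap braid braid (LinearMap.ext braid_braid)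
    (LinearMap.ext braid_braid)) braid_isHom

end tensor

/-! ### Signs as scalars -/

/-- A sign, as a scalar. -/
def sc (s : ℤˣ) : K := ((s : ℤ) : K)

@[simp] theorem sc_one : sc (K := K) 1 = 1 := by simp [sc]

@[simp] theorem sc_neg (s : ℤˣ) : sc (K := K) (-s) = -sc s := by simp [sc]

@[simp] theorem sc_mul (s t : ℤˣ) : sc (K := K) (s * t) = sc s * sc t := by simp [sc]

@[simp] theorem sc_pow (s : ℤˣ) (n : ℕ) : sc (K := K) (s ^ n) = sc s ^ n := by simp [sc]

theorem sc_mul_self (s : ℤˣ) : sc (K := K) s * sc s = 1 := by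
  rw [← sc_mul, Int.units_mul_self, sc_one]

/-! ### One-dimensional modules and twists -/

/-- The basis vector of the one-dimensional module. -/
def oneS (s t : ℤˣ) : (S K s t).carrier := (1 : K)

theorem S_ops (s t : ℤˣ) : (S K s t).opG (oneS s t) = (sc s : K) • oneS s t ∧
    (S K s t).opH (oneS s t) = (sc t : K) • oneS s t ∧
    (S K s t).opX (oneS s t) = 0 ∧ (S K s t).opY (oneS s t) = 0 := by
  have h1 : ((sc s : K) • 1 : Module.End K K) * ((sc t : K) • 1) = ((sc t : K) • 1) * ((sc s : K) • 1) := by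
    rw [smul_mul_smul_comm, smul_mul_smul_comm, mul_comm]
  have h2 : ((sc s : K) • 1 : Module.End K K) * 0 = 0 * ((sc s : K) • 1) := by simp
  have h3 : (0 : Module.End K K) * ((sc t : K) • 1) = ((sc t : K) • 1) * 0 := by simp
  exact ⟨LinearMap.congr_fun (opsHom_g ((sc s : K) • 1) ((sc t : K) • 1) 0 0 _ _ _ _ _ _ h1 h2 h3 rfl) (1 : K),
    LinearMap.congr_fun (opsHom_h ((sc s : K) • 1) ((sc t : K) • 1) 0 0 _ _ _ _ _ _ h1 h2 h3 rfl) (1 : K),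
    LinearMap.congr_fun (opsHom_x ((sc s : K) • 1) ((sc t : K) • 1) 0 0 _ _ _ _ _ _ h1 h2 h3 rfl) (1 : K),
    LinearMap.congr_fun (opsHom_y ((sc s : K) • 1) ((sc t : K) • 1) 0 0 _ _ _ _ _ _ h1 h2 h3 rfl) (1 : K)⟩

/-- The linear identification `a ↦ a ⊗ 1` of a module with its twist. -/
def tl (A : HHModule K) (s t : ℤˣ) : A.carrier ≃ₗ[K] (A.twist s t).carrier :=
  (TensorProduct.rid K A.carrier).symm

theorem tl_apply (A : HHModule K) (s t : ℤˣ) (a : A.carrier) :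
    tl A s t a = tm a (oneS s t) := rfl

section

variable (A : HHModule K) (s t : ℤˣ) (a : A.carrier)

@[simp] theorem opG_tl : (A.twist s t).opG (tl A s t a) = (sc s : K) • tl A s t (A.opG a) := by
  rw [tl_apply, tl_apply]
  refine (opG_tm a _).trans ?_
  rw [(S_ops s t |>.1), map_smul]; rfl

@[simp] theorem opH_tl : (A.twist s t).opH (tl A s t a) = (sc t : K) • tl A s t (A.opH a) := by
  rw [tl_apply, tl_apply]
  refine (opH_tm a _).trans ?_
  rw [(S_ops s t |>.2.1), map_smul]; rfl

@[simp] theorem opX_tl : (A.twist s t).opX (tl A s t a) = tl A s t (A.opX a) := by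
  rw [tl_apply, tl_apply]
  refine (opX_tm a _).trans ?_
  rw [(S_ops s t |>.2.2.1), map_zero, add_zero]

@[simp] theorem opY_tl : (A.twist s t).opY (tl A s t a) = tl A s t (A.opY a) := by
  rw [tl_apply, tl_apply]
  refine (opY_tm a _).trans ?_
  rw [(S_ops s t |>.2.2.2), map_zero, add_zero]

end

/-- A linear bijection that commutes with `x`, `y` and with `g`, `h` up to the signs `s`, `t` is an
isomorphism from the twist. -/
theorem twist_iso_of {A B : HHModule K} {s t : ℤˣ} (e : A.carrier ≃ₗ[K] B.carrier)
    (hg : ∀ a, (sc s : K) • e (A.opG a) = B.opG (e a))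
    (hh : ∀ a, (sc t : K) • e (A.opH a) = B.opH (e a))
    (hx : ∀ a, e (A.opX a) = B.opX (e a)) (hy : ∀ a, e (A.opY a) = B.opY (e a)) :
    A.twist s t ≅ₕ B := by
  refine Iso.of_isHom ((tl A s t).symm.trans e) ⟨?_, ?_, ?_, ?_⟩ <;> intro z <;>
    obtain ⟨a, rfl⟩ := (tl A s t).surjective z <;> simp [hg, hh, hx, hy]

theorem Iso.twist {A B : HHModule K} (h : A ≅ₕ B) (s t : ℤˣ) : A.twist s t ≅ₕ B.twist s t :=
  h.tensor (Iso.refl _)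

theorem twist_one (A : HHModule K) : A.twist 1 1 ≅ₕ A :=
  twist_iso_of (LinearEquiv.refl K _) (by simp) (by simp) (by simp) (by simp)

theorem twist_twist (A : HHModule K) (s t s' t' : ℤˣ) :
    (A.twist s t).twist s' t' ≅ₕ A.twist (s * s') (t * t') := by
  refine twist_iso_of ((tl A s t).symm.trans (tl A (s * s') (t * t'))) ?_ ?_ ?_ ?_ <;> intro z <;>
    obtain ⟨a, rfl⟩ := (tl A s t).surjective z <;> simp [smul_smul, mul_comm]

/-! ### The projective module `P` in coordinates -/

/-- The action of `g` on `P_{s t}` in the coordinates of `F1`. -/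
def F1.G (s : ℤˣ) : Module.End K (K × K × K × K) where
  toFun z := (sc s * z.1, -(sc s * z.2.1), sc s * z.2.2.1, -(sc s * z.2.2.2))
  map_add' v w := by simp only [Prod.fst_add, Prod.snd_add, Prod.mk_add_mk, mul_add, neg_add]
  map_smul' c w := by
    simp only [Prod.smul_fst, Prod.smul_snd, Prod.smul_mk, smul_eq_mul, RingHom.id_apply, mul_neg,
      mul_left_comm]

/-- The action of `h` on `P_{s t}` in the coordinates of `F1`. -/
def F1.H (t : ℤˣ) : Module.End K (K × K × K × K) where
  toFun z := (sc t * z.1, sc t * z.2.1, -(sc t * z.2.2.1), -(sc t * z.2.2.2))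
  map_add' v w := by simp only [Prod.fst_add, Prod.snd_add, Prod.mk_add_mk, mul_add, neg_add]
  map_smul' c w := by
    simp only [Prod.smul_fst, Prod.smul_snd, Prod.smul_mk, smul_eq_mul, RingHom.id_apply, mul_neg,
      mul_left_comm]

/-- The action of `x` on `P_{s t}` in the coordinates of `F1`. -/
def F1.X : Module.End K (K × K × K × K) where
  toFun z := (0, z.1, 0, z.2.2.1)
  map_add' v w := by simp only [Prod.fst_add, Prod.snd_add, Prod.mk_add_mk, add_zero]
  map_smul' c w := by
    simp only [Prod.smul_fst, Prod.smul_snd, Prod.smul_mk, smul_zero, RingHom.id_apply]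

/-- The action of `y` on `P_{s t}` in the coordinates of `F1`. -/
def F1.Y : Module.End K (K × K × K × K) where
  toFun z := (0, 0, z.1, z.2.1)
  map_add' v w := by simp only [Prod.fst_add, Prod.snd_add, Prod.mk_add_mk, add_zero]
  map_smul' c w := by
    simp only [Prod.smul_fst, Prod.smul_snd, Prod.smul_mk, smul_zero, RingHom.id_apply]

theorem sc_mul_sc_mul (s : ℤˣ) (c : K) : sc s * (sc s * c) = c := by
  rw [← mul_assoc, sc_mul_self, one_mul]

theorem F1.G_mul_H (s t : ℤˣ) : F1.G (K := K) s * F1.H t = F1.H t * F1.G s := by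
  refine LinearMap.ext fun z => ?_; simp [F1.G, F1.H, mul_left_comm]

theorem F1.G_mul_Y (s : ℤˣ) : F1.G (K := K) s * F1.Y = F1.Y * F1.G s := by
  refine LinearMap.ext fun z => ?_; simp [F1.G, F1.Y]

theorem F1.X_mul_H (t : ℤˣ) : F1.X (K := K) * F1.H t = F1.H t * F1.X := by
  refine LinearMap.ext fun z => ?_; simp [F1.X, F1.H]

theorem F1.X_mul_Y : F1.X (K := K) * F1.Y = F1.Y * F1.X := by
  refine LinearMap.ext fun z => ?_; simp [F1.X, F1.Y]

/-- The twist `P_{s t}` in coordinates: `(a, b, c, d)` stands for `a e + b xe + c ye + d xye`, where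
`e` is a generator of signs `(s, t)`. -/
def F1 (K : Type u) [Field K] (s t : ℤˣ) : HHModule K where
  carrier := K × K × K × K
  ρ := opsHom (F1.G s) (F1.H t) F1.X F1.Y
    (by refine LinearMap.ext fun z => ?_; simp [F1.G, sc_mul_sc_mul])
    (by refine LinearMap.ext fun z => ?_; simp [F1.X])
    (by refine LinearMap.ext fun z => ?_; simp [F1.G, F1.X])
    (by refine LinearMap.ext fun z => ?_; simp [F1.H, sc_mul_sc_mul])
    (by refine LinearMap.ext fun z => ?_; simp [F1.Y])
    (by refine LinearMap.ext fun z => ?_; simp [F1.H, F1.Y])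
    (F1.G_mul_H s t) (F1.G_mul_Y s) (F1.X_mul_H t) F1.X_mul_Y

/-- The coordinates of `F1`, as a linear equivalence. -/
def F1.mk (s t : ℤˣ) : (K × K × K × K) ≃ₗ[K] (F1 K s t).carrier := LinearEquiv.refl K _

section

variable (s t : ℤˣ) (z : K × K × K × K)

@[simp] theorem F1_opG : (F1 K s t).opG (F1.mk s t z) = F1.mk s t (F1.G s z) :=
  LinearMap.congr_fun (opsHom_g _ _ _ _ _ _ _ _ _ _
    (F1.G_mul_H s t) (F1.G_mul_Y s) (F1.X_mul_H t) F1.X_mul_Y) z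

@[simp] theorem F1_opH : (F1 K s t).opH (F1.mk s t z) = F1.mk s t (F1.H t z) :=
  LinearMap.congr_fun (opsHom_h _ _ _ _ _ _ _ _ _ _
    (F1.G_mul_H s t) (F1.G_mul_Y s) (F1.X_mul_H t) F1.X_mul_Y) z

@[simp] theorem F1_opX : (F1 K s t).opX (F1.mk s t z) = F1.mk s t (F1.X z) :=
  LinearMap.congr_fun (opsHom_x _ _ _ _ _ _ _ _ _ _
    (F1.G_mul_H s t) (F1.G_mul_Y s) (F1.X_mul_H t) F1.X_mul_Y) z

@[simp] theorem F1_opY : (F1 K s t).opY (F1.mk s t z) = F1.mk s t (F1.Y z) :=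
  LinearMap.congr_fun (opsHom_y _ _ _ _ _ _ _ _ _ _
    (F1.G_mul_H s t) (F1.G_mul_Y s) (F1.X_mul_H t) F1.X_mul_Y) z

end

/-- The linear map from `P_{s t}` that sends the generator to `w`. -/
def genMap {A : HHModule K} (s t : ℤˣ) (w : A.carrier) : (F1 K s t).carrier →ₗ[K] A.carrier :=
  (show (K × K × K × K) →ₗ[K] A.carrier from
    { toFun z := z.1 • w + z.2.1 • A.opX w + z.2.2.1 • A.opY w + z.2.2.2 • A.opX (A.opY w)
      map_add' := by intro v w; simp only [Prod.fst_add, Prod.snd_add]; module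
      map_smul' := by
        intro v w; simp only [Prod.smul_fst, Prod.smul_snd, RingHom.id_apply, smul_eq_mul]; module })
    ∘ₗ (F1.mk s t).symm.toLinearMap

theorem genMap_mk {A : HHModule K} (s t : ℤˣ) (w : A.carrier) (a b c d : K) :
    genMap s t w (F1.mk s t (a, b, c, d)) =
      a • w + b • A.opX w + c • A.opY w + d • A.opX (A.opY w) := rfl

theorem genMap_isHom {A : HHModule K} {s t : ℤˣ} {w : A.carrier} (hg : A.opG w = (sc s : K) • w)
    (hh : A.opH w = (sc t : K) • w) : IsHom (F1 K s t) A (genMap s t w) := by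
  constructor <;> intro z <;> obtain ⟨⟨a, b, c, d⟩, rfl⟩ := (F1.mk s t).surjective z <;>
    simp only [F1_opG, F1_opH, F1_opX, F1_opY, F1.G, F1.H, F1.X, F1.Y, LinearMap.coe_mk,
      AddHom.coe_mk, genMap_mk, map_add, map_smul, opG_opX, opH_opY,
      opG_opY, opH_opX, opY_opX, opX_opX, opY_opY, hg, hh, map_neg, map_zero] <;> module

/-- An element of the left ideal `P`, as an element of `H₄ ⊗ H₄`. -/
def P.val : (P K).carrier →ₗ[K] HH K :=
  ((Ideal.span {HH.e₁ K} : Ideal (HH K)).subtype.restrictScalars K :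
    ↥(Ideal.span {HH.e₁ K} : Ideal (HH K)) →ₗ[K] HH K)

theorem P.val_ρ (w : HH K) (p : (P K).carrier) : P.val ((P K).ρ w p) = w * P.val p := rfl

theorem P.val_injective : Function.Injective (P.val (K := K)) := Subtype.val_injective

/-- The generator `e₁` of `P`. -/
def P.gen : (P K).carrier := ⟨HH.e₁ K, Ideal.subset_span rfl⟩

theorem P.val_gen : P.val P.gen = HH.e₁ K := rfl

theorem P.exists_eq (p : (P K).carrier) : ∃ w, p = (P K).ρ w P.gen := by
  obtain ⟨w, hw⟩ := Ideal.mem_span_singleton'.mp p.2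
  exact ⟨w, P.val_injective hw.symm⟩

theorem P.opG_gen : (P K).opG P.gen = (sc 1 : K) • P.gen := by
  apply P.val_injective
  rw [opG, P.val_ρ, map_smul, P.val_gen]
  simp only [sc_one, one_smul, HH.e₁, mul_smul_comm, mul_add, HH.g_mul_g, ← mul_assoc, mul_one,
    one_mul]
  abel_nf

theorem P.opH_gen : (P K).opH P.gen = (sc 1 : K) • P.gen := by
  apply P.val_injective
  rw [opH, P.val_ρ, map_smul, P.val_gen]
  simp only [sc_one, one_smul, HH.e₁, mul_smul_comm, mul_add, HH.g_mul_h, HH.h_mul_h, ← mul_assoc,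
    mul_one, one_mul]
  abel_nf

/-- The vector `e₁` has the signs `(1, 1)`, so it defines a homomorphism from the coordinate module to
`P`. Its inverse is `w ↦ w v₀` for the generator `v₀` of the coordinate module, as `e₁ v₀ = v₀`. -/
theorem P_iso_F1 [CharZero K] : P K ≅ₕ F1 K 1 1 := by
  -- the map `w ↦ w v₀` to the coordinate module
  let v₀ : (F1 K 1 1).carrier := F1.mk 1 1 (1, 0, 0, 0)
  let ψ : (P K).carrier →ₗ[K] (F1 K 1 1).carrier :=
    (LinearMap.applyₗ v₀ ∘ₗ (F1 K 1 1).ρ.toLinearMap) ∘ₗ P.val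
  have hψ : ∀ w p, ψ ((P K).ρ w p) = (F1 K 1 1).ρ w (ψ p) := by
    intro w p
    simp [ψ, P.val_ρ]
  have hψe : ψ P.gen = v₀ := by
    have h1 : ψ P.gen = (4 : K)⁻¹ • (v₀ + (F1 K 1 1).opG v₀ +
        (F1 K 1 1).opH v₀ + (F1 K 1 1).opG ((F1 K 1 1).opH v₀)) := by
      simp [ψ, P.val_gen, HH.e₁, opG, opH]
    have h2 : (F1 K 1 1).opG v₀ = v₀ := by simp [v₀, F1.G]
    have h3 : (F1 K 1 1).opH v₀ = v₀ := by simp [v₀, F1.H]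
    rw [h1, h3, h2]
    match_scalars
    norm_num
  have hφ := genMap_isHom (P.opG_gen (K := K)) P.opH_gen
  have hv₀ : genMap 1 1 P.gen v₀ = P.gen := by simp [v₀, genMap_mk]
  have hinv : ∀ p, genMap 1 1 P.gen (ψ p) = p := by
    intro p
    obtain ⟨w, rfl⟩ := P.exists_eq p
    rw [hψ, hφ.map_ρ, hψe, hv₀]
  refine ⟨LinearEquiv.ofLinearMap ψ (genMap 1 1 P.gen) ?_ (LinearMap.ext hinv), hψ⟩
  refine LinearMap.ext fun z => ?_
  have hx : ∀ p, ψ ((P K).opX p) = (F1 K 1 1).opX (ψ p) := hψ _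
  have hy : ∀ p, ψ ((P K).opY p) = (F1 K 1 1).opY (ψ p) := hψ _
  obtain ⟨⟨a, b, c, d⟩, rfl⟩ := (F1.mk 1 1).surjective z
  apply (F1.mk 1 1).symm.injective
  simp [genMap_mk, hx, hy, hψe, v₀, F1.X, F1.Y]

theorem twist_P_iso_F1 [CharZero K] (s t : ℤˣ) : (P K).twist s t ≅ₕ F1 K s t := by
  refine (P_iso_F1.twist s t).trans (twist_iso_of ((F1.mk 1 1).symm.trans (F1.mk s t)) ?_ ?_ ?_ ?_)
    <;> intro z <;> obtain ⟨z, rfl⟩ := (F1.mk 1 1).surjective z <;>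
    simp [F1.G, F1.H, ← map_smul]

/-! ### Exchanging the two tensor factors of `H₄ ⊗ H₄` -/

/-- The module obtained by exchanging `(g, x)` with `(h, y)`. It is compatible with direct sums and
tensor products, and interchanges the shapes of `N` and `N'`, while `M` and `W` keep theirs. -/
def swap (A : HHModule K) : HHModule K where
  carrier := A.carrier
  ρ := A.ρ.comp (Algebra.TensorProduct.comm K (H4 K) (H4 K)).toAlgHom

/-- A vector of `A`, as a vector of `swap A`. -/
def sw (A : HHModule K) : A.carrier ≃ₗ[K] A.swap.carrier := LinearEquiv.refl K _

section

variable (A : HHModule K) (a : A.carrier)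

@[simp] theorem opG_sw : A.swap.opG (A.sw a) = A.sw (A.opH a) := rfl

@[simp] theorem opH_sw : A.swap.opH (A.sw a) = A.sw (A.opG a) := rfl

@[simp] theorem opX_sw : A.swap.opX (A.sw a) = A.sw (A.opY a) := rfl

@[simp] theorem opY_sw : A.swap.opY (A.sw a) = A.sw (A.opX a) := rfl

end

/-- A linear bijection that exchanges the actions of `(g, x)` and `(h, y)` is an isomorphism from
the swapped module. -/
theorem swap_iso_of {A B : HHModule K} (e : A.carrier ≃ₗ[K] B.carrier)
    (hg : ∀ a, e (A.opG a) = B.opH (e a)) (hh : ∀ a, e (A.opH a) = B.opG (e a))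
    (hx : ∀ a, e (A.opX a) = B.opY (e a)) (hy : ∀ a, e (A.opY a) = B.opX (e a)) :
    A.swap ≅ₕ B := by
  refine Iso.of_isHom ((sw A).symm.trans e) ⟨?_, ?_, ?_, ?_⟩ <;> intro z <;>
    obtain ⟨a, rfl⟩ := (sw A).surjective z <;> simp [hg, hh, hx, hy]

theorem Iso.swap {A B : HHModule K} : A ≅ₕ B → A.swap ≅ₕ B.swap := by
  rintro ⟨e, he⟩
  exact ⟨e, fun w v => he _ v⟩

theorem swap_swap (A : HHModule K) : A.swap.swap ≅ₕ A :=
  swap_iso_of (sw A).symm (fun _ => rfl) (fun _ => rfl) (fun _ => rfl) (fun _ => rfl)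

theorem Iso.of_swap {A B : HHModule K} (h : A.swap ≅ₕ B.swap) : A ≅ₕ B :=
  (swap_swap A).symm.trans (h.swap.trans (swap_swap B))

theorem swap_sum (A B : HHModule K) : (A ⊕ₕ B).swap ≅ₕ A.swap ⊕ₕ B.swap :=
  ⟨LinearEquiv.refl K _, fun _ _ => rfl⟩

theorem swap_power (A : HHModule K) (n : ℕ) : (A ^⊕ n).swap ≅ₕ A.swap ^⊕ n :=
  ⟨LinearEquiv.refl K _, fun _ _ => rfl⟩

theorem swap_tensor (A B : HHModule K) : (A ⊗ₕ B).swap ≅ₕ A.swap ⊗ₕ B.swap := by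
  have h := isHom_of_tm (A := A) (B := B) (C := (A.swap ⊗ₕ B.swap).swap)
    ((sw _).toLinearMap ∘ₗ (tequiv (sw A) (sw B)).toLinearMap)
    (by intro a b; simp) (by intro a b; simp) (by intro a b; simp) (by intro a b; simp)
  exact Iso.trans (Iso.swap (Iso.of_isHom ((tequiv (sw A) (sw B)).trans (sw _)) h)) (swap_swap _)

theorem swap_F1 (s t : ℤˣ) : (F1 K s t).swap ≅ₕ F1 K t s := by
  let e : (K × K × K × K) ≃ₗ[K] (K × K × K × K) := LinearEquiv.ofLinearMap
    { toFun z := (z.1, z.2.2.1, z.2.1, z.2.2.2)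
      map_add' _ _ := rfl
      map_smul' _ _ := rfl }
    { toFun z := (z.1, z.2.2.1, z.2.1, z.2.2.2)
      map_add' _ _ := rfl
      map_smul' _ _ := rfl } rfl rfl
  refine swap_iso_of ((F1.mk s t).symm.trans (e.trans (F1.mk t s))) ?_ ?_ ?_ ?_ <;> intro z <;>
    obtain ⟨⟨a, b, c, d⟩, rfl⟩ := (F1.mk s t).surjective z <;>
    simp [e, F1.G, F1.H, F1.X, F1.Y]

theorem swap_P [CharZero K] : (P K).swap ≅ₕ P K :=
  P_iso_F1.swap.trans ((swap_F1 1 1).trans P_iso_F1.symm)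

theorem swap_twist_P [CharZero K] (s t : ℤˣ) : ((P K).twist s t).swap ≅ₕ (P K).twist t s :=
  (twist_P_iso_F1 s t).swap.trans ((swap_F1 s t).trans (twist_P_iso_F1 t s).symm)

/-! ### Splitting off projective summands -/

/-- The linear map out of a finite product of modules given by a family of linear maps. -/
def piMap {ι : Type} [Fintype ι] [DecidableEq ι] {A : ι → HHModule K} {T : HHModule K}
    (f : ∀ i, (A i).carrier →ₗ[K] T.carrier) : (pi A).carrier →ₗ[K] T.carrier :=
  LinearMap.lsum K (fun i => (A i).carrier) K f

theorem piMap_apply {ι : Type} [Fintype ι] [DecidableEq ι] {A : ι → HHModule K} {T : HHModule K}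
    (f : ∀ i, (A i).carrier →ₗ[K] T.carrier) (z : ∀ i, (A i).carrier) :
    piMap f z = ∑ i, f i (z i) := by
  change LinearMap.lsum K (fun i => (A i).carrier) K f z = _
  rw [LinearMap.lsum_apply, LinearMap.sum_apply]
  rfl

theorem piMap_isHom {ι : Type} [Fintype ι] [DecidableEq ι] {A : ι → HHModule K} {T : HHModule K}
    {f : ∀ i, (A i).carrier →ₗ[K] T.carrier} (hf : ∀ i, IsHom (A i) T (f i)) :
    IsHom (pi A) T (piMap f) := by
  constructor <;> intro z
  · rw [piMap_apply f z, map_sum]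
    exact (piMap_apply f _).trans (Finset.sum_congr rfl fun i _ => (hf i).g (z i))
  · rw [piMap_apply f z, map_sum]
    exact (piMap_apply f _).trans (Finset.sum_congr rfl fun i _ => (hf i).h (z i))
  · rw [piMap_apply f z, map_sum]
    exact (piMap_apply f _).trans (Finset.sum_congr rfl fun i _ => (hf i).x (z i))
  · rw [piMap_apply f z, map_sum]
    exact (piMap_apply f _).trans (Finset.sum_congr rfl fun i _ => (hf i).y (z i))

theorem finrank_F1 (s t : ℤˣ) : Module.finrank K (F1 K s t).carrier = 4 := by
  rw [← (F1.mk s t).finrank_eq]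
  simp

instance F1.finite (s t : ℤˣ) : Module.Finite K (F1 K s t).carrier :=
  Module.Finite.equiv (F1.mk s t)

theorem finrank_pi_F1 {ι : Type} [Fintype ι] (σ τ : ι → ℤˣ) :
    Module.finrank K (pi fun i => F1 K (σ i) (τ i)).carrier = 4 * Fintype.card ι := by
  have h : Module.finrank K (∀ i, (F1 K (σ i) (τ i)).carrier) = 4 * Fintype.card ι := by
    rw [Module.finrank_pi_fintype]
    simp [finrank_F1, mul_comm]
  exact h

instance pi_F1_finite {ι : Type} [Fintype ι] (σ τ : ι → ℤˣ) :
    Module.Finite K (pi fun i => F1 K (σ i) (τ i)).carrier :=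
  inferInstanceAs (Module.Finite K (∀ i, (F1 K (σ i) (τ i)).carrier))

/-- The splitting criterion. Homogeneous vectors `w i` and a homomorphism `φ : B → T` from a module
of Loewy length two define a homomorphism from the sum of the projective modules on the `w i` and of
`B` to `T`. It is injective as soon as it is injective on the socle, which is spanned by the vectors
`x y w i` and the common kernel of `x` and `y` on `B`. -/
theorem splitting {ι : Type} [Fintype ι] {σ τ : ι → ℤˣ} {T B : HHModule K}
    [Module.Finite K T.carrier] [Module.Finite K B.carrier]
    (w : ι → T.carrier) (hg : ∀ i, T.opG (w i) = (sc (σ i) : K) • w i)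
    (hh : ∀ i, T.opH (w i) = (sc (τ i) : K) • w i)
    (φ : B.carrier →ₗ[K] T.carrier) (hφ : IsHom B T φ) (hXY : ∀ b, B.opX (B.opY b) = 0)
    (inj : ∀ (c : ι → K) (b : B.carrier), B.opX b = 0 → B.opY b = 0 →
      ∑ i, c i • T.opX (T.opY (w i)) + φ b = 0 → c = 0 ∧ b = 0)
    (dim : Module.finrank K T.carrier = 4 * Fintype.card ι + Module.finrank K B.carrier) :
    T ≅ₕ pi (fun i => F1 K (σ i) (τ i)) ⊕ₕ B := by
  classical
  let f : ∀ i, (F1 K (σ i) (τ i)).carrier →ₗ[K] T.carrier := fun i => genMap (σ i) (τ i) (w i)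
  have hf : ∀ i, IsHom (F1 K (σ i) (τ i)) T (f i) := fun i => genMap_isHom (hg i) (hh i)
  have hpi := piMap_isHom hf
  let Φ : (pi (fun i => F1 K (σ i) (τ i)) ⊕ₕ B).carrier →ₗ[K] T.carrier :=
    LinearMap.coprod (piMap f) φ
  have hΦ : IsHom (pi (fun i => F1 K (σ i) (τ i)) ⊕ₕ B) T Φ := by
    constructor <;> rintro ⟨z, b⟩
    · exact (congrArg₂ (· + ·) (hpi.g z) (hφ.g b)).trans (map_add _ _ _).symm
    · exact (congrArg₂ (· + ·) (hpi.h z) (hφ.h b)).trans (map_add _ _ _).symm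
    · exact (congrArg₂ (· + ·) (hpi.x z) (hφ.x b)).trans (map_add _ _ _).symm
    · exact (congrArg₂ (· + ·) (hpi.y z) (hφ.y b)).trans (map_add _ _ _).symm
  have hinj : Function.Injective Φ := by
    rw [← LinearMap.ker_eq_bot, LinearMap.ker_eq_bot']
    rintro ⟨z, b⟩ hz
    have hz' : (∑ i, f i (z i)) + φ b = 0 := by rw [← piMap_apply f z]; exact hz
    have hcoord : ∀ i, ∃ q : K × K × K × K, z i = F1.mk _ _ q :=
      fun i => ⟨(F1.mk _ _).symm (z i), ((F1.mk _ _).apply_symm_apply (z i)).symm⟩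
    choose q hq using hcoord
    have hfq : ∀ i, f i (z i) = (q i).1 • w i + (q i).2.1 • T.opX (w i) +
        (q i).2.2.1 • T.opY (w i) + (q i).2.2.2 • T.opX (T.opY (w i)) := by
      intro i; rw [hq]; exact genMap_mk ..
    simp only [hfq] at hz'
    -- apply `x y` to see that the coefficients of the generators vanish, then `y` and `x`
    have h1 := congrArg (fun v => T.opX (T.opY v)) hz'
    simp only [map_add, map_sum, map_smul, opY_opY, opY_opX, opX_opX, smul_zero, add_zero,
      map_zero, ← hφ.x, ← hφ.y, hXY] at h1
    have ha := (inj (fun i => (q i).1) 0 (map_zero _) (map_zero _) (by simpa using h1)).1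
    have ha' : ∀ i, (q i).1 = 0 := fun i => congrFun ha i
    simp only [ha', zero_smul, zero_add] at hz'
    have h2 := congrArg (fun v => T.opY v) hz'
    simp only [map_add, map_sum, map_smul, opY_opY, opY_opX, smul_zero, add_zero,
      map_zero, ← hφ.y] at h2
    obtain ⟨hb, hYb⟩ := inj (fun i => (q i).2.1) (B.opY b) (hXY b) (opY_opY _ _) h2
    have hb' : ∀ i, (q i).2.1 = 0 := fun i => congrFun hb i
    simp only [hb', zero_smul, zero_add] at hz'
    have h3 := congrArg (fun v => T.opX v) hz'
    simp only [map_add, map_sum, map_smul, opX_opX, smul_zero, add_zero,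
      map_zero, ← hφ.x] at h3
    obtain ⟨hc, hXb⟩ := inj (fun i => (q i).2.2.1) (B.opX b) (opX_opX _ _)
      ((opY_opX _ _).trans (hXY b)) h3
    have hc' : ∀ i, (q i).2.2.1 = 0 := fun i => congrFun hc i
    simp only [hc', zero_smul, zero_add] at hz'
    obtain ⟨hd, hb0⟩ := inj (fun i => (q i).2.2.2) b hXb hYb hz'
    have hd' : ∀ i, (q i).2.2.2 = 0 := fun i => congrFun hd i
    refine Prod.ext (funext fun i => ?_) hb0
    have hqi : q i = 0 := Prod.ext (ha' i) (Prod.ext (hb' i) (Prod.ext (hc' i) (hd' i)))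
    change z i = 0
    rw [hq, hqi, map_zero]
  have : Module.Finite K (pi (fun i => F1 K (σ i) (τ i)) ⊕ₕ B).carrier :=
    inferInstanceAs (Module.Finite K ((pi (fun i => F1 K (σ i) (τ i))).carrier × B.carrier))
  have hdim : Module.finrank K (pi (fun i => F1 K (σ i) (τ i)) ⊕ₕ B).carrier =
      Module.finrank K T.carrier := by
    rw [dim, ← finrank_pi_F1 (K := K) σ τ]
    exact Module.finrank_prod
  exact (Iso.of_isHom (LinearEquiv.ofInjectiveOfFinrankEq Φ hinj hdim) hΦ).symm

/-! ### Counting signs -/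

theorem Iso.pi {ι : Type} {A B : ι → HHModule K} (h : ∀ i, A i ≅ₕ B i) : pi A ≅ₕ pi B := by
  choose e he using h
  exact ⟨LinearEquiv.piCongrRight e, fun w v => funext fun i => he i w (v i)⟩

theorem pi_iso_power {ι : Type} [Fintype ι] {A : ι → HHModule K} {B : HHModule K}
    (h : ∀ i, A i ≅ₕ B) {k : ℕ} (hk : Fintype.card ι = k) : pi A ≅ₕ B ^⊕ k :=
  (Iso.pi h).trans ((pi_reindex (Fintype.equivFinOfCardEq hk).symm fun _ => B).trans
    (pi_const_iso B k))

theorem pi_iso_two {ι : Type} [Fintype ι] (p : ι → Prop) [DecidablePred p] {A : ι → HHModule K}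
    {B C : HHModule K} (hB : ∀ i, p i → A i ≅ₕ B) (hC : ∀ i, ¬p i → A i ≅ₕ C) {k l : ℕ}
    (hk : Fintype.card {i // p i} = k) (hl : Fintype.card ι = k + l) :
    pi A ≅ₕ B ^⊕ k ⊕ₕ C ^⊕ l := by
  have hl' : Fintype.card {i // ¬p i} = l := by
    rw [Fintype.card_subtype_compl, hk, hl]; omega
  exact (pi_reindex (Equiv.sumCompl p) A).trans ((pi_sum _).trans
    ((pi_iso_power (fun i => hB _ i.2) hk).sum (pi_iso_power (fun i => hC _ i.2) hl')))

theorem card_even_fin (n : ℕ) : Fintype.card {i : Fin n // Even (i : ℕ)} = (n + 1) / 2 := by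
  rw [Fintype.card_subtype, Finset.card_filter]
  rw [Fin.sum_univ_eq_sum_range (fun i => if Even i then 1 else 0) n]
  induction n with
  | zero => rfl
  | succ n ih =>
    rw [Finset.sum_range_succ, ih]
    split_ifs with h <;> grind

/-- A chessboard whose corner is even has `⌈a b / 2⌉` even squares. -/
theorem card_even_grid (a b : ℕ) :
    Fintype.card {i : Fin a × Fin b // Even ((i.1 : ℕ) + i.2)} = (a * b + 1) / 2 := by
  have hrow : ∀ i b : ℕ, (∑ j ∈ Finset.range b, if Even (i + j) then 1 else 0) =
      if Even i then (b + 1) / 2 else b / 2 := by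
    intro i b
    induction b with
    | zero => simp
    | succ b ih =>
      rw [Finset.sum_range_succ, ih]
      split_ifs with h1 h2 <;> grind
  have hall : ∀ a : ℕ, (∑ i ∈ Finset.range a, if Even i then (b + 1) / 2 else b / 2) =
      (a + 1) / 2 * ((b + 1) / 2) + a / 2 * (b / 2) := by
    intro a
    induction a with
    | zero => simp
    | succ a ih =>
      rw [Finset.sum_range_succ, ih]
      split_ifs with h
      · obtain ⟨k, rfl⟩ := h
        have h1 : (k + k + 1 + 1) / 2 = k + 1 := by omega
        have h2 : (k + k + 1) / 2 = k := by omega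
        have h3 : (k + k) / 2 = k := by omega
        rw [h1, h2, h3]; ring
      · obtain ⟨k, rfl⟩ := Nat.not_even_iff_odd.mp h
        have h1 : (2 * k + 1 + 1 + 1) / 2 = k + 1 := by omega
        have h2 : (2 * k + 1 + 1) / 2 = k + 1 := by omega
        have h3 : (2 * k + 1) / 2 = k := by omega
        rw [h1, h2, h3]; ring
  rw [Fintype.card_subtype, Finset.card_filter, ← Finset.univ_product_univ,
    Finset.sum_product]
  rw [Fin.sum_univ_eq_sum_range (fun i => ∑ j : Fin b, if Even (i + (j : ℕ)) then 1 else 0) a]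
  have : ∀ i, (∑ j : Fin b, if Even (i + (j : ℕ)) then 1 else 0) =
      if Even i then (b + 1) / 2 else b / 2 := by
    intro i
    rw [Fin.sum_univ_eq_sum_range (fun j => if Even (i + j) then 1 else 0) b, hrow]
  simp only [this, hall]
  rcases Nat.even_or_odd' a with ⟨k, rfl | rfl⟩ <;> rcases Nat.even_or_odd' b with ⟨l, rfl | rfl⟩
  · have h1 : (2 * k + 1) / 2 = k := by omega
    have h2 : (2 * l + 1) / 2 = l := by omega
    have h3 : 2 * k / 2 = k := by omega
    have h4 : 2 * l / 2 = l := by omega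
    have h5 : 2 * k * (2 * l) = 2 * (k * l + k * l) := by ring
    rw [h1, h2, h3, h4, h5]; omega
  · have h1 : (2 * k + 1) / 2 = k := by omega
    have h2 : (2 * l + 1 + 1) / 2 = l + 1 := by omega
    have h3 : 2 * k / 2 = k := by omega
    have h4 : (2 * l + 1) / 2 = l := by omega
    have h5 : 2 * k * (2 * l + 1) = 2 * (k * (l + 1) + k * l) := by ring
    rw [h1, h2, h3, h4, h5]; omega
  · have h1 : (2 * k + 1 + 1) / 2 = k + 1 := by omega
    have h2 : (2 * l + 1) / 2 = l := by omega
    have h3 : (2 * k + 1) / 2 = k := by omega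
    have h4 : 2 * l / 2 = l := by omega
    have h5 : (2 * k + 1) * (2 * l) = 2 * ((k + 1) * l + k * l) := by ring
    rw [h1, h2, h3, h4, h5]; omega
  · have h1 : (2 * k + 1 + 1) / 2 = k + 1 := by omega
    have h2 : (2 * l + 1 + 1) / 2 = l + 1 := by omega
    have h3 : (2 * k + 1) / 2 = k := by omega
    have h4 : (2 * l + 1) / 2 = l := by omega
    have h5 : (2 * k + 1) * (2 * l + 1) + 1 = 2 * ((k + 1) * (l + 1) + k * l) := by ring
    rw [h1, h2, h3, h4, h5]; omega

theorem sgn_even {i : ℕ} (h : Even i) : sgn i = 1 := h.neg_one_pow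

theorem sgn_odd {i : ℕ} (h : ¬Even i) : sgn i = -1 := (Nat.not_even_iff_odd.mp h).neg_one_pow

/-- The sum of the modules `P` with alternating signs along a row. -/
theorem pi_row [CharZero K] (s t : ℤˣ) (n : ℕ) :
    pi (fun i : Fin n => F1 K (s * sgn i) (t * sgn i)) ≅ₕ
      (P K).twist s t ^⊕ ((n + 1) / 2) ⊕ₕ (P K).twist (-s) (-t) ^⊕ (n / 2) := by
  refine pi_iso_two (fun i : Fin n => Even (i : ℕ)) ?_ ?_ (card_even_fin n) ?_
  · intro i hi
    rw [sgn_even hi, mul_one, mul_one]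
    exact (twist_P_iso_F1 _ _).symm
  · intro i hi
    rw [sgn_odd hi, mul_neg_one, mul_neg_one]
    exact (twist_P_iso_F1 _ _).symm
  · rw [Fintype.card_fin]; omega

/-- The sum of the modules `P` with the signs of a chessboard. -/
theorem pi_grid [CharZero K] (s : ℤˣ) (a b k l : ℕ) (hk : s = 1 → k = (a * b + 1) / 2)
    (hl : s = -1 → l = (a * b + 1) / 2) (hkl : k + l = a * b) :
    pi (fun i : Fin a × Fin b => F1 K (s * sgn (i.1 + i.2)) (s * sgn (i.1 + i.2))) ≅ₕ
      P K ^⊕ k ⊕ₕ (P K).twist (-1) (-1) ^⊕ l := by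
  have h1 : F1 K 1 1 ≅ₕ P K := P_iso_F1.symm
  have h2 : F1 K (-1) (-1) ≅ₕ (P K).twist (-1) (-1) := (twist_P_iso_F1 _ _).symm
  have hc : Fintype.card (Fin a × Fin b) = a * b := by simp
  rcases Int.units_eq_one_or s with rfl | rfl
  · refine pi_iso_two (fun i : Fin a × Fin b => Even ((i.1 : ℕ) + i.2)) ?_ ?_
      ((card_even_grid a b).trans (hk rfl).symm) (hc.trans hkl.symm)
    · intro i hi; rw [sgn_even hi, mul_one]; exact h1
    · intro i hi; rw [sgn_odd hi, one_mul]; exact h2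
  · refine Iso.trans (pi_iso_two (fun i : Fin a × Fin b => Even ((i.1 : ℕ) + i.2)) (k := l)
      (l := k) (B := (P K).twist (-1) (-1)) (C := P K) ?_ ?_
      ((card_even_grid a b).trans (hl rfl).symm) (by omega)) (sum_comm _ _)
    · intro i hi; rw [sgn_even hi, mul_one]; exact h2
    · intro i hi; rw [sgn_odd hi]; exact h1

/-! ### Modules of Loewy length two in coordinates -/

/-- The `i`-th standard basis vector of `K ^ m`, which is `0` for `i ≥ m`. -/
def stdVec (K : Type u) [Field K] (m i : ℕ) : Fin m → K := fun k => if (k : ℕ) = i then 1 else 0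

theorem stdVec_ge {m i : ℕ} (h : m ≤ i) : stdVec K m i = 0 := by
  funext k
  have := k.2
  simp only [stdVec, Pi.zero_apply, ite_eq_right_iff]
  omega

theorem sum_stdVec {m : ℕ} (a : Fin m → K) (c : ℕ → K) (h : ∀ i : Fin m, c i = a i) :
    ∑ i ∈ Finset.range m, c i • stdVec K m i = a := by
  funext k
  simp [stdVec, Finset.sum_apply, h]

/-- Coordinates on a module of Loewy length two: an upper layer of dimension `m`, and a lower layer
of dimension `n` which is killed by `x` and `y`. -/
structure Layer (A : HHModule K) (m n : ℕ) where
  equiv : A.carrier ≃ₗ[K] (Fin m → K) × (Fin n → K)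
  opX_symm : ∀ b, A.opX (equiv.symm (0, b)) = 0
  opY_symm : ∀ b, A.opY (equiv.symm (0, b)) = 0

namespace Layer

variable {A : HHModule K} {m n : ℕ} (L : Layer A m n)

/-- The basis of the upper layer, extended by `0`. -/
def u (i : ℕ) : A.carrier := L.equiv.symm (stdVec K m i, 0)

/-- The basis of the lower layer, extended by `0`. -/
def v (j : ℕ) : A.carrier := L.equiv.symm (0, stdVec K n j)

/-- The coordinates of the upper layer, extended by `0`. -/
def uc (i : ℕ) : A.carrier →ₗ[K] K :=
  if h : i < m then LinearMap.proj ⟨i, h⟩ ∘ₗ LinearMap.fst K _ _ ∘ₗ L.equiv.toLinearMap else 0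

/-- The coordinates of the lower layer, extended by `0`. -/
def vc (j : ℕ) : A.carrier →ₗ[K] K :=
  if h : j < n then LinearMap.proj ⟨j, h⟩ ∘ₗ LinearMap.snd K _ _ ∘ₗ L.equiv.toLinearMap else 0

theorem u_ge {i : ℕ} (h : m ≤ i) : L.u i = 0 := by
  rw [u, stdVec_ge h, Prod.mk_zero_zero, map_zero]

theorem v_ge {j : ℕ} (h : n ≤ j) : L.v j = 0 := by
  rw [v, stdVec_ge h, Prod.mk_zero_zero, map_zero]

theorem uc_u {i : ℕ} (h : i < m) (j : ℕ) : L.uc i (L.u j) = if i = j then 1 else 0 := by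
  simp [uc, u, h, stdVec]

@[simp] theorem uc_v (i j : ℕ) : L.uc i (L.v j) = 0 := by
  unfold uc v; split_ifs <;> simp

@[simp] theorem vc_u (i j : ℕ) : L.vc i (L.u j) = 0 := by
  unfold vc u; split_ifs <;> simp

theorem vc_v {i : ℕ} (h : i < n) (j : ℕ) : L.vc i (L.v j) = if i = j then 1 else 0 := by
  simp [vc, v, h, stdVec]

@[simp] theorem opX_v (j : ℕ) : A.opX (L.v j) = 0 := L.opX_symm _

@[simp] theorem opY_v (j : ℕ) : A.opY (L.v j) = 0 := L.opY_symm _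

theorem decomp (z : A.carrier) : z = ∑ i ∈ Finset.range m, L.uc i z • L.u i +
    ∑ j ∈ Finset.range n, L.vc j z • L.v j := by
  apply L.equiv.injective
  have hu : ∑ i ∈ Finset.range m, L.uc i z • stdVec K m i = (L.equiv z).1 :=
    sum_stdVec _ _ fun i => by simp [uc]
  have hv : ∑ j ∈ Finset.range n, L.vc j z • stdVec K n j = (L.equiv z).2 :=
    sum_stdVec _ _ fun i => by simp [vc]
  rw [map_add, map_sum, map_sum]
  refine Prod.ext ?_ ?_
  · simp only [map_smul, u, v, LinearEquiv.apply_symm_apply, Prod.fst_add, Prod.fst_sum,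
      Prod.smul_fst, smul_zero, Finset.sum_const_zero, add_zero, hu]
  · simp only [map_smul, u, v, LinearEquiv.apply_symm_apply, Prod.snd_add, Prod.snd_sum,
      Prod.smul_snd, smul_zero, Finset.sum_const_zero, zero_add, hv]

theorem finite (L : Layer A m n) : Module.Finite K A.carrier := Module.Finite.equiv L.equiv.symm

theorem finrank (L : Layer A m n) : Module.finrank K A.carrier = m + n := by
  rw [L.equiv.finrank_eq]; simp

theorem hom_ext {T : Type*} [AddCommGroup T] [Module K T] {φ ψ : A.carrier →ₗ[K] T}
    (hu : ∀ i < m, φ (L.u i) = ψ (L.u i)) (hv : ∀ j < n, φ (L.v j) = ψ (L.v j))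
    (z : A.carrier) : φ z = ψ z := by
  rw [L.decomp z]
  simp only [map_add, map_sum, map_smul]
  congr 1
  · exact Finset.sum_congr rfl fun i hi => by rw [hu i (Finset.mem_range.mp hi)]
  · exact Finset.sum_congr rfl fun i hi => by rw [hv i (Finset.mem_range.mp hi)]

/-- The linear map with prescribed values on the basis. -/
def map {T : Type*} [AddCommGroup T] [Module K T] (U V : ℕ → T) : A.carrier →ₗ[K] T :=
  ∑ i ∈ Finset.range m, (L.uc i).smulRight (U i) + ∑ j ∈ Finset.range n, (L.vc j).smulRight (V j)

theorem map_apply {T : Type*} [AddCommGroup T] [Module K T] (U V : ℕ → T) (z : A.carrier) :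
    L.map U V z = ∑ i ∈ Finset.range m, L.uc i z • U i + ∑ j ∈ Finset.range n, L.vc j z • V j := by
  simp [map, LinearMap.add_apply, LinearMap.sum_apply]

theorem map_u {T : Type*} [AddCommGroup T] [Module K T] (U V : ℕ → T) {i : ℕ} (h : i < m) :
    L.map U V (L.u i) = U i := by
  rw [map_apply, Finset.sum_eq_single i]
  · simp [uc_u, h]
  · intro j hj hij
    rw [L.uc_u (Finset.mem_range.mp hj), if_neg hij, zero_smul]
  · intro hi; exact absurd (Finset.mem_range.mpr h) hi

theorem map_v {T : Type*} [AddCommGroup T] [Module K T] (U V : ℕ → T) {j : ℕ} (h : j < n) :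
    L.map U V (L.v j) = V j := by
  rw [map_apply, Finset.sum_eq_zero, zero_add, Finset.sum_eq_single j]
  · simp [vc_v, h]
  · intro i hi hij
    rw [L.vc_v (Finset.mem_range.mp hi), if_neg hij, zero_smul]
  · intro hi; exact absurd (Finset.mem_range.mpr h) hi
  · simp

/-- The signs alternate along both layers: `g`, `h` act on `u i` as `a (-1)^i`, `b (-1)^i` and on
`v j` as `c (-1)^j`, `d (-1)^j`. -/
structure Signs (a b c d : ℤˣ) : Prop where
  gu : ∀ i, A.opG (L.u i) = ((sc a : K) * (-1) ^ i) • L.u i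
  hu : ∀ i, A.opH (L.u i) = ((sc b : K) * (-1) ^ i) • L.u i
  gv : ∀ j, A.opG (L.v j) = ((sc c : K) * (-1) ^ j) • L.v j
  hv : ∀ j, A.opH (L.v j) = ((sc d : K) * (-1) ^ j) • L.v j

theorem isHom_map {T : HHModule K} {a b c d : ℤˣ} (hL : L.Signs a b c d) (U V : ℕ → T.carrier)
    (gU : ∀ i < m, T.opG (U i) = ((sc a : K) * (-1) ^ i) • U i)
    (hU : ∀ i < m, T.opH (U i) = ((sc b : K) * (-1) ^ i) • U i)
    (gV : ∀ j < n, T.opG (V j) = ((sc c : K) * (-1) ^ j) • V j)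
    (hV : ∀ j < n, T.opH (V j) = ((sc d : K) * (-1) ^ j) • V j)
    (xU : ∀ i < m, T.opX (U i) = L.map U V (A.opX (L.u i)))
    (yU : ∀ i < m, T.opY (U i) = L.map U V (A.opY (L.u i)))
    (xV : ∀ j < n, T.opX (V j) = 0) (yV : ∀ j < n, T.opY (V j) = 0) :
    IsHom A T (L.map U V) := by
  constructor
  · refine L.hom_ext (φ := L.map U V ∘ₗ A.opG) (ψ := T.opG ∘ₗ L.map U V) ?_ ?_ <;> intro i hi
    · simp [hL.gu, map_u _ _ _ hi, gU i hi]
    · simp [hL.gv, map_v _ _ _ hi, gV i hi]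
  · refine L.hom_ext (φ := L.map U V ∘ₗ A.opH) (ψ := T.opH ∘ₗ L.map U V) ?_ ?_ <;> intro i hi
    · simp [hL.hu, map_u _ _ _ hi, hU i hi]
    · simp [hL.hv, map_v _ _ _ hi, hV i hi]
  · refine L.hom_ext (φ := L.map U V ∘ₗ A.opX) (ψ := T.opX ∘ₗ L.map U V) ?_ ?_ <;> intro i hi
    · simp [map_u _ _ _ hi, xU i hi]
    · simp [map_v _ _ _ hi, xV i hi]
  · refine L.hom_ext (φ := L.map U V ∘ₗ A.opY) (ψ := T.opY ∘ₗ L.map U V) ?_ ?_ <;> intro i hi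
    · simp [map_u _ _ _ hi, yU i hi]
    · simp [map_v _ _ _ hi, yV i hi]

theorem opX_opY (z : A.carrier) (hu : ∀ i < m, A.opX (A.opY (L.u i)) = 0) :
    A.opX (A.opY z) = 0 :=
  L.hom_ext (φ := A.opX ∘ₗ A.opY) (ψ := 0) (by simpa using hu) (by simp) z

/-- Coordinates on a twist. -/
def twist (s t : ℤˣ) : Layer (A.twist s t) m n where
  equiv := (tl A s t).symm.trans L.equiv
  opX_symm b := by simp [L.opX_symm]
  opY_symm b := by simp [L.opY_symm]

theorem twist_u (s t : ℤˣ) (i : ℕ) : (L.twist s t).u i = tl A s t (L.u i) := rfl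

theorem twist_v (s t : ℤˣ) (i : ℕ) : (L.twist s t).v i = tl A s t (L.v i) := rfl

theorem Signs.twist {L : Layer A m n} {a b c d : ℤˣ} (hL : L.Signs a b c d) (s t : ℤˣ) :
    (L.twist s t).Signs (s * a) (t * b) (s * c) (t * d) := by
  constructor <;> intro i <;>
    simp [twist_u, twist_v, hL.gu, hL.hu, hL.gv, hL.hv, smul_smul, mul_assoc]

/-- Coordinates on a swapped module. -/
def swap : Layer A.swap m n where
  equiv := (sw A).symm.trans L.equiv
  opX_symm b := by simp [L.opY_symm]
  opY_symm b := by simp [L.opX_symm]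

theorem swap_u (i : ℕ) : L.swap.u i = sw A (L.u i) := rfl

theorem swap_v (i : ℕ) : L.swap.v i = sw A (L.v i) := rfl

theorem Signs.swap {L : Layer A m n} {a b c d : ℤˣ} (hL : L.Signs a b c d) :
    L.swap.Signs b a d c := by
  constructor <;> intro i <;> simp [swap_u, swap_v, hL.gu, hL.hu, hL.gv, hL.hv]

/-- Coordinates in reversed order. -/
def rev : Layer A m n where
  equiv := L.equiv.trans ((LinearEquiv.funCongrLeft K K Fin.revPerm).prodCongr
    (LinearEquiv.funCongrLeft K K Fin.revPerm))
  opX_symm _ := L.opX_symm _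
  opY_symm _ := L.opY_symm _

theorem rev_u {i : ℕ} (h : i < m) : L.rev.u i = L.u (m - 1 - i) := by
  change L.equiv.symm (_, _) = L.equiv.symm (_, _)
  congr 2
  funext k
  have := k.2
  change stdVec K m i (Fin.rev k) = stdVec K m (m - 1 - i) k
  simp only [stdVec, Fin.val_rev]
  congr 1
  simp only [eq_iff_iff]
  omega

theorem rev_v {j : ℕ} (h : j < n) : L.rev.v j = L.v (n - 1 - j) := by
  change L.equiv.symm (_, _) = L.equiv.symm (_, _)
  congr 2
  funext k
  have := k.2
  change stdVec K n j (Fin.rev k) = stdVec K n (n - 1 - j) k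
  simp only [stdVec, Fin.val_rev]
  congr 1
  simp only [eq_iff_iff]
  omega

theorem neg_one_pow_rev {m i : ℕ} (h : i < m) : (-1 : K) ^ (m - 1 - i) = (-1) ^ (m - 1) * (-1) ^ i := by
  obtain ⟨k, rfl⟩ := Nat.exists_eq_add_of_lt h
  have h1 : i + k + 1 - 1 - i = k := by omega
  have h2 : i + k + 1 - 1 = k + i := by omega
  rw [h1, h2, pow_add, mul_assoc, ← mul_pow]
  simp

theorem Signs.rev {L : Layer A m n} {a b c d : ℤˣ} (hL : L.Signs a b c d) :
    L.rev.Signs (a * sgn (m - 1)) (b * sgn (m - 1)) (c * sgn (n - 1)) (d * sgn (n - 1)) := by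
  constructor <;> intro i
  · rcases lt_or_ge i m with h | h
    · rw [rev_u _ h, hL.gu, neg_one_pow_rev h]; simp [mul_assoc]
    · simp [u_ge _ h]
  · rcases lt_or_ge i m with h | h
    · rw [rev_u _ h, hL.hu, neg_one_pow_rev h]; simp [mul_assoc]
    · simp [u_ge _ h]
  · rcases lt_or_ge i n with h | h
    · rw [rev_v _ h, hL.gv, neg_one_pow_rev h]; simp [mul_assoc]
    · simp [v_ge _ h]
  · rcases lt_or_ge i n with h | h
    · rw [rev_v _ h, hL.hv, neg_one_pow_rev h]; simp [mul_assoc]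
    · simp [v_ge _ h]

end Layer

/-! ### The operators on a layered module -/

section layered

variable {p q : Type} [Fintype p] (gU hU : p → ℤˣ) (gV hV : q → ℤˣ) (X Y : Matrix q p K)
  (hX : ∀ j i, X j i ≠ 0 → gV j = -gU i ∧ hV j = hU i)
  (hY : ∀ j i, Y j i ≠ 0 → gV j = gU i ∧ hV j = -hU i)

/-- A pair of coordinate vectors, as a vector of the layered module. -/
def layered.mk : ((p → K) × (q → K)) ≃ₗ[K] (layered gU hU gV hV X Y hX hY).carrier :=
  LinearEquiv.refl K _

theorem layered_ops (z : (p → K) × (q → K)) :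
    (layered gU hU gV hV X Y hX hY).opG (layered.mk gU hU gV hV X Y hX hY z) =
      layered.mk gU hU gV hV X Y hX hY (diagOp K gU z.1, diagOp K gV z.2) ∧
    (layered gU hU gV hV X Y hX hY).opH (layered.mk gU hU gV hV X Y hX hY z) =
      layered.mk gU hU gV hV X Y hX hY (diagOp K hU z.1, diagOp K hV z.2) ∧
    (layered gU hU gV hV X Y hX hY).opX (layered.mk gU hU gV hV X Y hX hY z) =
      layered.mk gU hU gV hV X Y hX hY (0, X.mulVec z.1) ∧
    (layered gU hU gV hV X Y hX hY).opY (layered.mk gU hU gV hV X Y hX hY z) =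
      layered.mk gU hU gV hV X Y hX hY (0, Y.mulVec z.1) := by
  have h1 : (diagOp K gU).prodMap (diagOp K gV) * (diagOp K hU).prodMap (diagOp K hV) =
      (diagOp K hU).prodMap (diagOp K hV) * (diagOp K gU).prodMap (diagOp K gV) := by
    rw [LinearMap.prodMap_mul, LinearMap.prodMap_mul, (diagOp_commute gU hU).eq,
      (diagOp_commute gV hV).eq]
  have h2 : (diagOp K gU).prodMap (diagOp K gV) * (LinearMap.inr K (p → K) (q → K)).comp
        (Y.mulVecLin.comp (LinearMap.fst K (p → K) (q → K))) =
      (LinearMap.inr K (p → K) (q → K)).comp (Y.mulVecLin.comp (LinearMap.fst K (p → K) (q → K))) *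
        (diagOp K gU).prodMap (diagOp K gV) := by
    refine LinearMap.ext fun v => ?_
    have h := diagOp_comp_mulVec gU gV 1 Y (fun j i hji => by simp [(hY j i hji).1]) v.1
    simp [h]
  have h3 : (LinearMap.inr K (p → K) (q → K)).comp (X.mulVecLin.comp (LinearMap.fst K (p → K) (q → K))) *
        (diagOp K hU).prodMap (diagOp K hV) = (diagOp K hU).prodMap (diagOp K hV) *
      (LinearMap.inr K (p → K) (q → K)).comp (X.mulVecLin.comp (LinearMap.fst K (p → K) (q → K))) := by
    refine LinearMap.ext fun v => ?_
    have h := diagOp_comp_mulVec hU hV 1 X (fun j i hji => by simp [(hX j i hji).2]) v.1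
    simp [h]
  have h4 : (LinearMap.inr K (p → K) (q → K)).comp (X.mulVecLin.comp (LinearMap.fst K (p → K) (q → K))) *
        (LinearMap.inr K (p → K) (q → K)).comp (Y.mulVecLin.comp (LinearMap.fst K (p → K) (q → K))) =
      (LinearMap.inr K (p → K) (q → K)).comp (Y.mulVecLin.comp (LinearMap.fst K (p → K) (q → K))) *
        (LinearMap.inr K (p → K) (q → K)).comp (X.mulVecLin.comp (LinearMap.fst K (p → K) (q → K))) := by
    refine LinearMap.ext fun v => ?_; simp
  exact ⟨LinearMap.congr_fun (opsHom_g _ _ _ _ _ _ _ _ _ _ h1 h2 h3 h4) z,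
    LinearMap.congr_fun (opsHom_h _ _ _ _ _ _ _ _ _ _ h1 h2 h3 h4) z,
    LinearMap.congr_fun (opsHom_x _ _ _ _ _ _ _ _ _ _ h1 h2 h3 h4) z,
    LinearMap.congr_fun (opsHom_y _ _ _ _ _ _ _ _ _ _ h1 h2 h3 h4) z⟩

end layered

/-- The standard coordinates of a layered module. -/
def Layer.std {m n : ℕ} (gU hU : Fin m → ℤˣ) (gV hV : Fin n → ℤˣ) (X Y : Matrix (Fin n) (Fin m) K)
    (hX : ∀ j i, X j i ≠ 0 → gV j = -gU i ∧ hV j = hU i)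
    (hY : ∀ j i, Y j i ≠ 0 → gV j = gU i ∧ hV j = -hU i) :
    Layer (layered gU hU gV hV X Y hX hY) m n where
  equiv := (layered.mk gU hU gV hV X Y hX hY).symm
  opX_symm b := by simp [(layered_ops gU hU gV hV X Y hX hY _).2.2.1]
  opY_symm b := by simp [(layered_ops gU hU gV hV X Y hX hY _).2.2.2]

theorem diagOp_stdVec {m : ℕ} (σ : Fin m → ℤˣ) (a : ℤˣ) (h : ∀ k, σ k = a * sgn k) (i : ℕ) :
    diagOp K σ (stdVec K m i) = ((sc a : K) * (-1) ^ i) • stdVec K m i := by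
  funext k
  simp only [diagOp, stdVec, LinearMap.pi_apply, LinearMap.smul_apply, LinearMap.proj_apply,
    smul_eq_mul, Pi.smul_apply, h]
  split_ifs with hk
  · simp [sc, hk]
  · simp

theorem Layer.signs_std {m n : ℕ} (gU hU : Fin m → ℤˣ) (gV hV : Fin n → ℤˣ)
    (X Y : Matrix (Fin n) (Fin m) K) (hX : ∀ j i, X j i ≠ 0 → gV j = -gU i ∧ hV j = hU i)
    (hY : ∀ j i, Y j i ≠ 0 → gV j = gU i ∧ hV j = -hU i) (a b c d : ℤˣ)
    (ha : ∀ k, gU k = a * sgn k) (hb : ∀ k, hU k = b * sgn k) (hc : ∀ k, gV k = c * sgn k)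
    (hd : ∀ k, hV k = d * sgn k) : (Layer.std gU hU gV hV X Y hX hY).Signs a b c d := by
  constructor <;> intro i <;> simp only [u, v, std, LinearEquiv.symm_symm]
  · rw [(layered_ops gU hU gV hV X Y hX hY _).1, ← map_smul]
    simp [diagOp_stdVec gU a ha]
  · rw [(layered_ops gU hU gV hV X Y hX hY _).2.1, ← map_smul]
    simp [diagOp_stdVec hU b hb]
  · rw [(layered_ops gU hU gV hV X Y hX hY _).1, ← map_smul]
    simp [diagOp_stdVec gV c hc]
  · rw [(layered_ops gU hU gV hV X Y hX hY _).2.1, ← map_smul]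
    simp [diagOp_stdVec hV d hd]

theorem mulVec_stdVec {m n : ℕ} (M : Matrix (Fin n) (Fin m) K) {i : ℕ} (h : i < m) :
    M.mulVec (stdVec K m i) = fun j => M j ⟨i, h⟩ := by
  have : stdVec K m i = Pi.single ⟨i, h⟩ 1 := by
    funext k
    simp [stdVec, Pi.single_apply, Fin.ext_iff]
  rw [this, Matrix.mulVec_single_one]
  rfl

theorem Layer.std_opX {m n : ℕ} (gU hU : Fin m → ℤˣ) (gV hV : Fin n → ℤˣ)
    (X Y : Matrix (Fin n) (Fin m) K) (hX : ∀ j i, X j i ≠ 0 → gV j = -gU i ∧ hV j = hU i)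
    (hY : ∀ j i, Y j i ≠ 0 → gV j = gU i ∧ hV j = -hU i) {i : ℕ} (h : i < m) (c : ℕ → K)
    (hc : ∀ j : Fin n, X j ⟨i, h⟩ = c j) :
    (layered gU hU gV hV X Y hX hY).opX ((Layer.std gU hU gV hV X Y hX hY).u i) =
      ∑ j ∈ Finset.range n, c j • (Layer.std gU hU gV hV X Y hX hY).v j := by
  simp only [u, v, std, LinearEquiv.symm_symm]
  rw [(layered_ops gU hU gV hV X Y hX hY _).2.2.1, mulVec_stdVec _ h]
  simp only [← map_smul, ← map_sum]
  congr 1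
  refine Prod.ext (by simp [Prod.fst_sum]) ?_
  simp only [Prod.snd_sum, Prod.smul_snd]
  exact (sum_stdVec _ _ fun j => (hc j).symm).symm

theorem Layer.std_opY {m n : ℕ} (gU hU : Fin m → ℤˣ) (gV hV : Fin n → ℤˣ)
    (X Y : Matrix (Fin n) (Fin m) K) (hX : ∀ j i, X j i ≠ 0 → gV j = -gU i ∧ hV j = hU i)
    (hY : ∀ j i, Y j i ≠ 0 → gV j = gU i ∧ hV j = -hU i) {i : ℕ} (h : i < m) (c : ℕ → K)
    (hc : ∀ j : Fin n, Y j ⟨i, h⟩ = c j) :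
    (layered gU hU gV hV X Y hX hY).opY ((Layer.std gU hU gV hV X Y hX hY).u i) =
      ∑ j ∈ Finset.range n, c j • (Layer.std gU hU gV hV X Y hX hY).v j := by
  simp only [u, v, std, LinearEquiv.symm_symm]
  rw [(layered_ops gU hU gV hV X Y hX hY _).2.2.2, mulVec_stdVec _ h]
  simp only [← map_smul, ← map_sum]
  congr 1
  refine Prod.ext (by simp [Prod.fst_sum]) ?_
  simp only [Prod.snd_sum, Prod.smul_snd]
  exact (sum_stdVec _ _ fun j => (hc j).symm).symm

/-! ### The shapes of the modules `M`, `N`, `W`, `N'`, `C` -/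

/-- The coefficients `0, η, 0, η, …` of the three-term recurrence of a band module. -/
def band (η : K) (i : ℕ) : K := if Odd i then η else 0

theorem band_zero_left (i : ℕ) : band (0 : K) i = 0 := by simp [band]

@[simp] theorem band_zero (η : K) : band η 0 = 0 := by simp [band]

namespace Layer

/-- The shape of `M`: `x u_i = v_i`, `y u_i = v_{i+1}`. -/
structure IsM {A : HHModule K} {m n : ℕ} (L : Layer A m n) : Prop where
  x : ∀ i < m, A.opX (L.u i) = L.v i
  y : ∀ i < m, A.opY (L.u i) = L.v (i + 1)

/-- The shape of `W` and `N'`: `y u_i = v_i`, `x u_{i+1} = v_i`, `x u_0 = 0`. -/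
structure IsW {A : HHModule K} {m n : ℕ} (L : Layer A m n) : Prop where
  x_zero : A.opX (L.u 0) = 0
  x_succ : ∀ i, i + 1 < m → A.opX (L.u (i + 1)) = L.v i
  y : ∀ i < m, A.opY (L.u i) = L.v i

/-- The shape of `N` (with `η = 0`) and of `C`: `x u_i = v_i`, `y u_i = v_{i+1} + c_i v_{i-1}`, where
`c_i` is `η` for odd `i` and `0` for even `i`. So `x` identifies the two layers, and `y` becomes
multiplication by `t` on `K[t] / (t^n)` or `K[t] / ((t² - η)^(n / 2))`, in the basis
`1, t, t² - η, t (t² - η), (t² - η)², …`. -/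
structure IsA {A : HHModule K} {n : ℕ} (L : Layer A n n) (η : K) : Prop where
  x : ∀ i < n, A.opX (L.u i) = L.v i
  y : ∀ i < n, A.opY (L.u i) = L.v (i + 1) + band η i • L.v (i - 1)

theorem sum_v {A : HHModule K} {m n : ℕ} (L : Layer A m n) (i : ℕ) :
    ∑ j ∈ Finset.range n, (if j = i then (1 : K) else 0) • L.v j = L.v i := by
  rcases lt_or_ge i n with h | h
  · rw [Finset.sum_eq_single i]
    · simp
    · intro j _ hj; simp [hj]
    · intro hi; exact absurd (Finset.mem_range.mpr h) hi
  · rw [L.v_ge h, Finset.sum_eq_zero]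
    intro j hj
    have := Finset.mem_range.mp hj
    rw [if_neg (by omega), zero_smul]

section twist

variable {A : HHModule K} (s t : ℤˣ)

theorem IsM.twist {m n : ℕ} {L : Layer A m n} (h : L.IsM) : (L.twist s t).IsM where
  x i hi := by simp [twist_u, twist_v, h.x i hi]
  y i hi := by simp [twist_u, twist_v, h.y i hi]

theorem IsW.twist {m n : ℕ} {L : Layer A m n} (h : L.IsW) : (L.twist s t).IsW where
  x_zero := by simp [twist_u, h.x_zero]
  x_succ i hi := by simp [twist_u, twist_v, h.x_succ i hi]
  y i hi := by simp [twist_u, twist_v, h.y i hi]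

theorem IsA.twist {n : ℕ} {L : Layer A n n} {η : K} (h : L.IsA η) : (L.twist s t).IsA η where
  x i hi := by simp [twist_u, twist_v, h.x i hi]
  y i hi := by simp [twist_u, twist_v, h.y i hi]

end twist

theorem IsM.swap_rev {A : HHModule K} {n : ℕ} {L : Layer A n (n + 1)} (h : L.IsM) :
    L.swap.rev.IsM where
  x i hi := by
    rw [rev_u _ hi, rev_v _ (by omega), swap_u, swap_v, opX_sw, h.y _ (by omega)]
    congr 2; omega
  y i hi := by
    rw [rev_u _ hi, rev_v _ (by omega), swap_u, swap_v, opY_sw, h.x _ (by omega)]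
    congr 2; omega

theorem IsW.swap_rev {A : HHModule K} {n : ℕ} {L : Layer A (n + 1) n} (h : L.IsW) :
    L.swap.rev.IsW where
  x_zero := by
    rw [rev_u _ (by omega), swap_u, opX_sw, h.y _ (by omega), L.v_ge (by omega), map_zero]
  x_succ i hi := by
    rw [rev_u _ hi, rev_v _ (by omega), swap_u, swap_v, opX_sw, h.y _ (by omega)]
    congr 2; omega
  y i hi := by
    rw [rev_u _ hi, swap_u, opY_sw]
    rcases Nat.lt_or_ge i n with hin | hin
    · rw [rev_v _ hin, swap_v]
      have hi' : n + 1 - 1 - i = (n - 1 - i) + 1 := by omega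
      rw [hi', h.x_succ _ (by omega)]
    · have hi' : n + 1 - 1 - i = 0 := by omega
      rw [hi', h.x_zero, v_ge _ hin, map_zero]

theorem IsW.swap_rev_isA {A : HHModule K} {n : ℕ} {L : Layer A n n} (h : L.IsW) :
    L.swap.rev.IsA 0 where
  x i hi := by
    rw [rev_u _ hi, rev_v _ hi, swap_u, swap_v, opX_sw, h.y _ (by omega)]
  y i hi := by
    rw [rev_u _ hi, swap_u, opY_sw, band_zero_left, zero_smul, add_zero]
    rcases Nat.lt_or_ge (i + 1) n with hin | hin
    · rw [rev_v _ hin, swap_v]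
      have hi' : n - 1 - i = (n - 1 - (i + 1)) + 1 := by omega
      rw [hi', h.x_succ _ (by omega)]
    · have hi' : n - 1 - i = 0 := by omega
      rw [hi', h.x_zero, v_ge _ hin, map_zero]

/-! The common kernel of `x` and `y` is the lower layer. -/

theorem uc_eq_zero_of_sum {A : HHModule K} {m n : ℕ} (L : Layer A m n) {f : ℕ → K} {k : ℕ}
    (hk : k ≤ n) (h : ∑ i ∈ Finset.range k, f i • L.v i = 0) {i : ℕ} (hi : i < k) : f i = 0 := by
  have h' := congrArg (L.vc i) h
  simpa [vc_v _ (lt_of_lt_of_le hi hk), hi] using h'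

theorem opX_eq_sum {A : HHModule K} {m n : ℕ} (L : Layer A m n) (z : A.carrier) :
    A.opX z = ∑ i ∈ Finset.range m, L.uc i z • A.opX (L.u i) := by
  conv_lhs => rw [L.decomp z]
  simp

theorem opY_eq_sum {A : HHModule K} {m n : ℕ} (L : Layer A m n) (z : A.carrier) :
    A.opY z = ∑ i ∈ Finset.range m, L.uc i z • A.opY (L.u i) := by
  conv_lhs => rw [L.decomp z]
  simp

theorem uc_eq_zero {A : HHModule K} {m n : ℕ} (L : Layer A m n) (hmn : m ≤ n)
    (h : ∀ i < m, A.opX (L.u i) = L.v i) {z : A.carrier} (hz : A.opX z = 0) :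
    ∀ i < m, L.uc i z = 0 := by
  intro i hi
  rw [L.opX_eq_sum] at hz
  refine L.uc_eq_zero_of_sum hmn ?_ hi (f := fun i => L.uc i z)
  rw [← hz]
  exact Finset.sum_congr rfl fun j hj => by rw [h j (Finset.mem_range.mp hj)]

theorem IsW.uc_eq_zero {A : HHModule K} {n : ℕ} {L : Layer A (n + 1) n} (h : L.IsW)
    (hn : 1 ≤ n) {z : A.carrier} (hx : A.opX z = 0) (hy : A.opY z = 0) :
    ∀ i < n + 1, L.uc i z = 0 := by
  intro i hi
  rcases Nat.lt_or_ge i n with hin | hin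
  · rw [L.opY_eq_sum, Finset.sum_range_succ, h.y n (by omega), L.v_ge le_rfl, smul_zero,
      add_zero] at hy
    refine L.uc_eq_zero_of_sum le_rfl ?_ hin (f := fun i => L.uc i z)
    rw [← hy]
    exact Finset.sum_congr rfl fun j hj => by rw [h.y j (by have := Finset.mem_range.mp hj; omega)]
  · obtain ⟨k, rfl⟩ : ∃ k, i = k + 1 := ⟨i - 1, by omega⟩
    rw [L.opX_eq_sum, Finset.sum_range_succ', h.x_zero, smul_zero, add_zero] at hx
    refine L.uc_eq_zero_of_sum le_rfl ?_ (show k < n by omega) (f := fun i => L.uc (i + 1) z)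
    rw [← hx]
    exact Finset.sum_congr rfl fun j hj => by
      rw [h.x_succ j (by have := Finset.mem_range.mp hj; omega)]

end Layer

section string

variable (m n : ℕ)

theorem stringX_x (j : Fin n) (i : Fin m)
    (h : (Matrix.of fun (j : Fin n) (i : Fin m) => if (j : ℕ) = i then (1 : K) else 0) j i ≠ 0) :
    -sgn (j : ℕ) = -sgn (i : ℕ) ∧ sgn (j : ℕ) = sgn (i : ℕ) := by
  have h' : (j : ℕ) = i := by by_contra hne; exact h (by simp [hne])
  simp [h']

theorem stringX_y (j : Fin n) (i : Fin m)
    (h : (Matrix.of fun (j : Fin n) (i : Fin m) => if (j : ℕ) = i + 1 then (1 : K) else 0) j i ≠ 0) :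
    -sgn (j : ℕ) = sgn (i : ℕ) ∧ sgn (j : ℕ) = -sgn (i : ℕ) := by
  have h' : (j : ℕ) = i + 1 := by by_contra hne; exact h (by simp [hne])
  simp [h', sgn, pow_succ]

theorem stringY_x (j : Fin n) (i : Fin m)
    (h : (Matrix.of fun (j : Fin n) (i : Fin m) => if (j : ℕ) + 1 = i then (1 : K) else 0) j i ≠ 0) :
    sgn (j : ℕ) = -sgn (i : ℕ) ∧ -sgn (j : ℕ) = sgn (i : ℕ) := by
  have h' : (j : ℕ) + 1 = i := by by_contra hne; exact h (by simp [hne])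
  simp [← h', sgn, pow_succ]

theorem stringY_y (j : Fin n) (i : Fin m)
    (h : (Matrix.of fun (j : Fin n) (i : Fin m) => if (j : ℕ) = i then (1 : K) else 0) j i ≠ 0) :
    sgn (j : ℕ) = sgn (i : ℕ) ∧ -sgn (j : ℕ) = -sgn (i : ℕ) := by
  have h' : (j : ℕ) = i := by by_contra hne; exact h (by simp [hne])
  simp [h']

theorem C_x (j i : Fin n)
    (h : (Matrix.of fun (j : Fin n) (i : Fin n) => if (j : ℕ) = i then (1 : K) else 0) j i ≠ 0) :
    sgn (j : ℕ) = - -sgn (i : ℕ) ∧ -sgn (j : ℕ) = -sgn (i : ℕ) := by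
  have h' : (j : ℕ) = i := by by_contra hne; exact h (by simp [hne])
  simp [h']

theorem C_y (η : K) (j i : Fin n)
    (h : (Matrix.of fun (j : Fin n) (i : Fin n) => if (j : ℕ) + 1 = i then (1 : K) else
      if (j : ℕ) = i + 1 ∧ Even (i : ℕ) then η else 0) j i ≠ 0) :
    sgn (j : ℕ) = -sgn (i : ℕ) ∧ -sgn (j : ℕ) = - -sgn (i : ℕ) := by
  have h' : (j : ℕ) + 1 = i ∨ (j : ℕ) = i + 1 := by
    by_contra hne
    push Not at hne
    exact h (by simp [hne.1, hne.2])
  rcases h' with h' | h'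
  · simp [← h', sgn, pow_succ]
  · simp [h', sgn, pow_succ]

/-- The coordinates of the string module `stringX`. -/
def layerX (K : Type u) [Field K] (m n : ℕ) : Layer (stringX K m n) m n :=
  Layer.std _ _ _ _ _ _ (stringX_x m n) (stringX_y m n)

/-- The coordinates of the string module `stringY`. -/
def layerY (K : Type u) [Field K] (m n : ℕ) : Layer (stringY K m n) m n :=
  Layer.std _ _ _ _ _ _ (stringY_x m n) (stringY_y m n)

/-- The coordinates of `C(r, η)` in the order of its definition. -/
def layerC₀ (K : Type u) [Field K] (r : ℕ) (η : Kˣ) : Layer (C K r η) (2 * r) (2 * r) :=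
  Layer.std _ _ _ _ _ _ (C_x (2 * r)) (C_y (2 * r) (η : K))

theorem layerX_x {i : ℕ} (hi : i < m) :
    (stringX K m n).opX ((layerX K m n).u i) = (layerX K m n).v i :=
  (Layer.std_opX _ _ _ _ _ _ (stringX_x m n) (stringX_y m n) hi (fun j => if j = i then 1 else 0)
    fun j => by simp).trans (Layer.sum_v (layerX K m n) i)

theorem layerX_y {i : ℕ} (hi : i < m) :
    (stringX K m n).opY ((layerX K m n).u i) = (layerX K m n).v (i + 1) :=
  (Layer.std_opY _ _ _ _ _ _ (stringX_x m n) (stringX_y m n) hi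
    (fun j => if j = i + 1 then 1 else 0) fun j => by simp).trans
      (Layer.sum_v (layerX K m n) (i + 1))

theorem layerX_signs : (layerX K m n).Signs 1 1 (-1) 1 :=
  Layer.signs_std _ _ _ _ _ _ (stringX_x m n) (stringX_y m n) _ _ _ _ (by simp) (by simp)
    (by simp) (by simp)

theorem layerY_isW : (layerY K m n).IsW where
  x_zero := by
    rcases Nat.eq_zero_or_pos m with rfl | hm
    · rw [Layer.u_ge _ le_rfl, map_zero]
    · refine (Layer.std_opX _ _ _ _ _ _ (stringY_x m n) (stringY_y m n) hm (fun _ => 0)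
        fun j => by simp).trans ?_
      simp only [zero_smul, Finset.sum_const_zero]
      rfl
  x_succ i hi := (Layer.std_opX _ _ _ _ _ _ (stringY_x m n) (stringY_y m n) hi
    (fun j => if j = i then 1 else 0) fun j => by simp).trans (Layer.sum_v (layerY K m n) i)
  y i hi := (Layer.std_opY _ _ _ _ _ _ (stringY_x m n) (stringY_y m n) hi
    (fun j => if j = i then 1 else 0) fun j => by simp).trans (Layer.sum_v (layerY K m n) i)

theorem layerY_signs : (layerY K m n).Signs 1 1 1 (-1) :=
  Layer.signs_std _ _ _ _ _ _ (stringY_x m n) (stringY_y m n) _ _ _ _ (by simp) (by simp)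
    (by simp) (by simp)

end string

theorem layerC₀_x (r : ℕ) (η : Kˣ) {i : ℕ} (hi : i < 2 * r) :
    (C K r η).opX ((layerC₀ K r η).u i) = (layerC₀ K r η).v i :=
  (Layer.std_opX _ _ _ _ _ _ (C_x (2 * r)) (C_y (2 * r) (η : K)) hi
    (fun j => if j = i then 1 else 0) fun j => by simp).trans (Layer.sum_v (layerC₀ K r η) i)

theorem layerC₀_y (r : ℕ) (η : Kˣ) {i : ℕ} (hi : i < 2 * r) :
    (C K r η).opY ((layerC₀ K r η).u i) = ∑ j ∈ Finset.range (2 * r),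
      (if j + 1 = i then 1 else if j = i + 1 ∧ Even i then (η : K) else 0) •
        (layerC₀ K r η).v j :=
  Layer.std_opY _ _ _ _ _ _ (C_x (2 * r)) (C_y (2 * r) (η : K)) hi
    (fun j => if j + 1 = i then 1 else if j = i + 1 ∧ Even i then (η : K) else 0)
    fun j => by simp

theorem layerC₀_signs (r : ℕ) (η : Kˣ) : (layerC₀ K r η).Signs (-1) (-1) 1 (-1) :=
  Layer.signs_std _ _ _ _ _ _ (C_x (2 * r)) (C_y (2 * r) (η : K)) _ _ _ _ (by simp) (by simp)
    (by simp) (by simp)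

/-- The coordinates of `M(r)`. -/
def layerM (K : Type u) [Field K] (r : ℕ) : Layer (M K r) r (r + 1) := layerX K r (r + 1)

/-- The coordinates of `N(r)`. -/
def layerN (K : Type u) [Field K] (r : ℕ) : Layer (N K r) r r := layerX K r r

/-- The coordinates of `W(r)`. -/
def layerW (K : Type u) [Field K] (r : ℕ) : Layer (W K r) (r + 1) r := layerY K (r + 1) r

/-- The coordinates of `N'(r)`. -/
def layerN' (K : Type u) [Field K] (r : ℕ) : Layer (N' K r) r r := layerY K r r

/-- The coordinates of `C(r, η)`, in reversed order. -/
def layerC (K : Type u) [Field K] (r : ℕ) (η : Kˣ) : Layer (C K r η) (2 * r) (2 * r) :=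
  (layerC₀ K r η).rev

theorem layerM_isM (r : ℕ) : (layerM K r).IsM where
  x _ hi := layerX_x _ _ hi
  y _ hi := layerX_y _ _ hi

theorem layerN_isA (r : ℕ) : (layerN K r).IsA 0 where
  x _ hi := layerX_x _ _ hi
  y i hi := by
    rw [band_zero_left, zero_smul, add_zero]
    exact layerX_y _ _ hi

theorem layerW_isW (r : ℕ) : (layerW K r).IsW := layerY_isW _ _

theorem layerN'_isW (r : ℕ) : (layerN' K r).IsW := layerY_isW _ _

theorem layerC_isA (r : ℕ) (η : Kˣ) : (layerC K r η).IsA (η : K) where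
  x i hi := by
    rw [layerC, Layer.rev_u _ hi, Layer.rev_v _ hi, layerC₀_x _ _ (by omega)]
  y i hi := by
    rw [layerC, Layer.rev_u _ hi, layerC₀_y _ _ (by omega)]
    have h1 : ∀ j, (if j + 1 = 2 * r - 1 - i then (1 : K) else
        if j = 2 * r - 1 - i + 1 ∧ Even (2 * r - 1 - i) then (η : K) else 0) =
        (if j + 1 = 2 * r - 1 - i then (1 : K) else 0) +
          band (η : K) i * (if j = 2 * r - 1 - i + 1 then 1 else 0) := by
      intro j
      have hpar : Even (2 * r - 1 - i) ↔ Odd i := by grind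
      unfold band
      simp only [hpar]
      split_ifs <;> first | omega | simp_all
    simp only [h1, add_smul, mul_smul, Finset.sum_add_distrib, ← Finset.smul_sum, Layer.sum_v]
    congr 1
    · rcases Nat.lt_or_ge (i + 1) (2 * r) with hi' | hi'
      · rw [Layer.rev_v _ hi', ← Layer.sum_v]
        refine Finset.sum_congr rfl fun j _ => ?_
        congr 2
        simp only [eq_iff_iff]; omega
      · rw [Layer.v_ge _ hi']
        refine Finset.sum_eq_zero fun j _ => ?_
        rw [if_neg (by omega), zero_smul]
    · rcases Nat.eq_zero_or_pos i with rfl | hpos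
      · simp
      · rw [Layer.rev_v _ (by omega)]
        congr 2; omega

theorem layerM_signs (r : ℕ) : (layerM K r).Signs 1 1 (-1) 1 := layerX_signs _ _

theorem layerN_signs (r : ℕ) : (layerN K r).Signs 1 1 (-1) 1 := layerX_signs _ _

theorem layerW_signs (r : ℕ) : (layerW K r).Signs 1 1 1 (-1) := layerY_signs _ _

theorem layerN'_signs (r : ℕ) : (layerN' K r).Signs 1 1 1 (-1) := layerY_signs _ _

theorem layerC_signs {r : ℕ} (hr : 1 ≤ r) (η : Kˣ) : (layerC K r η).Signs 1 1 (-1) 1 := by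
  have h := (layerC₀_signs r η).rev
  have h2 : sgn (2 * r - 1) = -1 := sgn_odd (by grind)
  rw [h2] at h
  simpa [layerC] using h

/-- The coordinates of the one-dimensional module. -/
def layerS (K : Type u) [Field K] (s t : ℤˣ) : Layer (S K s t) 0 1 where
  equiv := LinearEquiv.ofLinearMap (M := (S K s t).carrier)
    (show K →ₗ[K] (Fin 0 → K) × (Fin 1 → K) from
      LinearMap.inr K _ _ ∘ₗ LinearMap.pi fun _ => LinearMap.id)
    (show (Fin 0 → K) × (Fin 1 → K) →ₗ[K] K from LinearMap.proj 0 ∘ₗ LinearMap.snd K _ _)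
    (by
      refine LinearMap.ext fun z => Prod.ext (Subsingleton.elim _ _) (funext fun i => ?_)
      rw [Subsingleton.elim i 0]; rfl)
    rfl
  opX_symm b := by
    have h : (S K s t).opX (b 0 • oneS s t) = 0 := by rw [map_smul, (S_ops s t).2.2.1, smul_zero]
    rw [← h]
    congr 1
    exact (mul_one (b 0)).symm
  opY_symm b := by
    have h : (S K s t).opY (b 0 • oneS s t) = 0 := by rw [map_smul, (S_ops s t).2.2.2, smul_zero]
    rw [← h]
    congr 1
    exact (mul_one (b 0)).symm

theorem layerS_v (s t : ℤˣ) : (layerS K s t).v 0 = oneS s t := rfl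

theorem layerS_signs (s t : ℤˣ) (a b : ℤˣ) : (layerS K s t).Signs a b s t where
  gu i := by simp [Layer.u_ge _ (Nat.zero_le i)]
  hu i := by simp [Layer.u_ge _ (Nat.zero_le i)]
  gv j := by
    rcases Nat.eq_zero_or_pos j with rfl | hj
    · rw [layerS_v, (S_ops s t).1]; simp
    · simp [Layer.v_ge _ hj]
  hv j := by
    rcases Nat.eq_zero_or_pos j with rfl | hj
    · rw [layerS_v, (S_ops s t).2.1]; simp
    · simp [Layer.v_ge _ hj]

theorem sum_iso_left (A : HHModule K) {Z : HHModule K} (hZ : Subsingleton Z.carrier) :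
    A ⊕ₕ Z ≅ₕ A := by
  refine ⟨LinearEquiv.ofLinearMap (LinearMap.fst K A.carrier Z.carrier)
    (LinearMap.inl K A.carrier Z.carrier) rfl ?_, fun _ _ => rfl⟩
  exact LinearMap.ext fun z => Prod.ext rfl (Subsingleton.elim _ _)

/-- The zero module. -/
def zeroModule (K : Type u) [Field K] : HHModule K := pi fun _ : Fin 0 => F1 K 1 1

instance subsingleton_zeroModule : Subsingleton (zeroModule K).carrier :=
  inferInstanceAs (Subsingleton (Fin 0 → (F1 K 1 1).carrier))

instance finite_zeroModule : Module.Finite K (zeroModule K).carrier := pi_F1_finite _ _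

theorem finrank_zeroModule : Module.finrank K (zeroModule K).carrier = 0 :=
  Module.finrank_zero_of_subsingleton

/-! ### Tensor products with `P` -/

/-- A module with a homogeneous basis `e i` satisfies `A ⊗ P ≅ ⨁ P_{σ i, τ i}`: up to terms in
`A ⊗ e`, `A ⊗ xe` and `A ⊗ ye`, the socle vector of the `i`-th summand is `e i ⊗ xye`. -/
theorem tensor_P [CharZero K] {A : HHModule K} [Module.Finite K A.carrier] {ι : Type} [Fintype ι]
    {σ τ : ι → ℤˣ} (e : ι → A.carrier) (hg : ∀ i, A.opG (e i) = (sc (σ i) : K) • e i)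
    (hh : ∀ i, A.opH (e i) = (sc (τ i) : K) • e i)
    (li : ∀ c : ι → K, ∑ i, c i • e i = 0 → c = 0)
    (dim : Module.finrank K A.carrier = Fintype.card ι) :
    A ⊗ₕ P K ≅ₕ pi fun i => F1 K (σ i) (τ i) := by
  refine ((Iso.refl A).tensor P_iso_F1).trans (Iso.trans ?_
    (sum_iso_left _ (subsingleton_zeroModule (K := K))))
  let p : (F1 K 1 1).carrier := F1.mk 1 1 (1, 0, 0, 0)
  let f : (F1 K 1 1).carrier →ₗ[K] K :=
    LinearMap.snd K K K ∘ₗ LinearMap.snd K K (K × K) ∘ₗ LinearMap.snd K K (K × K × K) ∘ₗ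
      (F1.mk 1 1).symm.toLinearMap
  have := finite_tensor (A := A) (B := F1 K 1 1)
  refine splitting (B := zeroModule K) (fun i => tm (e i) p) ?_ ?_ 0
    ⟨by simp, by simp, by simp, by simp⟩ (fun b => Subsingleton.elim _ _) ?_ ?_
  · intro i; simp [p, hg, F1.G]
  · intro i; simp [p, hh, F1.H]
  · intro c b _ _ h
    refine ⟨li c ?_, Subsingleton.elim _ _⟩
    have h1 := congrArg (rc f) h
    simp only [opX_tm, opY_tm, map_add, map_sum, map_smul, map_zero, LinearMap.zero_apply, add_zero,
      rc_tm] at h1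
    have h2 : f p = 0 := by simp [f, p]
    have h3 : f ((F1 K 1 1).opX p) = 0 := by simp [f, p, F1.X]
    have h4 : f ((F1 K 1 1).opY p) = 0 := by simp [f, p, F1.Y]
    have h5 : f ((F1 K 1 1).opX ((F1 K 1 1).opY p)) = 1 := by simp [f, p, F1.Y, F1.X]
    simp only [h2, h3, h4, h5, zero_smul, one_smul, ← map_smul] at h1
    have h6 := congrArg (fun z => A.opH (A.opG z)) h1
    simpa using h6
  · rw [finrank_tensor, finrank_zeroModule, finrank_F1, dim]
    ring

theorem Layer.tensor_P [CharZero K] {A : HHModule K} {m n : ℕ} (L : Layer A m n) {a b c d : ℤˣ}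
    (hL : L.Signs a b c d) : A ⊗ₕ P K ≅ₕ
      (P K).twist a b ^⊕ ((m + 1) / 2) ⊕ₕ (P K).twist (-a) (-b) ^⊕ (m / 2) ⊕ₕ
        (P K).twist c d ^⊕ ((n + 1) / 2) ⊕ₕ (P K).twist (-c) (-d) ^⊕ (n / 2) := by
  have := L.finite
  refine (HHModule.tensor_P (ι := Fin m ⊕ Fin n)
    (σ := Sum.elim (fun i => a * sgn i) (fun j => c * sgn j))
    (τ := Sum.elim (fun i => b * sgn i) (fun j => d * sgn j))
    (Sum.elim (fun i => L.u i) fun j => L.v j) ?_ ?_ ?_ ?_).trans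
      (Iso.trans (pi_sum _) (Iso.trans ((pi_row a b m).sum (pi_row c d n)) (sum_assoc _ _ _)))
  · rintro (i | j)
    · simp [hL.gu]
    · simp [hL.gv]
  · rintro (i | j)
    · simp [hL.hu]
    · simp [hL.hv]
  · intro f hf
    rw [Fintype.sum_sum_type] at hf
    funext i
    rcases i with i | j
    · have h := congrArg (L.uc i) hf
      simpa [L.uc_u i.2, Fin.val_inj] using h
    · have h := congrArg (L.vc j) hf
      simpa [L.vc_v j.2, Fin.val_inj] using h
  · simp [L.finrank]

theorem pi_unit (A : Unit → HHModule K) : pi A ≅ₕ A () :=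
  ⟨LinearEquiv.funUnique Unit K (A ()).carrier, fun _ _ => rfl⟩

theorem P_tensor_P [CharZero K] : P K ⊗ₕ P K ≅ₕ
    P K ⊕ₕ (P K).twist (-1) (-1) ⊕ₕ (P K).twist 1 (-1) ⊕ₕ (P K).twist (-1) 1 := by
  refine (P_iso_F1.tensor (Iso.refl _)).trans ?_
  refine (tensor_P (ι := Unit ⊕ Unit ⊕ Unit ⊕ Unit)
    (σ := Sum.elim (fun _ => 1) (Sum.elim (fun _ => -1) (Sum.elim (fun _ => 1) fun _ => -1)))
    (τ := Sum.elim (fun _ => 1) (Sum.elim (fun _ => -1) (Sum.elim (fun _ => -1) fun _ => 1)))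
    (Sum.elim (fun _ => F1.mk 1 1 (1, 0, 0, 0)) (Sum.elim (fun _ => F1.mk 1 1 (0, 0, 0, 1))
      (Sum.elim (fun _ => F1.mk 1 1 (0, 0, 1, 0)) fun _ => F1.mk 1 1 (0, 1, 0, 0)))) ?_ ?_ ?_
    ?_).trans (Iso.trans (pi_sum _) (Iso.sum ((pi_unit _).trans P_iso_F1.symm)
      (Iso.trans (pi_sum _) (Iso.sum ((pi_unit _).trans (twist_P_iso_F1 _ _).symm)
        (Iso.trans (pi_sum _) (Iso.sum ((pi_unit _).trans (twist_P_iso_F1 _ _).symm)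
          ((pi_unit _).trans (twist_P_iso_F1 _ _).symm)))))))
  · rintro (i | i | i | i) <;> simp [F1.G, ← map_neg]
  · rintro (i | i | i | i) <;> simp [F1.H, ← map_neg]
  · intro f hf
    have h := congrArg (F1.mk 1 1).symm hf
    simp only [Fintype.sum_sum_type, Sum.elim_inl, Sum.elim_inr, map_add, map_smul,
      LinearEquiv.symm_apply_apply, Finset.univ_unique, Finset.sum_singleton, map_zero,
      Prod.smul_mk, Prod.mk_add_mk, smul_eq_mul, mul_zero, mul_one, add_zero, zero_add,
      Prod.mk_eq_zero] at h
    funext i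
    rcases i with i | i | i | i
    · exact h.1
    · exact h.2.2.2
    · exact h.2.2.1
    · exact h.2.1
  · rw [finrank_F1]; rfl

/-! ### The splitting criterion for chessboards -/

/-- The splitting criterion for vectors `w i j` (`i < a`, `j < b`) with the signs of a chessboard,
with `x y w_{i j} = E i j`. -/
theorem splitting_grid [CharZero K] {T B : HHModule K} [Module.Finite K T.carrier]
    [Module.Finite K B.carrier] (s : ℤˣ) (a b : ℕ) {k l : ℕ} (hk : s = 1 → k = (a * b + 1) / 2)
    (hl : s = -1 → l = (a * b + 1) / 2) (hkl : k + l = a * b) (w E : ℕ → ℕ → T.carrier)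
    (hg : ∀ i < a, ∀ j < b, T.opG (w i j) = ((sc s : K) * (-1) ^ (i + j)) • w i j)
    (hh : ∀ i < a, ∀ j < b, T.opH (w i j) = ((sc s : K) * (-1) ^ (i + j)) • w i j)
    (hE : ∀ i < a, ∀ j < b, T.opX (T.opY (w i j)) = E i j)
    (φ : B.carrier →ₗ[K] T.carrier) (hφ : IsHom B T φ) (hXY : ∀ b, B.opX (B.opY b) = 0)
    (inj : ∀ c : ℕ → ℕ → K, (∀ i j, ¬(i < a ∧ j < b) → c i j = 0) → ∀ z : B.carrier,
      B.opX z = 0 → B.opY z = 0 →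
      ∑ i ∈ Finset.range a, ∑ j ∈ Finset.range b, c i j • E i j + φ z = 0 →
        (∀ i < a, ∀ j < b, c i j = 0) ∧ z = 0)
    (dim : Module.finrank K T.carrier = 4 * (a * b) + Module.finrank K B.carrier) :
    T ≅ₕ P K ^⊕ k ⊕ₕ (P K).twist (-1) (-1) ^⊕ l ⊕ₕ B := by
  refine Iso.trans (splitting (ι := Fin a × Fin b) (σ := fun i => s * sgn (i.1 + i.2))
    (τ := fun i => s * sgn (i.1 + i.2)) (fun i => w i.1 i.2) ?_ ?_ φ hφ hXY ?_ ?_)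
    (((pi_grid s a b k l hk hl hkl).sum (Iso.refl _)).trans (sum_assoc _ _ _))
  · intro i; rw [hg _ i.1.2 _ i.2.2]; simp
  · intro i; rw [hh _ i.1.2 _ i.2.2]; simp
  · intro c z hx hy hz
    let c' : ℕ → ℕ → K := fun i j => if h : i < a ∧ j < b then c (⟨i, h.1⟩, ⟨j, h.2⟩) else 0
    have hc' : ∀ i : Fin a × Fin b, c i = c' i.1 i.2 := by
      intro i; simp [c']
    have hsum : ∑ i ∈ Finset.range a, ∑ j ∈ Finset.range b, c' i j • E i j =
        ∑ i : Fin a × Fin b, c i • T.opX (T.opY (w i.1 i.2)) := by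
      rw [← Finset.univ_product_univ, Finset.sum_product,
        ← Fin.sum_univ_eq_sum_range (fun i => ∑ j ∈ Finset.range b, c' i j • E i j) a]
      refine Finset.sum_congr rfl fun i _ => ?_
      rw [← Fin.sum_univ_eq_sum_range (fun j => c' i j • E i j) b]
      refine Finset.sum_congr rfl fun j _ => ?_
      rw [hE _ i.2 _ j.2, hc']
    obtain ⟨h1, h2⟩ := inj c' (fun i j h => dif_neg h) z hx hy (by rw [hsum]; exact hz)
    exact ⟨funext fun i => (hc' i).trans (h1 _ i.1.2 _ i.2.2), h2⟩
  · rw [dim, Fintype.card_prod, Fintype.card_fin, Fintype.card_fin]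

/-- `splitting_grid` for a complement which is given by coordinates. -/
theorem splitting_layer [CharZero K] {T B : HHModule K} [Module.Finite K T.carrier] {m n : ℕ}
    (L : Layer B m n) (s : ℤˣ) (a b : ℕ) {k l : ℕ} (hk : s = 1 → k = (a * b + 1) / 2)
    (hl : s = -1 → l = (a * b + 1) / 2) (hkl : k + l = a * b) (w E : ℕ → ℕ → T.carrier)
    (hg : ∀ i < a, ∀ j < b, T.opG (w i j) = ((sc s : K) * (-1) ^ (i + j)) • w i j)
    (hh : ∀ i < a, ∀ j < b, T.opH (w i j) = ((sc s : K) * (-1) ^ (i + j)) • w i j)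
    (hE : ∀ i < a, ∀ j < b, T.opX (T.opY (w i j)) = E i j)
    (U V : ℕ → T.carrier) (hφ : IsHom B T (L.map U V))
    (hXY : ∀ i < m, B.opX (B.opY (L.u i)) = 0)
    (hker : ∀ z, B.opX z = 0 → B.opY z = 0 → ∀ i < m, L.uc i z = 0)
    (inj : ∀ (c : ℕ → ℕ → K) (d : ℕ → K), (∀ i j, ¬(i < a ∧ j < b) → c i j = 0) →
      ∑ i ∈ Finset.range a, ∑ j ∈ Finset.range b, c i j • E i j +
        ∑ j ∈ Finset.range n, d j • V j = 0 →
        (∀ i < a, ∀ j < b, c i j = 0) ∧ ∀ j < n, d j = 0)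
    (dim : Module.finrank K T.carrier = 4 * (a * b) + (m + n)) :
    T ≅ₕ P K ^⊕ k ⊕ₕ (P K).twist (-1) (-1) ^⊕ l ⊕ₕ B := by
  have := L.finite
  refine splitting_grid s a b hk hl hkl w E hg hh hE (L.map U V) hφ
    (fun z => L.opX_opY z hXY) ?_ (by rw [dim, L.finrank])
  intro c hc z hx hy hz
  have hu := hker z hx hy
  have hu0 : ∀ {T' : HHModule K} (f : ℕ → T'.carrier),
      ∑ i ∈ Finset.range m, L.uc i z • f i = 0 := fun f =>
    Finset.sum_eq_zero fun i hi => by rw [hu i (Finset.mem_range.mp hi), zero_smul]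
  rw [L.map_apply, hu0, zero_add] at hz
  obtain ⟨h1, h2⟩ := inj c (fun j => L.vc j z) hc hz
  refine ⟨h1, ?_⟩
  rw [L.decomp z, hu0, zero_add]
  exact Finset.sum_eq_zero fun j hj => by rw [h2 j (Finset.mem_range.mp hj), zero_smul]

/-- `splitting_grid` without a complement. -/
theorem splitting_projective [CharZero K] {T : HHModule K} [Module.Finite K T.carrier]
    (s : ℤˣ) (a b : ℕ) {k l : ℕ} (hk : s = 1 → k = (a * b + 1) / 2)
    (hl : s = -1 → l = (a * b + 1) / 2) (hkl : k + l = a * b) (w E : ℕ → ℕ → T.carrier)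
    (hg : ∀ i < a, ∀ j < b, T.opG (w i j) = ((sc s : K) * (-1) ^ (i + j)) • w i j)
    (hh : ∀ i < a, ∀ j < b, T.opH (w i j) = ((sc s : K) * (-1) ^ (i + j)) • w i j)
    (hE : ∀ i < a, ∀ j < b, T.opX (T.opY (w i j)) = E i j)
    (inj : ∀ c : ℕ → ℕ → K, ∑ i ∈ Finset.range a, ∑ j ∈ Finset.range b, c i j • E i j = 0 →
      ∀ i < a, ∀ j < b, c i j = 0)
    (dim : Module.finrank K T.carrier = 4 * (a * b)) :
    T ≅ₕ P K ^⊕ k ⊕ₕ (P K).twist (-1) (-1) ^⊕ l :=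
  (splitting_grid s a b hk hl hkl w E hg hh hE (0 : (zeroModule K).carrier →ₗ[K] T.carrier)
    ⟨by simp, by simp, by simp, by simp⟩ (fun b => Subsingleton.elim _ _)
    (fun c _ z _ _ h => ⟨inj c (by simpa using h), Subsingleton.elim _ _⟩)
    (by rw [dim, finrank_zeroModule, add_zero])).trans
    ((Iso.refl _).sum (sum_iso_left _ subsingleton_zeroModule))

/-! ### Chessboards and the splitting criterion for the different shapes -/

/-- A chessboard with `N` squares and the sign `s` in the corner has `k` positive and `l` negative
squares: the squares of sign `s` are `⌈N / 2⌉` in number. -/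
structure Halves (s : ℤˣ) (N k l : ℕ) : Prop where
  pos : s = 1 → k = (N + 1) / 2
  neg : s = -1 → l = (N + 1) / 2
  add : k + l = N

/-- There are vectors `w_{i j}` (`i < a`, `j < b`) with the signs `s (-1)^(i+j)` of a chessboard and
with `x y w_{i j} = E i j`. -/
def IsBoard (T : HHModule K) (s : ℤˣ) (a b : ℕ) (E : ℕ → ℕ → T.carrier) : Prop :=
  ∃ w : ℕ → ℕ → T.carrier, ∀ i < a, ∀ j < b,
    T.opG (w i j) = ((sc s : K) * (-1) ^ (i + j)) • w i j ∧
    T.opH (w i j) = ((sc s : K) * (-1) ^ (i + j)) • w i j ∧ T.opX (T.opY (w i j)) = E i j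

theorem IsBoard.mono {T : HHModule K} {s : ℤˣ} {a b a' b' : ℕ} {E : ℕ → ℕ → T.carrier}
    (h : IsBoard T s a b E) (ha : a' ≤ a) (hb : b' ≤ b) : IsBoard T s a' b' E := by
  obtain ⟨w, hw⟩ := h
  exact ⟨w, fun i hi j hj => hw i (by omega) j (by omega)⟩

theorem IsBoard.congr {T : HHModule K} {s : ℤˣ} {a b : ℕ} {E E' : ℕ → ℕ → T.carrier}
    (h : IsBoard T s a b E) (hE : ∀ i < a, ∀ j < b, E i j = E' i j) : IsBoard T s a b E' := by
  obtain ⟨w, hw⟩ := h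
  exact ⟨w, fun i hi j hj => hE i hi j hj ▸ hw i hi j hj⟩

theorem sc_mul_neg_one_pow_self (s : ℤˣ) (i : ℕ) :
    ((sc s : K) * (-1) ^ i) * ((sc s : K) * (-1) ^ i) = 1 := by
  rw [mul_mul_mul_comm, sc_mul_self, ← mul_pow]; simp

theorem opX_opY_tm {A B : HHModule K} {u : A.carrier} {b : B.carrier} {ε : K}
    (hg : A.opG u = ε • u) (hh : A.opH u = ε • u) (hu : A.opX (A.opY u) = 0)
    (hb : B.opX (B.opY b) = 0) :
    (A ⊗ₕ B).opX ((A ⊗ₕ B).opY (tm u b)) =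
      ε • (tm (A.opY u) (B.opX b) + tm (A.opX u) (B.opY b)) := by
  simp [hg, hh, hu, hb, opG_opY]

/-- The vectors `± u_i ⊗ u'_{j + t}` form a chessboard. -/
theorem Layer.isBoard {A B : HHModule K} {m n m' n' : ℕ} (L : Layer A m n) (L' : Layer B m' n')
    {p c d q c' d' : ℤˣ} (hL : L.Signs p p c d) (hL' : L'.Signs q q c' d')
    (hA : ∀ i < m, A.opX (A.opY (L.u i)) = 0) (hB : ∀ i < m', B.opX (B.opY (L'.u i)) = 0) (t : ℕ) :
    IsBoard (A ⊗ₕ B) (p * q * sgn t) m (m' - t) fun i j =>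
      tm (A.opY (L.u i)) (B.opX (L'.u (j + t))) + tm (A.opX (L.u i)) (B.opY (L'.u (j + t))) := by
  refine ⟨fun i j => ((sc p : K) * (-1) ^ i) • tm (L.u i) (L'.u (j + t)), fun i hi j hj =>
    ⟨?_, ?_, ?_⟩⟩
  · rw [map_smul, opG_tm, hL.gu, hL'.gu, map_smul, map_smul, LinearMap.smul_apply]
    simp only [smul_smul]
    congr 1
    simp only [sc_mul, sc_pow, sc_neg, sc_one]
    ring
  · rw [map_smul, opH_tm, hL.hu, hL'.hu, map_smul, map_smul, LinearMap.smul_apply]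
    simp only [smul_smul]
    congr 1
    simp only [sc_mul, sc_pow, sc_neg, sc_one]
    ring
  · rw [map_smul, map_smul, opX_opY_tm (hL.gu i) (hL.hu i) (hA i hi) (hB _ (by omega)), smul_smul,
      sc_mul_neg_one_pow_self, one_smul]

namespace Layer

variable {A B T : HHModule K}

theorem IsM.opX_opY_u {m : ℕ} {L : Layer A m (m + 1)} (h : L.IsM) (i : ℕ) (hi : i < m) :
    A.opX (A.opY (L.u i)) = 0 := by rw [h.y i hi, opX_v]

theorem IsW.opX_opY_u {m n : ℕ} {L : Layer A m n} (h : L.IsW) (i : ℕ) (hi : i < m) :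
    A.opX (A.opY (L.u i)) = 0 := by rw [h.y i hi, opX_v]

theorem IsA.opX_opY_u {n : ℕ} {L : Layer A n n} {η : K} (h : L.IsA η) (i : ℕ) (hi : i < n) :
    A.opX (A.opY (L.u i)) = 0 := by rw [h.y i hi]; simp

theorem IsM.isHom_map {m : ℕ} {L : Layer B m (m + 1)} (h : L.IsM) (hm : 1 ≤ m) {p q : ℤˣ}
    (hL : L.Signs p q (-p) q) (U V : ℕ → T.carrier)
    (gU : ∀ i < m, T.opG (U i) = ((sc p : K) * (-1) ^ i) • U i)
    (hU : ∀ i < m, T.opH (U i) = ((sc q : K) * (-1) ^ i) • U i)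
    (x : ∀ i < m, T.opX (U i) = V i) (y : ∀ i < m, T.opY (U i) = V (i + 1))
    (xy : ∀ i < m, T.opX (T.opY (U i)) = 0) : IsHom B T (L.map U V) := by
  refine L.isHom_map hL U V gU hU ?_ ?_ ?_ ?_ ?_ ?_
  · intro j hj
    rcases Nat.eq_zero_or_pos j with rfl | hj'
    · rw [← x 0 hm, opG_opX, gU 0 hm, map_smul, ← neg_smul]; simp
    · obtain ⟨i, rfl⟩ : ∃ i, j = i + 1 := ⟨j - 1, by omega⟩
      rw [← y i (by omega), opG_opY, gU i (by omega), map_smul]; congr 1; simp [pow_succ]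
  · intro j hj
    rcases Nat.eq_zero_or_pos j with rfl | hj'
    · rw [← x 0 hm, opH_opX, hU 0 hm, map_smul]
    · obtain ⟨i, rfl⟩ : ∃ i, j = i + 1 := ⟨j - 1, by omega⟩
      rw [← y i (by omega), opH_opY, hU i (by omega), map_smul, ← neg_smul]; congr 1
      simp [pow_succ]
  · intro i hi; rw [x i hi, h.x i hi, L.map_v _ _ (by omega)]
  · intro i hi; rw [y i hi, h.y i hi, L.map_v _ _ (by omega)]
  · intro j hj
    rcases Nat.lt_or_ge j m with hj' | hj'
    · rw [← x j hj', opX_opX]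
    · obtain ⟨i, rfl⟩ : ∃ i, j = i + 1 := ⟨j - 1, by omega⟩
      rw [← y i (by omega), xy i (by omega)]
  · intro j hj
    rcases Nat.lt_or_ge j m with hj' | hj'
    · rw [← x j hj', opY_opX, xy j hj']
    · obtain ⟨i, rfl⟩ : ∃ i, j = i + 1 := ⟨j - 1, by omega⟩
      rw [← y i (by omega), opY_opY]

theorem IsW.isHom_map {n : ℕ} {L : Layer B (n + 1) n} (h : L.IsW) {p q : ℤˣ}
    (hL : L.Signs p q p (-q)) (U V : ℕ → T.carrier)
    (gU : ∀ i < n + 1, T.opG (U i) = ((sc p : K) * (-1) ^ i) • U i)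
    (hU : ∀ i < n + 1, T.opH (U i) = ((sc q : K) * (-1) ^ i) • U i)
    (x_zero : T.opX (U 0) = 0) (x_succ : ∀ i < n, T.opX (U (i + 1)) = V i)
    (y : ∀ i < n, T.opY (U i) = V i) (y_last : T.opY (U n) = 0) : IsHom B T (L.map U V) := by
  refine L.isHom_map hL U V gU hU ?_ ?_ ?_ ?_ ?_ ?_
  · intro j hj
    rw [← y j hj, opG_opY, gU j (by omega), map_smul]
  · intro j hj
    rw [← y j hj, opH_opY, hU j (by omega), map_smul, ← neg_smul]; congr 1; simp
  · intro i hi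
    rcases Nat.eq_zero_or_pos i with rfl | hi'
    · rw [x_zero, h.x_zero, map_zero]
    · obtain ⟨i, rfl⟩ : ∃ k, i = k + 1 := ⟨i - 1, by omega⟩
      rw [x_succ i (by omega), h.x_succ i (by omega), L.map_v _ _ (by omega)]
  · intro i hi
    rcases Nat.lt_or_ge i n with hi' | hi'
    · rw [y i hi', h.y i hi, L.map_v _ _ hi']
    · obtain rfl : i = n := by omega
      rw [y_last, h.y i hi, L.v_ge le_rfl, map_zero]
  · intro j hj; rw [← x_succ j hj, opX_opX]
  · intro j hj; rw [← y j hj, opY_opY]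

theorem IsA.isHom_map {n : ℕ} {L : Layer B n n} {η : K} (h : L.IsA η) {p q : ℤˣ}
    (hL : L.Signs p q (-p) q) (U : ℕ → T.carrier)
    (gU : ∀ i < n, T.opG (U i) = ((sc p : K) * (-1) ^ i) • U i)
    (hU : ∀ i < n, T.opH (U i) = ((sc q : K) * (-1) ^ i) • U i)
    (y : ∀ i < n, T.opY (U i) = T.opX (U (i + 1)) + band η i • T.opX (U (i - 1)))
    (last : T.opX (U n) = 0) : IsHom B T (L.map U fun i => T.opX (U i)) := by
  refine L.isHom_map hL U _ gU hU ?_ ?_ ?_ ?_ ?_ ?_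
  · intro j hj
    rw [opG_opX, gU j hj, map_smul, ← neg_smul]; simp
  · intro j hj
    rw [opH_opX, hU j hj, map_smul]
  · intro i hi; rw [h.x i hi, L.map_v _ _ hi]
  · intro i hi
    rw [y i hi, h.y i hi, map_add, map_smul, L.map_v _ _ (show i - 1 < n by omega)]
    congr 1
    rcases Nat.lt_or_ge (i + 1) n with hi' | hi'
    · rw [L.map_v _ _ hi']
    · obtain rfl : i + 1 = n := by omega
      rw [last, L.v_ge le_rfl, map_zero]
  · intro j hj; exact opX_opX _ _
  · intro j hj
    rw [opY_opX, y j hj, map_add, map_smul, opX_opX, opX_opX, smul_zero, add_zero]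

/-- The splitting criterion for a complement of the shape of `M`. A homomorphism from it is given by
the images `U i` and `V j` of the two layers, and `inj` is injectivity on the socle. -/
theorem IsM.splitting [CharZero K] {m : ℕ} {L : Layer B m (m + 1)} (h : L.IsM)
    [Module.Finite K T.carrier] (hm : 1 ≤ m) {p q : ℤˣ} (hL : L.Signs p q (-p) q) {s : ℤˣ}
    {a b k l : ℕ} (hkl : Halves s (a * b) k l) {E : ℕ → ℕ → T.carrier} (hE : IsBoard T s a b E)
    (U V : ℕ → T.carrier)
    (gU : ∀ i < m, T.opG (U i) = ((sc p : K) * (-1) ^ i) • U i)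
    (hU : ∀ i < m, T.opH (U i) = ((sc q : K) * (-1) ^ i) • U i)
    (x : ∀ i < m, T.opX (U i) = V i) (y : ∀ i < m, T.opY (U i) = V (i + 1))
    (xy : ∀ i < m, T.opX (T.opY (U i)) = 0)
    (inj : ∀ (c : ℕ → ℕ → K) (d : ℕ → K), (∀ i j, ¬(i < a ∧ j < b) → c i j = 0) →
      ∑ i ∈ Finset.range a, ∑ j ∈ Finset.range b, c i j • E i j +
        ∑ j ∈ Finset.range (m + 1), d j • V j = 0 →
        (∀ i < a, ∀ j < b, c i j = 0) ∧ ∀ j < m + 1, d j = 0)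
    (dim : Module.finrank K T.carrier = 4 * (a * b) + (m + (m + 1))) :
    T ≅ₕ P K ^⊕ k ⊕ₕ (P K).twist (-1) (-1) ^⊕ l ⊕ₕ B := by
  obtain ⟨w, hw⟩ := hE
  exact splitting_layer L s a b hkl.pos hkl.neg hkl.add w E (fun i hi j hj => (hw i hi j hj).1)
    (fun i hi j hj => (hw i hi j hj).2.1) (fun i hi j hj => (hw i hi j hj).2.2) U V
    (h.isHom_map hm hL U V gU hU x y xy) h.opX_opY_u
    (fun _ hx _ => L.uc_eq_zero (Nat.le_succ m) h.x hx) inj dim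

/-- The splitting criterion for a complement of the shape of `W`. -/
theorem IsW.splitting [CharZero K] {n : ℕ} {L : Layer B (n + 1) n} (h : L.IsW)
    [Module.Finite K T.carrier] (hn : 1 ≤ n) {p q : ℤˣ} (hL : L.Signs p q p (-q)) {s : ℤˣ}
    {a b k l : ℕ} (hkl : Halves s (a * b) k l) {E : ℕ → ℕ → T.carrier} (hE : IsBoard T s a b E)
    (U V : ℕ → T.carrier)
    (gU : ∀ i < n + 1, T.opG (U i) = ((sc p : K) * (-1) ^ i) • U i)
    (hU : ∀ i < n + 1, T.opH (U i) = ((sc q : K) * (-1) ^ i) • U i)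
    (x_zero : T.opX (U 0) = 0) (x_succ : ∀ i < n, T.opX (U (i + 1)) = V i)
    (y : ∀ i < n, T.opY (U i) = V i) (y_last : T.opY (U n) = 0)
    (inj : ∀ (c : ℕ → ℕ → K) (d : ℕ → K), (∀ i j, ¬(i < a ∧ j < b) → c i j = 0) →
      ∑ i ∈ Finset.range a, ∑ j ∈ Finset.range b, c i j • E i j +
        ∑ j ∈ Finset.range n, d j • V j = 0 →
        (∀ i < a, ∀ j < b, c i j = 0) ∧ ∀ j < n, d j = 0)
    (dim : Module.finrank K T.carrier = 4 * (a * b) + (n + 1 + n)) :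
    T ≅ₕ P K ^⊕ k ⊕ₕ (P K).twist (-1) (-1) ^⊕ l ⊕ₕ B := by
  obtain ⟨w, hw⟩ := hE
  exact splitting_layer L s a b hkl.pos hkl.neg hkl.add w E (fun i hi j hj => (hw i hi j hj).1)
    (fun i hi j hj => (hw i hi j hj).2.1) (fun i hi j hj => (hw i hi j hj).2.2) U V
    (h.isHom_map hL U V gU hU x_zero x_succ y y_last) h.opX_opY_u
    (fun _ hx hy => h.uc_eq_zero hn hx hy) inj dim

/-- The splitting criterion for a complement of the shape of `N` or `C`, where the images of the lower
layer are determined as `x U i`. -/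
theorem IsA.splitting [CharZero K] {n : ℕ} {L : Layer B n n} {η : K} (h : L.IsA η)
    [Module.Finite K T.carrier] {p q : ℤˣ} (hL : L.Signs p q (-p) q) {s : ℤˣ}
    {a b k l : ℕ} (hkl : Halves s (a * b) k l) {E : ℕ → ℕ → T.carrier} (hE : IsBoard T s a b E)
    (U : ℕ → T.carrier)
    (gU : ∀ i < n, T.opG (U i) = ((sc p : K) * (-1) ^ i) • U i)
    (hU : ∀ i < n, T.opH (U i) = ((sc q : K) * (-1) ^ i) • U i)
    (y : ∀ i < n, T.opY (U i) = T.opX (U (i + 1)) + band η i • T.opX (U (i - 1)))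
    (last : T.opX (U n) = 0)
    (inj : ∀ (c : ℕ → ℕ → K) (d : ℕ → K), (∀ i j, ¬(i < a ∧ j < b) → c i j = 0) →
      ∑ i ∈ Finset.range a, ∑ j ∈ Finset.range b, c i j • E i j +
        ∑ j ∈ Finset.range n, d j • T.opX (U j) = 0 →
        (∀ i < a, ∀ j < b, c i j = 0) ∧ ∀ j < n, d j = 0)
    (dim : Module.finrank K T.carrier = 4 * (a * b) + (n + n)) :
    T ≅ₕ P K ^⊕ k ⊕ₕ (P K).twist (-1) (-1) ^⊕ l ⊕ₕ B := by
  obtain ⟨w, hw⟩ := hE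
  exact splitting_layer L s a b hkl.pos hkl.neg hkl.add w E (fun i hi j hj => (hw i hi j hj).1)
    (fun i hi j hj => (hw i hi j hj).2.1) (fun i hi j hj => (hw i hi j hj).2.2) U _
    (h.isHom_map hL U gU hU y last) h.opX_opY_u
    (fun _ hx _ => L.uc_eq_zero le_rfl h.x hx) inj dim

end Layer

/-! Extraction of coefficients from double sums. -/

theorem sum_sum_delta {a b : ℕ} {c : ℕ → ℕ → K} (hc : ∀ i j, ¬(i < a ∧ j < b) → c i j = 0)
    (k l : ℕ) : ∑ i ∈ Finset.range a, ∑ j ∈ Finset.range b,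
      c i j * ((if k = i then 1 else 0) * (if l = j then 1 else 0)) = c k l := by
  by_cases h : k < a ∧ l < b
  · simp [h.1, h.2]
  · rw [hc k l h]
    refine Finset.sum_eq_zero fun i hi => Finset.sum_eq_zero fun j hj => ?_
    rw [Finset.mem_range] at hi hj
    split_ifs <;> first | (exfalso; omega) | simp

theorem sum_sum_delta_left {M : Type*} [AddCommGroup M] [Module K M] {a b : ℕ} {c : ℕ → ℕ → K}
    (hc : ∀ i j, ¬(i < a ∧ j < b) → c i j = 0) (k : ℕ) (f : ℕ → M) :
    ∑ i ∈ Finset.range a, ∑ j ∈ Finset.range b, c i j • ((if k = i then (1 : K) else 0) • f j) =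
      ∑ j ∈ Finset.range b, c k j • f j := by
  by_cases h : k < a
  · rw [Finset.sum_eq_single k]
    · simp
    · intro i _ hi; simp [Ne.symm hi]
    · intro hk; exact absurd (Finset.mem_range.mpr h) hk
  · rw [Finset.sum_eq_zero, Finset.sum_eq_zero]
    · intro j _; rw [hc _ _ (by omega), zero_smul]
    · intro i hi
      rw [Finset.mem_range] at hi
      simp [show k ≠ i by omega]

theorem sum_sum_delta_succ_right {a b : ℕ} {c : ℕ → ℕ → K}
    (hc : ∀ i j, ¬(i < a ∧ j < b) → c i j = 0) (k l : ℕ) :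
    ∑ i ∈ Finset.range a, ∑ j ∈ Finset.range b,
      c i j * ((if k = i then 1 else 0) * (if l = j + 1 then 1 else 0)) =
        if l = 0 then 0 else c k (l - 1) := by
  rcases l with _ | l
  · simp
  · simpa using sum_sum_delta hc k l

/-- A recursion along the antidiagonals of a grid, from the column `j = 0` on. -/
theorem antidiagonal_eq_zero {m n : ℕ} {c : ℕ → ℕ → K}
    (hc : ∀ i j, ¬(i < m ∧ j < n) → c i j = 0)
    (h : ∀ j < n, ∀ i < m, c i j + (if j = 0 then 0 else c (i + 1) (j - 1)) = 0) (i j : ℕ) :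
    c i j = 0 := by
  induction j generalizing i with
  | zero =>
    by_cases hij : i < m ∧ 0 < n
    · simpa using h 0 hij.2 i hij.1
    · exact hc _ _ hij
  | succ j ih =>
    by_cases hij : i < m ∧ j + 1 < n
    · simpa [ih] using h (j + 1) hij.2 i hij.1
    · exact hc _ _ hij

theorem coeff_eq_zero_of_add {M : Type*} [AddCommGroup M] [Module K M] {N : ℕ} {V : ℕ → M} {R : M}
    {d : ℕ → K} (h : R + ∑ j ∈ Finset.range N, d j • V j = 0) {j : ℕ} (hj : j < N) (f : M →ₗ[K] K)
    (hR : f R = 0) (h1 : f (V j) ≠ 0) (h0 : ∀ i < N, i ≠ j → f (V i) = 0) : d j = 0 := by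
  have h' := congrArg f h
  rw [map_add, hR, zero_add, map_sum, Finset.sum_eq_single j] at h'
  · rw [map_smul, map_zero, smul_eq_mul] at h'
    exact (mul_eq_zero.mp h').resolve_right h1
  · intro i hi hij; rw [map_smul, h0 i (Finset.mem_range.mp hi) hij, smul_zero]
  · intro hj'; exact absurd (Finset.mem_range.mpr hj) hj'

theorem coeff_eq_zero {M : Type*} [AddCommGroup M] [Module K M] {N : ℕ} {V : ℕ → M} {d : ℕ → K}
    (h : ∑ j ∈ Finset.range N, d j • V j = 0) {j : ℕ} (hj : j < N) (f : M →ₗ[K] K)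
    (h1 : f (V j) ≠ 0) (h0 : ∀ i < N, i ≠ j → f (V i) = 0) : d j = 0 :=
  coeff_eq_zero_of_add (R := 0) (by rwa [zero_add]) hj f (map_zero f) h1 h0

namespace Layer

variable {A B : HHModule K} {m n m' n' : ℕ} (L : Layer A m n) (L' : Layer B m' n')

/-- The coefficient of `v_k ⊗ v'_l`. -/
def vv (k l : ℕ) : (A ⊗ₕ B).carrier →ₗ[K] K := L'.vc l ∘ₗ lc (L.vc k)

/-- The coefficient of `u_k ⊗ v'_l`. -/
def uv (k l : ℕ) : (A ⊗ₕ B).carrier →ₗ[K] K := L'.vc l ∘ₗ lc (L.uc k)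

@[simp] theorem vv_tm (k l : ℕ) (z : A.carrier) (z' : B.carrier) :
    L.vv L' k l (tm z z') = L.vc k z * L'.vc l z' := by simp [vv]

@[simp] theorem uv_tm (k l : ℕ) (z : A.carrier) (z' : B.carrier) :
    L.uv L' k l (tm z z') = L.uc k z * L'.vc l z' := by simp [uv]

end Layer

namespace Layer

variable {A B Z : HHModule K}

/-! ### `M(r) ⊗ M(s)` -/

/-- The chessboard consists of all `± u_i ⊗ u'_j`. The upper layer of the complement is
`± v_0 ⊗ u'_0, …, ± v_0 ⊗ u'_{n-1}, ± u_0 ⊗ v'_n, …, ± u_{m-1} ⊗ v'_n`: the copies `v_0 ⊗ B` and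
`A ⊗ v'_n` of the factors, joined at `v_0 ⊗ v'_n`. -/
theorem IsM.tensor_isM [CharZero K] {m n k l : ℕ} {L : Layer A m (m + 1)} (hL : L.IsM)
    {L' : Layer B n (n + 1)} (hL' : L'.IsM) (sL : L.Signs 1 1 (-1) 1) (sL' : L'.Signs 1 1 (-1) 1)
    (hm : 1 ≤ m) {LZ : Layer Z (m + n) (m + n + 1)} (hZ : LZ.IsM)
    (sZ : LZ.Signs (-1) 1 1 1) (hkl : Halves 1 (m * n) k l) :
    A ⊗ₕ B ≅ₕ P K ^⊕ k ⊕ₕ (P K).twist (-1) (-1) ^⊕ l ⊕ₕ Z := by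
  have := L.finite; have := L'.finite
  have := finite_tensor (A := A) (B := B)
  have hE := (L.isBoard L' sL sL' hL.opX_opY_u hL'.opX_opY_u 0).congr
    (E' := fun i j => tm (L.v (i + 1)) (L'.v j) + tm (L.v i) (L'.v (j + 1)))
    (fun i hi j hj => by
      simp only [add_zero, hL.y i hi, hL'.x j hj, hL.x i hi, hL'.y j hj])
  have hgv : A.opG (L.v 0) = -L.v 0 := by simpa using sL.gv 0
  have hhv : A.opH (L.v 0) = L.v 0 := by simpa using sL.hv 0
  refine hZ.splitting (p := -1) (q := 1) (s := 1) (a := m) (b := n)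
    (E := fun i j => tm (L.v (i + 1)) (L'.v j) + tm (L.v i) (L'.v (j + 1))) (by omega)
    (by simpa using sZ) hkl (by simpa using hE)
    (fun l => if l < n then (-1 : K) ^ l • tm (L.v 0) (L'.u l) else
      (-1 : K) ^ (n + 1) • tm (L.u (l - n)) (L'.v n))
    (fun l => if l < n then (-1 : K) ^ (l + 1) • tm (L.v 0) (L'.v l) else
      (-1 : K) ^ (n + 1) • tm (L.v (l - n)) (L'.v n)) ?_ ?_ ?_ ?_ ?_ ?_ ?_
  · intro i hi
    split_ifs with h
    · rw [map_smul, opG_tm, hgv, sL'.gu]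
      simp [smul_smul]
    · obtain ⟨k, rfl⟩ : ∃ k, i = k + n := ⟨i - n, by omega⟩
      rw [map_smul, opG_tm, sL.gu, sL'.gv]
      simp [smul_smul, pow_add]; ring_nf
  · intro i hi
    split_ifs with h
    · rw [map_smul, opH_tm, hhv, sL'.hu]
      simp [smul_smul]
    · obtain ⟨k, rfl⟩ : ∃ k, i = k + n := ⟨i - n, by omega⟩
      rw [map_smul, opH_tm, sL.hu, sL'.hv]
      simp [smul_smul, pow_add]; ring_nf
  · intro i hi
    split_ifs with h
    · rw [map_smul, opX_tm, opX_v, hgv, hL'.x i h]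
      simp [pow_succ]
    · rw [map_smul, opX_tm, opX_v, hL.x _ (by omega)]
      simp
  · intro i hi
    split_ifs with h h' h'
    · rw [map_smul, opY_tm, opY_v, hhv, hL'.y i h]
      simp [pow_succ]
    · obtain rfl : i + 1 = n := by omega
      rw [map_smul, opY_tm, opY_v, hhv, hL'.y i h]
      simp [pow_succ]
    · omega
    · rw [map_smul, opY_tm, opY_v, hL.y _ (by omega)]
      have : i + 1 - n = i - n + 1 := by omega
      simp [this]
  · intro i hi
    split_ifs with h
    · rw [map_smul, opY_tm, opY_v, hhv, hL'.y i h]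
      simp
    · rw [map_smul, opY_tm, opY_v, hL.y _ (by omega)]
      simp
  · intro c d hc h
    simp only [smul_add, Finset.sum_add_distrib] at h
    -- the complement does not involve `v_{a+1} ⊗ v'_b` with `b < n`
    have hc0 := antidiagonal_eq_zero hc fun b hb a ha => by
      have h1 := congrArg (L.vv L' (a + 1) b) h
      simpa only [map_add, map_sum, map_smul, vv_tm, apply_ite (L.vv L' (a + 1) b), smul_eq_mul,
        L.vc_v (show a + 1 < m + 1 by omega), L'.vc_v (show b < n + 1 by omega), map_zero,
        Nat.add_right_cancel_iff, Nat.succ_ne_zero, hb.ne, sum_sum_delta hc,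
        sum_sum_delta_succ_right hc, if_false, zero_mul, mul_zero, ite_self,
        Finset.sum_const_zero, add_zero] using h1
    refine ⟨fun a ha b hb => hc0 a b, ?_⟩
    simp only [hc0, zero_smul, Finset.sum_const_zero, zero_add] at h
    intro j hj
    by_cases hjn : j < n
    · refine coeff_eq_zero h hj (L.vv L' 0 j) ?_ fun i hi hij => ?_
      · rw [if_pos hjn]
        simp [L.vc_v (show 0 < m + 1 by omega), L'.vc_v (show j < n + 1 by omega)]
      · split_ifs with hin
        · simp [L'.vc_v (show j < n + 1 by omega), hij.symm]
        · simp [L'.vc_v (show j < n + 1 by omega), hjn.ne]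
    · refine coeff_eq_zero h hj (L.vv L' (j - n) n) ?_ fun i hi hij => ?_
      · rw [if_neg hjn]
        simp [L.vc_v (show j - n < m + 1 by omega), L'.vc_v (show n < n + 1 by omega)]
      · split_ifs with hin
        · simp [L'.vc_v (show n < n + 1 by omega), hin.ne']
        · simp [L.vc_v (show j - n < m + 1 by omega), show j - n ≠ i - n by omega]
  · rw [finrank_tensor, L.finrank, L'.finrank]; ring

end Layer

namespace Layer

variable {A B Z : HHModule K}

/-! ### Tensor products of `M` and `W` with `N` and `C` -/

theorem IsA.x_all {n : ℕ} {L : Layer B n n} {η : K} (h : L.IsA η) (i : ℕ) :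
    B.opX (L.u i) = L.v i := by
  rcases Nat.lt_or_ge i n with hi | hi
  · exact h.x i hi
  · rw [L.u_ge hi, L.v_ge hi, map_zero]

/-- A recursion from the last row of a grid to the first: with the row `i + 1`, the row `i` of `c`
vanishes, as `x` is injective on the upper layer. -/
theorem IsA.descend {m n : ℕ} {L : Layer B n n} {η : K} (h : L.IsA η) {c : ℕ → ℕ → K}
    (hc : ∀ i j, ¬(i < m ∧ j < n) → c i j = 0)
    (hr : ∀ i < m, ∑ j ∈ Finset.range n, c i j • B.opX (L.u j) +
      ∑ j ∈ Finset.range n, c (i + 1) j • B.opY (L.u j) = 0) (i j : ℕ) : c i j = 0 := by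
  have : ∀ t i, m ≤ i + t → ∀ j, c i j = 0 := by
    intro t
    induction t with
    | zero => intro i hi j; exact hc _ _ (by omega)
    | succ t ih =>
      intro i hi j
      by_cases hij : i < m ∧ j < n
      · have h1 := hr i hij.1
        simp only [ih (i + 1) (by omega), zero_smul, Finset.sum_const_zero, add_zero, h.x_all] at h1
        exact L.uc_eq_zero_of_sum le_rfl h1 hij.2 (f := fun j => c i j)
      · exact hc _ _ hij
  exact this m i (by omega) j

/-- The chessboard consists of all `± u_i ⊗ u'_j`, and the complement is `v_0 ⊗ B`. -/
theorem IsM.tensor_isA [CharZero K] {m n k l : ℕ} {η : K} {L : Layer A m (m + 1)} (hL : L.IsM)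
    {L' : Layer B n n} (hL' : L'.IsA η) {p q s : ℤˣ} (sL : L.Signs p p (-p) p)
    (sL' : L'.Signs q q (-q) q) {LZ : Layer Z n n} (hZ : LZ.IsA η)
    (sZ : LZ.Signs (-(p * q)) (p * q) (p * q) (p * q)) (hs : p * q = s)
    (hkl : Halves s (m * n) k l) :
    A ⊗ₕ B ≅ₕ P K ^⊕ k ⊕ₕ (P K).twist (-1) (-1) ^⊕ l ⊕ₕ Z := by
  have := L.finite; have := L'.finite
  have := finite_tensor (A := A) (B := B)
  have hE := (L.isBoard L' sL sL' hL.opX_opY_u hL'.opX_opY_u 0).congr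
    (E' := fun i j => tm (L.v (i + 1)) (B.opX (L'.u j)) + tm (L.v i) (B.opY (L'.u j)))
    (fun i hi j hj => by simp only [add_zero, hL.y i hi, hL.x i hi])
  have hgv : A.opG (L.v 0) = -(sc p : K) • L.v 0 := by simpa using sL.gv 0
  have hhv : A.opH (L.v 0) = (sc p : K) • L.v 0 := by simpa using sL.hv 0
  have hX : ∀ l, (A ⊗ₕ B).opX ((-1 : K) ^ l • tm (L.v 0) (L'.u l)) =
      (-1 : K) ^ (l + 1) • (sc p : K) • tm (L.v 0) (L'.v l) := by
    intro l
    rw [map_smul, opX_tm, opX_v, hgv, hL'.x_all]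
    simp [pow_succ]
  refine hZ.splitting (p := -(p * q)) (q := p * q) (s := s) (a := m) (b := n)
    (E := fun i j => tm (L.v (i + 1)) (B.opX (L'.u j)) + tm (L.v i) (B.opY (L'.u j)))
    (by simpa using sZ) hkl (by simpa [hs] using hE)
    (fun l => (-1 : K) ^ l • tm (L.v 0) (L'.u l)) ?_ ?_ ?_ ?_ ?_ ?_
  · intro i hi
    rw [map_smul, opG_tm, hgv, sL'.gu]
    simp [smul_smul]; ring_nf
  · intro i hi
    rw [map_smul, opH_tm, hhv, sL'.hu]
    simp [smul_smul]; ring_nf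
  · intro i hi
    rw [hX, hX, map_smul, opY_tm, opY_v, hhv, hL'.y i hi]
    rcases Nat.eq_zero_or_pos i with rfl | hi'
    · simp
    · obtain ⟨i, rfl⟩ : ∃ k, i = k + 1 := ⟨i - 1, by omega⟩
      simp only [map_zero, LinearMap.zero_apply, zero_add, map_add, map_smul,
        LinearMap.smul_apply, smul_add, smul_smul, Nat.add_sub_cancel]
      congr 2 <;> ring
  · simp only [hX, L'.v_ge le_rfl, map_zero, smul_zero]
  · intro c d hc h
    simp only [smul_add, Finset.sum_add_distrib, hX] at h
    -- the complement does not involve `v_{a+1} ⊗ B`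
    have hc0 := hL'.descend hc (fun a ha => by
      have h1 := congrArg (lc (L.vc (a + 1))) h
      simp only [map_add, map_sum, map_smul, lc_tm, L.vc_v (show a + 1 < m + 1 by omega),
        map_zero, Nat.add_right_cancel_iff, Nat.succ_ne_zero, sum_sum_delta_left hc, if_false,
        zero_smul, smul_zero, Finset.sum_const_zero, add_zero] at h1
      exact h1)
    simp only [hc0, zero_smul, Finset.sum_const_zero, zero_add] at h
    refine ⟨fun _ _ _ _ => hc0 _ _, fun j hj => ?_⟩
    refine coeff_eq_zero h hj (L.vv L' 0 j) ?_ fun i hi hij => ?_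
    · have hp : (sc p : K) ≠ 0 := left_ne_zero_of_mul_eq_one (sc_mul_self p)
      simp [L.vc_v (show 0 < m + 1 by omega), L'.vc_v hj, hp]
    · simp [L'.vc_v hj, hij.symm]
  · rw [finrank_tensor, L.finrank, L'.finrank]; ring

/-- The shift of both layers of a module with `y = x J = J x`. -/
def shift {n : ℕ} (L : Layer B n n) (η : K) : Module.End K B.carrier :=
  L.map (fun i => L.u (i + 1) + band η i • L.u (i - 1))
    fun i => L.v (i + 1) + band η i • L.v (i - 1)

section shift

variable {n : ℕ} {L : Layer B n n} {η : K}

theorem shift_u {i : ℕ} (hi : i < n) : L.shift η (L.u i) = L.u (i + 1) + band η i • L.u (i - 1) :=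
  L.map_u _ _ hi

theorem shift_v {i : ℕ} (hi : i < n) : L.shift η (L.v i) = L.v (i + 1) + band η i • L.v (i - 1) :=
  L.map_v _ _ hi

theorem IsA.opX_shift (h : L.IsA η) (z : B.carrier) : B.opX (L.shift η z) = B.opY z := by
  refine L.hom_ext (φ := B.opX ∘ₗ L.shift η) (ψ := B.opY) ?_ ?_ z <;> intro i hi
  · simp [shift_u hi, h.x_all, h.y i hi]
  · simp [shift_v hi]

theorem IsA.shift_opX (h : L.IsA η) (z : B.carrier) : L.shift η (B.opX z) = B.opY z := by
  refine L.hom_ext (φ := L.shift η ∘ₗ B.opX) (ψ := B.opY) ?_ ?_ z <;> intro i hi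
  · simp [h.x_all, h.y i hi, shift_v hi]
  · simp

theorem IsA.shift_opY (h : L.IsA η) (z : B.carrier) : L.shift η (B.opY z) = B.opY (L.shift η z) := by
  rw [← h.opX_shift z, h.shift_opX]

theorem band_mul_neg_one_pow (i : ℕ) : band η i * (-1 : K) ^ (i - 1) = band η i := by
  unfold band
  split_ifs with h
  · obtain ⟨k, rfl⟩ := h; simp
  · simp

theorem band_mul_neg_one_pow' (i : ℕ) : band η i * (-1 : K) ^ i = -band η i := by
  unfold band
  split_ifs with h
  · rw [h.neg_one_pow, mul_neg_one]
  · simp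

theorem Signs.opG_shift {a b c d : ℤˣ} (h : L.Signs a b c d) (z : B.carrier) :
    B.opG (L.shift η z) = -L.shift η (B.opG z) := by
  refine L.hom_ext (φ := B.opG ∘ₗ L.shift η) (ψ := -(L.shift η ∘ₗ B.opG)) ?_ ?_ z <;> intro i hi
  · have h1 := band_mul_neg_one_pow (η := η) i
    have h2 := band_mul_neg_one_pow' (η := η) i
    simp only [LinearMap.comp_apply, LinearMap.neg_apply, shift_u hi, map_add, map_smul, h.gu,
      smul_add, smul_smul, neg_add, ← neg_smul]
    congr 2
    · ring
    · linear_combination (sc a : K) * h1 + sc a * h2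
  · have h1 := band_mul_neg_one_pow (η := η) i
    have h2 := band_mul_neg_one_pow' (η := η) i
    simp only [LinearMap.comp_apply, LinearMap.neg_apply, shift_v hi, map_add, map_smul, h.gv,
      smul_add, smul_smul, neg_add, ← neg_smul]
    congr 2
    · ring
    · linear_combination (sc c : K) * h1 + sc c * h2

theorem Signs.opH_shift {a b c d : ℤˣ} (h : L.Signs a b c d) (z : B.carrier) :
    B.opH (L.shift η z) = -L.shift η (B.opH z) := by
  refine L.hom_ext (φ := B.opH ∘ₗ L.shift η) (ψ := -(L.shift η ∘ₗ B.opH)) ?_ ?_ z <;> intro i hi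
  · have h1 := band_mul_neg_one_pow (η := η) i
    have h2 := band_mul_neg_one_pow' (η := η) i
    simp only [LinearMap.comp_apply, LinearMap.neg_apply, shift_u hi, map_add, map_smul, h.hu,
      smul_add, smul_smul, neg_add, ← neg_smul]
    congr 2
    · ring
    · linear_combination (sc b : K) * h1 + sc b * h2
  · have h1 := band_mul_neg_one_pow (η := η) i
    have h2 := band_mul_neg_one_pow' (η := η) i
    simp only [LinearMap.comp_apply, LinearMap.neg_apply, shift_v hi, map_add, map_smul, h.hv,
      smul_add, smul_smul, neg_add, ← neg_smul]
    congr 2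
    · ring
    · linear_combination (sc d : K) * h1 + sc d * h2

theorem Signs.opG_shift_pow {a b c d : ℤˣ} (h : L.Signs a b c d) (i : ℕ) (z : B.carrier) :
    B.opG ((L.shift η ^ i) z) = (-1 : K) ^ i • (L.shift η ^ i) (B.opG z) := by
  induction i with
  | zero => simp
  | succ i ih => simp [pow_succ', h.opG_shift, ih]

theorem Signs.opH_shift_pow {a b c d : ℤˣ} (h : L.Signs a b c d) (i : ℕ) (z : B.carrier) :
    B.opH ((L.shift η ^ i) z) = (-1 : K) ^ i • (L.shift η ^ i) (B.opH z) := by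
  induction i with
  | zero => simp
  | succ i ih => simp [pow_succ', h.opH_shift, ih]

end shift

end Layer

namespace Layer

variable {A B Z : HHModule K}

/-! ### `W` in a tensor product: the diagonal map -/

section IsW

variable {n : ℕ} {L : Layer A (n + 1) n}

theorem IsW.x_succ_all (hL : L.IsW) (i : ℕ) : A.opX (L.u (i + 1)) = L.v i := by
  rcases Nat.lt_or_ge (i + 1) (n + 1) with hi | hi
  · exact hL.x_succ i hi
  · rw [L.u_ge hi, L.v_ge (by omega), map_zero]

theorem IsW.y_all (hL : L.IsW) (i : ℕ) : A.opY (L.u i) = L.v i := by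
  rcases Nat.lt_or_ge i (n + 1) with hi | hi
  · exact hL.y i hi
  · rw [L.u_ge hi, L.v_ge (by omega), map_zero]

theorem IsW.uc_opX_u (hL : L.IsW) (k i : ℕ) : L.uc k (A.opX (L.u i)) = 0 := by
  rcases i with _ | i
  · rw [hL.x_zero, map_zero]
  · rw [hL.x_succ_all, uc_v]

theorem IsW.vc_opX_u (hL : L.IsW) {k : ℕ} (hk : k < n) (i : ℕ) :
    L.vc k (A.opX (L.u i)) = if k + 1 = i then 1 else 0 := by
  rcases i with _ | i
  · simp [hL.x_zero]
  · rw [hL.x_succ_all, L.vc_v hk]; simp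

end IsW

/-- The vector `∑ u_i ⊗ J^(m - i) b` for the shift `J`. It satisfies `y U(b) = x U(J b)`. -/
def diagonal {m n n' : ℕ} (L : Layer A (m + 1) n) (L' : Layer B n' n') (η : K) :
    B.carrier →ₗ[K] (A ⊗ₕ B).carrier :=
  ∑ i ∈ Finset.range (m + 1), tm (L.u i) ∘ₗ L'.shift η ^ (m - i)

section diagonal

variable {m n : ℕ} {η : K} {L : Layer A (m + 1) m} {L' : Layer B n n} {p q : ℤˣ}

theorem diagonal_apply (b : B.carrier) : L.diagonal L' η b =
    ∑ i ∈ Finset.range (m + 1), tm (L.u i) ((L'.shift η ^ (m - i)) b) := by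
  simp [diagonal, LinearMap.sum_apply]

theorem opG_diagonal {a b c d a' b' c' d' : ℤˣ} (sL : L.Signs a b c d) (sL' : L'.Signs a' b' c' d')
    (z : B.carrier) : (A ⊗ₕ B).opG (L.diagonal L' η z) =
      ((sc a : K) * (-1) ^ m) • L.diagonal L' η (B.opG z) := by
  rw [diagonal_apply, diagonal_apply, map_sum, Finset.smul_sum]
  refine Finset.sum_congr rfl fun i hi => ?_
  have hi' : i + (m - i) = m := by have := Finset.mem_range.mp hi; omega
  rw [opG_tm, sL.gu, sL'.opG_shift_pow, map_smul, map_smul, LinearMap.smul_apply, smul_smul]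
  congr 1
  rw [← hi', pow_add, hi']; ring

theorem opH_diagonal {a b c d a' b' c' d' : ℤˣ} (sL : L.Signs a b c d) (sL' : L'.Signs a' b' c' d')
    (z : B.carrier) : (A ⊗ₕ B).opH (L.diagonal L' η z) =
      ((sc b : K) * (-1) ^ m) • L.diagonal L' η (B.opH z) := by
  rw [diagonal_apply, diagonal_apply, map_sum, Finset.smul_sum]
  refine Finset.sum_congr rfl fun i hi => ?_
  have hi' : i + (m - i) = m := by have := Finset.mem_range.mp hi; omega
  rw [opH_tm, sL.hu, sL'.opH_shift_pow, map_smul, map_smul, LinearMap.smul_apply, smul_smul]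
  congr 1
  rw [← hi', pow_add, hi']; ring

theorem IsW.opX_diagonal (hL : L.IsW) (sL : L.Signs p p p (-p)) (z : B.carrier) :
    (A ⊗ₕ B).opX (L.diagonal L' η z) =
      ∑ i ∈ Finset.range m, tm (L.v i) ((L'.shift η ^ (m - 1 - i)) z) +
      ∑ i ∈ Finset.range (m + 1), ((sc p : K) * (-1) ^ i) •
        tm (L.u i) (B.opX ((L'.shift η ^ (m - i)) z)) := by
  rw [diagonal_apply, map_sum]
  simp only [opX_tm, Finset.sum_add_distrib, sL.gu, map_smul, LinearMap.smul_apply]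
  congr 1
  rw [Finset.sum_range_succ', hL.x_zero, map_zero, LinearMap.zero_apply, add_zero]
  refine Finset.sum_congr rfl fun i hi => ?_
  rw [hL.x_succ i (by have := Finset.mem_range.mp hi; omega), show m - (i + 1) = m - 1 - i by omega]

theorem IsW.opY_diagonal (hL : L.IsW) (hL' : L'.IsA η) (sL : L.Signs p p p (-p)) (z : B.carrier) :
    (A ⊗ₕ B).opY (L.diagonal L' η z) = (A ⊗ₕ B).opX (L.diagonal L' η (L'.shift η z)) := by
  rw [hL.opX_diagonal sL, diagonal_apply, map_sum]
  simp only [opY_tm, Finset.sum_add_distrib, sL.hu, map_smul, LinearMap.smul_apply]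
  congr 1
  · rw [Finset.sum_range_succ, hL.y m (by omega), L.v_ge le_rfl, map_zero, LinearMap.zero_apply,
      add_zero]
    refine Finset.sum_congr rfl fun i hi => ?_
    have := Finset.mem_range.mp hi
    rw [hL.y i (by omega), ← Module.End.mul_apply, ← pow_succ, show m - 1 - i + 1 = m - i by omega]
  · refine Finset.sum_congr rfl fun i hi => ?_
    rw [← hL'.opX_shift, ← Module.End.mul_apply (L'.shift η), ← pow_succ', pow_succ,
      Module.End.mul_apply]

end diagonal

/-- The chessboard consists of the `± u_i ⊗ u'_j` with `i < m`, and the complement is the image of the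
diagonal map. -/
theorem IsW.tensor_isA [CharZero K] {m n k l : ℕ} {η : K} {L : Layer A (m + 1) m} (hL : L.IsW)
    {L' : Layer B n n} (hL' : L'.IsA η) {p q s : ℤˣ} (sL : L.Signs p p p (-p))
    (sL' : L'.Signs q q (-q) q) {LZ : Layer Z n n} (hZ : LZ.IsA η)
    (sZ : LZ.Signs (p * q * sgn m) (p * q * sgn m) (-(p * q * sgn m)) (p * q * sgn m))
    (hs : p * q = s) (hkl : Halves s (m * n) k l) :
    A ⊗ₕ B ≅ₕ P K ^⊕ k ⊕ₕ (P K).twist (-1) (-1) ^⊕ l ⊕ₕ Z := by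
  have := L.finite; have := L'.finite
  have := finite_tensor (A := A) (B := B)
  have hE := ((L.isBoard L' sL sL' hL.opX_opY_u hL'.opX_opY_u 0).mono (Nat.le_succ m) le_rfl).congr
    (E' := fun i j => tm (L.v i) (B.opX (L'.u j)) + tm (A.opX (L.u i)) (B.opY (L'.u j)))
    (fun i hi j hj => by simp only [add_zero, hL.y i (Nat.lt_succ_of_lt hi)])
  refine hZ.splitting (p := p * q * sgn m) (q := p * q * sgn m) (s := s) (a := m) (b := n)
    (E := fun i j => tm (L.v i) (B.opX (L'.u j)) + tm (A.opX (L.u i)) (B.opY (L'.u j)))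
    sZ hkl (by simpa [hs] using hE) (fun l => L.diagonal L' η (L'.u l)) ?_ ?_ ?_ ?_ ?_ ?_
  · intro i hi
    rw [opG_diagonal sL sL', sL'.gu, map_smul, smul_smul]
    simp; ring_nf
  · intro i hi
    rw [opH_diagonal sL sL', sL'.hu, map_smul, smul_smul]
    simp; ring_nf
  · intro i hi
    rw [hL.opY_diagonal hL' sL, shift_u hi, map_add, map_smul, map_add, map_smul]
  · rw [L'.u_ge le_rfl, map_zero, map_zero]
  · intro c d hc h
    simp only [smul_add, Finset.sum_add_distrib] at h
    -- only the complement involves `u_m ⊗ B`, through `u_m ⊗ x b`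
    have hd : ∀ j < n, d j = 0 := by
      have h1 := congrArg (lc (L.uc m)) h
      have hp : ((sc p : K) * (-1) ^ m) ≠ 0 := left_ne_zero_of_mul_eq_one
        (sc_mul_neg_one_pow_self p m)
      simp only [map_add, map_sum, map_smul, lc_tm, uc_v, hL.uc_opX_u, zero_smul, smul_zero,
        Finset.sum_const_zero, zero_add, hL.opX_diagonal sL, L.uc_u (Nat.lt_succ_self m), map_zero,
        ite_smul, one_smul, smul_ite, Finset.sum_ite_eq, Finset.mem_range, Nat.lt_succ_self, if_true,
        Nat.sub_self, pow_zero, Module.End.one_apply, hL'.x_all] at h1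
      intro j hj
      have h2 := L'.uc_eq_zero_of_sum le_rfl
        (f := fun j => d j * ((sc p : K) * (-1) ^ m)) (by simpa only [smul_smul] using h1) hj
      exact (mul_eq_zero.mp h2).resolve_right hp
    have hd' : ∑ j ∈ Finset.range n, d j • (A ⊗ₕ B).opX (L.diagonal L' η (L'.u j)) = 0 :=
      Finset.sum_eq_zero fun j hj => by rw [hd j (Finset.mem_range.mp hj), zero_smul]
    rw [hd', add_zero] at h
    have hc0 := hL'.descend hc (fun a ha => by
      have h1 := congrArg (lc (L.vc a)) h
      simp only [map_add, map_sum, map_smul, lc_tm, L.vc_v ha, map_zero, hL.vc_opX_u ha,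
        sum_sum_delta_left hc] at h1
      exact h1)
    exact ⟨fun _ _ _ _ => hc0 _ _, hd⟩
  · rw [finrank_tensor, L.finrank, L'.finrank]; ring

end Layer

namespace Layer

variable {A B Z : HHModule K}

/-! ### `W(r) ⊗ W(s)` -/

/-- The chessboard consists of the `± u_i ⊗ u'_{j+1}` with `i < m` and `j < n`. The upper layer of the
complement consists of the sums of `u_i ⊗ u'_j` over the antidiagonals `i + j = k`. -/
theorem IsW.tensor_isW [CharZero K] {m n k l : ℕ} {L : Layer A (m + 1) m} (hL : L.IsW)
    {L' : Layer B (n + 1) n} (hL' : L'.IsW) (sL : L.Signs 1 1 1 (-1)) (sL' : L'.Signs 1 1 1 (-1))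
    (hm : 1 ≤ m) (hn : 1 ≤ n) {LZ : Layer Z (m + n + 1) (m + n)} (hZ : LZ.IsW)
    (sZ : LZ.Signs 1 1 1 (-1)) (hkl : Halves (-1) (m * n) k l) :
    A ⊗ₕ B ≅ₕ P K ^⊕ k ⊕ₕ (P K).twist (-1) (-1) ^⊕ l ⊕ₕ Z := by
  have := L.finite; have := L'.finite
  have := finite_tensor (A := A) (B := B)
  have hE := ((L.isBoard L' sL sL' hL.opX_opY_u hL'.opX_opY_u 1).mono (Nat.le_succ m)
    le_rfl).congr (E' := fun i j => tm (L.v i) (L'.v j) + tm (A.opX (L.u i)) (L'.v (j + 1)))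
    (fun i hi j hj => by simp only [hL.y_all, hL'.x_succ_all, hL'.y_all])
  have hY : ∀ k, (A ⊗ₕ B).opY (∑ i ∈ Finset.range (k + 1), tm (L.u i) (L'.u (k - i))) =
      ∑ i ∈ Finset.range (k + 1), tm (L.v i) (L'.u (k - i)) +
        ∑ i ∈ Finset.range (k + 1), (-1 : K) ^ i • tm (L.u i) (L'.v (k - i)) := by
    intro k
    simp [map_sum, opY_tm, hL.y_all, hL'.y_all, sL.hu, Finset.sum_add_distrib]
  have hX : ∀ k, (A ⊗ₕ B).opX (∑ i ∈ Finset.range (k + 1 + 1), tm (L.u i) (L'.u (k + 1 - i))) =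
      ∑ i ∈ Finset.range (k + 1), tm (L.v i) (L'.u (k - i)) +
        ∑ i ∈ Finset.range (k + 1), (-1 : K) ^ i • tm (L.u i) (L'.v (k - i)) := by
    intro k
    simp only [map_sum, opX_tm, sL.gu, Finset.sum_add_distrib]
    congr 1
    · rw [Finset.sum_range_succ']
      simp [hL.x_zero, hL.x_succ_all]
    · rw [Finset.sum_range_succ]
      simp only [Nat.sub_self, hL'.x_zero, map_zero, add_zero]
      refine Finset.sum_congr rfl fun i hi => ?_
      rw [show k + 1 - i = k - i + 1 by have := Finset.mem_range.mp hi; omega, hL'.x_succ_all]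
      simp
  refine hZ.splitting (p := 1) (q := 1) (s := -1) (a := m) (b := n)
    (E := fun i j => tm (L.v i) (L'.v j) + tm (A.opX (L.u i)) (L'.v (j + 1))) (by omega)
    sZ hkl (by simpa using hE)
    (fun k => ∑ i ∈ Finset.range (k + 1), tm (L.u i) (L'.u (k - i)))
    (fun k => ∑ i ∈ Finset.range (k + 1), tm (L.v i) (L'.u (k - i)) +
        ∑ i ∈ Finset.range (k + 1), (-1 : K) ^ i • tm (L.u i) (L'.v (k - i)))
    ?_ ?_ ?_ (fun k _ => hX k) (fun k _ => hY k) ?_ ?_ ?_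
  · intro k hk
    rw [map_sum, Finset.smul_sum]
    refine Finset.sum_congr rfl fun i hi => ?_
    rw [opG_tm, sL.gu, sL'.gu, map_smul, map_smul, LinearMap.smul_apply, smul_smul]
    congr 1
    obtain ⟨j, rfl⟩ : ∃ j, k = i + j := ⟨k - i, by have := Finset.mem_range.mp hi; omega⟩
    simp [pow_add, mul_comm]
  · intro k hk
    rw [map_sum, Finset.smul_sum]
    refine Finset.sum_congr rfl fun i hi => ?_
    rw [opH_tm, sL.hu, sL'.hu, map_smul, map_smul, LinearMap.smul_apply, smul_smul]
    congr 1
    obtain ⟨j, rfl⟩ : ∃ j, k = i + j := ⟨k - i, by have := Finset.mem_range.mp hi; omega⟩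
    simp [pow_add, mul_comm]
  · simp [hL.x_zero, hL'.x_zero]
  · rw [hY, Finset.sum_eq_zero, Finset.sum_eq_zero, add_zero]
    · intro i hi
      rcases Nat.lt_or_ge m i with h | h
      · rw [L.u_ge (by omega)]; simp
      · rw [L'.v_ge (by omega)]; simp
    · intro i hi
      rcases Nat.lt_or_ge i m with h | h
      · rw [L'.u_ge (by omega)]; simp
      · rw [L.v_ge (by omega)]; simp
  · intro c d hc h
    -- only the complement involves vectors `u_a ⊗ v'_b`, and each antidiagonal `a + b = j` of these
    -- occurs in a single vector
    have hd : ∀ j < m + n, d j = 0 := by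
      intro j hj
      have hv : ∀ a ≤ m, ∀ b < n, ∀ k, L.uv L' a b
          (∑ i ∈ Finset.range (k + 1), tm (L.v i) (L'.u (k - i)) +
          ∑ i ∈ Finset.range (k + 1), (-1 : K) ^ i • tm (L.u i) (L'.v (k - i))) =
          if k = a + b then (-1) ^ a else 0 := by
        intro a ha b hb k
        simp only [map_add, map_sum, map_smul, uv_tm, uc_v, zero_mul, Finset.sum_const_zero,
          zero_add, L.uc_u (show a < m + 1 by omega), L'.vc_v hb]
        by_cases hk : a < k + 1
        · rw [Finset.sum_eq_single a]
          · simp [show b = k - a ↔ k = a + b by omega]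
          · intro i _ hi; simp [hi.symm]
          · intro hi; exact absurd (Finset.mem_range.mpr hk) hi
        · rw [if_neg (by omega), Finset.sum_eq_zero]
          intro i hi
          rw [Finset.mem_range] at hi
          simp [show a ≠ i by omega]
      have ha : min j m ≤ m := by omega
      have hb : j - min j m < n := by omega
      refine coeff_eq_zero_of_add h hj (L.uv L' (min j m) (j - min j m)) ?_ ?_ ?_
      · simp [hL.uc_opX_u]
      · rw [hv _ ha _ hb, if_pos (by omega)]; simp
      · intro i hi hij
        rw [hv _ ha _ hb, if_neg (by omega)]
    rw [Finset.sum_eq_zero (s := Finset.range (m + n))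
      (fun j hj => by rw [hd j (Finset.mem_range.mp hj), zero_smul]), add_zero] at h
    simp only [smul_add, Finset.sum_add_distrib] at h
    have hc0 := antidiagonal_eq_zero hc fun b hb a ha => by
      have h1 := congrArg (L.vv L' a b) h
      have h2 := sum_sum_delta_succ_right hc (a + 1) b
      simpa only [map_add, map_sum, map_smul, vv_tm, smul_eq_mul, L.vc_v ha, hL.vc_opX_u ha,
        L'.vc_v hb, map_zero, sum_sum_delta hc, h2] using h1
    exact ⟨fun a ha b hb => hc0 a b, hd⟩
  · rw [finrank_tensor, L.finrank, L'.finrank]; ring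

end Layer

namespace Layer

variable {A B Z : HHModule K}

/-! ### `M(r) ⊗ W(s)` -/

section

variable {m n : ℕ} {L : Layer A m (m + 1)} {L' : Layer B (n + 1) n}

theorem IsM.opX_opY_tm_isW (hL : L.IsM) (hL' : L'.IsW) (sL : L.Signs 1 1 (-1) 1) {i : ℕ}
    (hi : i < m) (j : ℕ) : (A ⊗ₕ B).opX ((A ⊗ₕ B).opY (tm (L.u i) (L'.u j))) =
      (-1 : K) ^ i • (tm (L.v (i + 1)) (B.opX (L'.u j)) + tm (L.v i) (L'.v j)) := by
  rw [opX_opY_tm (ε := (-1) ^ i) (by simpa using sL.gu i) (by simpa using sL.hu i)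
    (hL.opX_opY_u i hi) (by rw [hL'.y_all, opX_v]), hL.x i hi, hL.y i hi, hL'.y_all]

/-- The vector `∑ u_i ⊗ u'_{m - 1 - i}`, with `x y` of it equal to `v_0 ⊗ x u'_m`. -/
def antidiagonal (L : Layer A m (m + 1)) (L' : Layer B (n + 1) n) : (A ⊗ₕ B).carrier :=
  ∑ i ∈ Finset.range m, tm (L.u i) (L'.u (m - 1 - i))

theorem IsM.opX_opY_antidiagonal (hL : L.IsM) (hL' : L'.IsW) (sL : L.Signs 1 1 (-1) 1) :
    (A ⊗ₕ B).opX ((A ⊗ₕ B).opY (L.antidiagonal L')) = tm (L.v 0) (B.opX (L'.u m)) := by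
  have h : ∀ i ∈ Finset.range m,
      (A ⊗ₕ B).opX ((A ⊗ₕ B).opY (tm (L.u i) (L'.u (m - 1 - i)))) =
      (-1 : K) ^ i • tm (L.v i) (B.opX (L'.u (m - i))) -
        (-1 : K) ^ (i + 1) • tm (L.v (i + 1)) (B.opX (L'.u (m - (i + 1)))) := by
    intro i hi
    have hi' := Finset.mem_range.mp hi
    rw [hL.opX_opY_tm_isW hL' sL hi', show m - i = m - 1 - i + 1 by omega, hL'.x_succ_all,
      show m - (i + 1) = m - 1 - i by omega, pow_succ, mul_neg_one, neg_smul, sub_neg_eq_add,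
      smul_add, add_comm]
  rw [antidiagonal, map_sum, map_sum, Finset.sum_congr rfl h, Finset.sum_range_sub'
    (fun i => (-1 : K) ^ i • tm (L.v i) (B.opX (L'.u (m - i))))]
  simp [hL'.x_zero]

theorem opG_antidiagonal (sL : L.Signs 1 1 (-1) 1) (sL' : L'.Signs 1 1 1 (-1)) :
    (A ⊗ₕ B).opG (L.antidiagonal L') = (-1 : K) ^ (m - 1) • L.antidiagonal L' := by
  rw [antidiagonal, map_sum, Finset.smul_sum]
  refine Finset.sum_congr rfl fun i hi => ?_
  rw [opG_tm, sL.gu, sL'.gu, map_smul, map_smul, LinearMap.smul_apply, smul_smul]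
  obtain ⟨j, hj⟩ : ∃ j, m - 1 = i + j := ⟨m - 1 - i, by have := Finset.mem_range.mp hi; omega⟩
  rw [hj]
  simp [pow_add, mul_comm]

theorem opH_antidiagonal (sL : L.Signs 1 1 (-1) 1) (sL' : L'.Signs 1 1 1 (-1)) :
    (A ⊗ₕ B).opH (L.antidiagonal L') = (-1 : K) ^ (m - 1) • L.antidiagonal L' := by
  rw [antidiagonal, map_sum, Finset.smul_sum]
  refine Finset.sum_congr rfl fun i hi => ?_
  rw [opH_tm, sL.hu, sL'.hu, map_smul, map_smul, LinearMap.smul_apply, smul_smul]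
  obtain ⟨j, hj⟩ : ∃ j, m - 1 = i + j := ⟨m - 1 - i, by have := Finset.mem_range.mp hi; omega⟩
  rw [hj]
  simp [pow_add, mul_comm]

/-- The vector `y` of the antidiagonal vector has no component in `v_0 ⊗ B`. -/
theorem IsM.lc_opY_antidiagonal (hL : L.IsM) (sL : L.Signs 1 1 (-1) 1) :
    lc (L.vc 0) ((A ⊗ₕ B).opY (L.antidiagonal L')) = 0 := by
  rw [antidiagonal, map_sum, map_sum]
  refine Finset.sum_eq_zero fun i hi => ?_
  rw [opY_tm, hL.y i (Finset.mem_range.mp hi), sL.hu, map_add, lc_tm, lc_tm,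
    L.vc_v (Nat.succ_pos m)]
  simp

/-- A recursion along the antidiagonals of a grid: the antidiagonals `i + j < m` end in the row
`i = 0`, and all others leave the grid at `i = m`. -/
theorem antidiagonal_eq_zero' {m n : ℕ} (hmn : m ≤ n) {c : ℕ → ℕ → K}
    (hc : ∀ i j, ¬(i < m ∧ j < n + 1) → c i j = 0) (h0 : ∀ j < m, c 0 j = 0)
    (h : ∀ i < m, ∀ j < n, c i (j + 1) + c (i + 1) j = 0) (i j : ℕ) : c i j = 0 := by
  have h1 : ∀ t i j, m ≤ i + t → t ≤ j → c i j = 0 := by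
    intro t
    induction t with
    | zero => intro i j hi _; exact hc _ _ (by omega)
    | succ t ih =>
      intro i j hi hj
      by_cases hij : i < m ∧ j < n + 1
      · obtain ⟨j, rfl⟩ : ∃ k, j = k + 1 := ⟨j - 1, by omega⟩
        simpa [ih (i + 1) j (by omega) (by omega)] using h i hij.1 j (by omega)
      · exact hc _ _ hij
  rcases Nat.lt_or_ge (i + j) m with hij | hij
  · induction i generalizing j with
    | zero => exact h0 j (by omega)
    | succ i ih => simpa [ih (j + 1) (by omega)] using h i (by omega) j (by omega)
  · exact h1 j i j hij le_rfl

theorem IsM.board_isW (hL : L.IsM) (hL' : L'.IsW) (sL : L.Signs 1 1 (-1) 1)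
    (sL' : L'.Signs 1 1 1 (-1)) : IsBoard (A ⊗ₕ B) 1 m (n + 1)
      fun i j => tm (L.v (i + 1)) (B.opX (L'.u j)) + tm (L.v i) (L'.v j) := by
  have := (L.isBoard L' sL sL' hL.opX_opY_u hL'.opX_opY_u 0).congr
    (E' := fun i j => tm (L.v (i + 1)) (B.opX (L'.u j)) + tm (L.v i) (L'.v j))
    (fun i hi j hj => by simp only [add_zero, hL.y i hi, hL.x i hi, hL'.y_all])
  simpa using this

/-- The coefficients of a dependence between the chessboard and vectors which do not involve
`v_k ⊗ v'_l` for `0 < k` or `l < m` vanish. -/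
theorem IsM.coeff_isW (hL' : L'.IsW) (hmn : m ≤ n) {c : ℕ → ℕ → K}
    (hc : ∀ i j, ¬(i < m ∧ j < n + 1) → c i j = 0) {V : (A ⊗ₕ B).carrier}
    (h : ∑ i ∈ Finset.range m, ∑ j ∈ Finset.range (n + 1),
      c i j • (tm (L.v (i + 1)) (B.opX (L'.u j)) + tm (L.v i) (L'.v j)) + V = 0)
    (hV0 : ∀ k < m, L.vv L' 0 k V = 0) (hV : ∀ i < m, ∀ k < n, L.vv L' (i + 1) k V = 0)
    (i j : ℕ) : c i j = 0 := by
  simp only [smul_add, Finset.sum_add_distrib] at h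
  refine antidiagonal_eq_zero' hmn hc (fun k hk => ?_) (fun i hi k hk => ?_) i j
  · have h1 := congrArg (L.vv L' 0 k) h
    have hz : ∀ i, 0 = i + 1 ↔ False := by simp
    simpa only [map_add, map_sum, map_smul, vv_tm, hV0 k hk, smul_eq_mul, L.vc_v (Nat.succ_pos m),
      L'.vc_v (show k < n by omega), map_zero, add_zero, hz, if_false, zero_mul, mul_zero,
      Finset.sum_const_zero, zero_add, sum_sum_delta hc] using h1
  · have h1 := congrArg (L.vv L' (i + 1) k) h
    simpa only [map_add, map_sum, map_smul, vv_tm, hV i hi k hk, smul_eq_mul,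
      L.vc_v (show i + 1 < m + 1 by omega), L'.vc_v hk, hL'.vc_opX_u hk, map_zero, add_zero,
      Nat.add_right_cancel_iff, sum_sum_delta hc] using h1

end

/-- The chessboard consists of all `± u_i ⊗ u'_j`. The upper layer of the complement consists of the
last vectors of `v_0 ⊗ B`. The first of these has to be killed by `x`, which is achieved by adding
`y` of the antidiagonal vector. -/
theorem IsM.tensor_isW_of_lt [CharZero K] {m n k l : ℕ} {L : Layer A m (m + 1)} (hL : L.IsM)
    {L' : Layer B (m + n + 1) (m + n)} (hL' : L'.IsW) (sL : L.Signs 1 1 (-1) 1)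
    (sL' : L'.Signs 1 1 1 (-1)) (hm : 1 ≤ m) (hn : 1 ≤ n) {LZ : Layer Z (n + 1) n} (hZ : LZ.IsW)
    (sZ : LZ.Signs (sgn (m - 1)) (sgn m) (sgn (m - 1)) (-sgn m))
    (hkl : Halves 1 (m * (m + n + 1)) k l) :
    A ⊗ₕ B ≅ₕ P K ^⊕ k ⊕ₕ (P K).twist (-1) (-1) ^⊕ l ⊕ₕ Z := by
  have := L.finite; have := L'.finite
  have := finite_tensor (A := A) (B := B)
  have hgv : A.opG (L.v 0) = -L.v 0 := by simpa using sL.gv 0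
  have hhv : A.opH (L.v 0) = L.v 0 := by simpa using sL.hv 0
  obtain ⟨r, rfl⟩ : ∃ r, m = r + 1 := ⟨m - 1, by omega⟩
  have hY : ∀ i, (A ⊗ₕ B).opY ((-1 : K) ^ i • tm (L.v 0) (L'.u (i + (r + 1))) +
      if i = 0 then (A ⊗ₕ B).opY (L.antidiagonal L') else 0) =
        (-1 : K) ^ i • tm (L.v 0) (L'.v (i + (r + 1))) := by
    intro i
    rw [map_add, map_smul, opY_tm, opY_v, hhv, hL'.y_all]
    split_ifs <;> simp
  refine hZ.splitting (p := sgn (r + 1 - 1)) (q := sgn (r + 1)) (s := 1) (a := r + 1)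
    (b := r + 1 + n + 1) hn sZ hkl (hL.board_isW hL' sL sL')
    (fun i => (-1 : K) ^ i • tm (L.v 0) (L'.u (i + (r + 1))) +
      if i = 0 then (A ⊗ₕ B).opY (L.antidiagonal L') else 0)
    (fun i => (-1 : K) ^ i • tm (L.v 0) (L'.v (i + (r + 1)))) ?_ ?_ ?_ ?_ (fun i _ => hY i) ?_ ?_ ?_
  · intro i hi
    rw [map_add, map_smul, opG_tm, hgv, sL'.gu, smul_add]
    congr 1
    · simp [smul_smul, pow_add]; ring_nf
    · split_ifs with h
      · rw [opG_opY, opG_antidiagonal sL sL', map_smul, h]; simp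
      · simp
  · intro i hi
    rw [map_add, map_smul, opH_tm, hhv, sL'.hu, smul_add]
    congr 1
    · simp [smul_smul, pow_add]; ring_nf
    · split_ifs with h
      · rw [opH_opY, opH_antidiagonal sL sL', map_smul, h]; simp [pow_succ]
      · simp
  · rw [if_pos rfl, map_add, map_smul, opX_tm, opX_v, hgv, hL.opX_opY_antidiagonal hL' sL]
    simp
  · intro i hi
    rw [if_neg (by omega), add_zero, map_smul, opX_tm, opX_v, hgv,
      show i + 1 + (r + 1) = i + (r + 1) + 1 by omega, hL'.x_succ_all]
    simp [pow_succ]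
  · rw [hY, L'.v_ge (by omega)]; simp
  · intro c d hc h
    have hc0 := IsM.coeff_isW hL' (by omega) hc h
      (by
        intro k hk
        rw [map_sum]
        refine Finset.sum_eq_zero fun j _ => ?_
        simp [L'.vc_v (show k < r + 1 + n by omega), show k ≠ j + (r + 1) by omega])
      (by
        intro i hi k hk
        rw [map_sum]
        refine Finset.sum_eq_zero fun j _ => ?_
        simp [L.vc_v (show i + 1 < r + 1 + 1 by omega)])
    simp only [hc0, zero_smul, Finset.sum_const_zero, zero_add] at h
    refine ⟨fun a ha b hb => hc0 a b, fun j hj => ?_⟩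
    refine coeff_eq_zero h hj (L.vv L' 0 (j + (r + 1))) ?_ fun i hi hij => ?_
    · simp [L.vc_v (show 0 < r + 1 + 1 by omega),
        L'.vc_v (show j + (r + 1) < r + 1 + n by omega)]
    · simp [L'.vc_v (show j + (r + 1) < r + 1 + n by omega), hij.symm]
  · rw [finrank_tensor, L.finrank, L'.finrank]; ring

/-- In the limiting case, all that is left of the complement is the vector `v_0 ⊗ u'_m` corrected by
`y` of the antidiagonal vector, which is killed by `x` and `y`. -/
theorem IsM.tensor_isW_of_eq [CharZero K] {m k l : ℕ} {L : Layer A m (m + 1)} (hL : L.IsM)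
    {L' : Layer B (m + 1) m} (hL' : L'.IsW) (sL : L.Signs 1 1 (-1) 1)
    (sL' : L'.Signs 1 1 1 (-1)) (hm : 1 ≤ m) (hkl : Halves 1 (m * (m + 1)) k l) :
    A ⊗ₕ B ≅ₕ P K ^⊕ k ⊕ₕ (P K).twist (-1) (-1) ^⊕ l ⊕ₕ S K (sgn (m - 1)) (sgn m) := by
  have := L.finite; have := L'.finite
  have := finite_tensor (A := A) (B := B)
  have hgv : A.opG (L.v 0) = -L.v 0 := by simpa using sL.gv 0
  have hhv : A.opH (L.v 0) = L.v 0 := by simpa using sL.hv 0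
  obtain ⟨r, rfl⟩ : ∃ r, m = r + 1 := ⟨m - 1, by omega⟩
  obtain ⟨w, hw⟩ := hL.board_isW hL' sL sL'
  let U : (A ⊗ₕ B).carrier := tm (L.v 0) (L'.u (r + 1)) + (A ⊗ₕ B).opY (L.antidiagonal L')
  have hXU : (A ⊗ₕ B).opX U = 0 := by
    rw [map_add, opX_tm, opX_v, hgv, hL.opX_opY_antidiagonal hL' sL]
    simp
  have hYU : (A ⊗ₕ B).opY U = 0 := by
    rw [map_add, opY_tm, opY_v, hhv, hL'.y_all, L'.v_ge le_rfl]
    simp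
  refine splitting_layer (layerS K _ _) 1 (r + 1) (r + 1 + 1) hkl.pos hkl.neg hkl.add w _
    (fun i hi j hj => (hw i hi j hj).1) (fun i hi j hj => (hw i hi j hj).2.1)
    (fun i hi j hj => (hw i hi j hj).2.2) 0 (fun _ => U)
    ((layerS K _ _).isHom_map (layerS_signs _ _ 1 1) _ _ (fun i hi => absurd hi (Nat.not_lt_zero i))
      (fun i hi => absurd hi (Nat.not_lt_zero i)) ?_ ?_ (fun i hi => absurd hi (Nat.not_lt_zero i))
      (fun i hi => absurd hi (Nat.not_lt_zero i)) (fun _ _ => hXU) (fun _ _ => hYU))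
    (fun i hi => absurd hi (Nat.not_lt_zero i)) (fun _ _ _ i hi => absurd hi (Nat.not_lt_zero i))
    ?_ ?_
  · intro j hj
    obtain rfl : j = 0 := by omega
    rw [map_add, opG_tm, hgv, sL'.gu, opG_opY, opG_antidiagonal sL sL', map_smul, smul_add]
    congr 1 <;> simp [pow_succ]
  · intro j hj
    obtain rfl : j = 0 := by omega
    rw [map_add, opH_tm, hhv, sL'.hu, opH_opY, opH_antidiagonal sL sL', map_smul, smul_add]
    congr 1 <;> simp [pow_succ]
  · intro c d hc h
    rw [Finset.sum_range_one] at h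
    -- only the complement involves `v_0 ⊗ u'_{r+1}`
    have hd : d 0 = 0 := by
      have h1 := congrArg (fun z => L'.uc (r + 1) (lc (L.vc 0) z)) h
      have hu := hL'.uc_opX_u
      simpa [U, hL.lc_opY_antidiagonal sL, L'.uc_u (Nat.lt_succ_self (r + 1)), hu,
        L.vc_v (Nat.succ_pos (r + 1))] using h1
    rw [hd, zero_smul] at h
    refine ⟨fun a ha b hb => IsM.coeff_isW hL' le_rfl hc h (by simp) (by simp) a b, fun j hj => ?_⟩
    obtain rfl : j = 0 := by omega
    exact hd
  · rw [finrank_tensor, L.finrank, L'.finrank]; ring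

section

variable {m n : ℕ} {L : Layer A m (m + 1)} {L' : Layer B (n + 1) n}

/-- For `n < m` every `v_i ⊗ v'_j` is of the form `x y w` with `w` homogeneous. As
`x y (± u_i ⊗ u'_{j + 1}) = v_{i + 1} ⊗ v'_j + v_i ⊗ v'_{j + 1}`, this propagates along the
antidiagonals, which start at `x y (u_i ⊗ u'_0) = v_i ⊗ v'_0` or
`x y (± u_i ⊗ u'_n) = v_{i + 1} ⊗ v'_{n - 1}`. -/
theorem IsM.board_isW_of_gt (hL : L.IsM) (hL' : L'.IsW) (sL : L.Signs 1 1 (-1) 1)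
    (sL' : L'.Signs 1 1 1 (-1)) (hmn : n < m) : IsBoard (A ⊗ₕ B) 1 (m + 1) n
      fun i j => tm (L.v i) (L'.v j) := by
  let Q : ℕ → ℕ → Prop := fun i j => ∃ w : (A ⊗ₕ B).carrier,
    (A ⊗ₕ B).opG w = (-1 : K) ^ (i + j) • w ∧ (A ⊗ₕ B).opH w = (-1 : K) ^ (i + j) • w ∧
      (A ⊗ₕ B).opX ((A ⊗ₕ B).opY w) = tm (L.v i) (L'.v j)
  have hz : ∀ i < m, ∀ j, ∃ w : (A ⊗ₕ B).carrier,
      (A ⊗ₕ B).opG w = (-1 : K) ^ (i + j) • w ∧ (A ⊗ₕ B).opH w = (-1 : K) ^ (i + j) • w ∧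
      (A ⊗ₕ B).opX ((A ⊗ₕ B).opY w) =
        tm (L.v (i + 1)) (B.opX (L'.u j)) + tm (L.v i) (L'.v j) := by
    intro i hi j
    refine ⟨(-1 : K) ^ i • tm (L.u i) (L'.u j), ?_, ?_, ?_⟩
    · rw [map_smul, opG_tm, sL.gu, sL'.gu]
      simp [smul_smul, pow_add, mul_comm]
    · rw [map_smul, opH_tm, sL.hu, sL'.hu]
      simp [smul_smul, pow_add, mul_comm]
    · rw [map_smul, map_smul, hL.opX_opY_tm_isW hL' sL hi, smul_smul, ← mul_pow]
      simp
  have h0 : ∀ i < m, Q i 0 := by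
    intro i hi
    obtain ⟨w, h1, h2, h3⟩ := hz i hi 0
    exact ⟨w, h1, h2, by simpa [hL'.x_zero] using h3⟩
  have hn : ∀ i < m, ∀ j, j + 1 = n → Q (i + 1) j := by
    intro i hi j hj
    obtain ⟨w, h1, h2, h3⟩ := hz i hi (j + 1)
    refine ⟨w, ?_, ?_, ?_⟩
    · rw [h1]; congr 2; omega
    · rw [h2]; congr 2; omega
    · rw [h3, hL'.x_succ_all, L'.v_ge (show n ≤ j + 1 by omega)]; simp
  have hup : ∀ i < m, ∀ j, Q (i + 1) j → Q i (j + 1) := by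
    rintro i hi j ⟨w', g1, g2, g3⟩
    obtain ⟨w, h1, h2, h3⟩ := hz i hi (j + 1)
    refine ⟨w - w', ?_, ?_, ?_⟩
    · rw [map_sub, h1, g1, smul_sub]; congr 3; omega
    · rw [map_sub, h2, g2, smul_sub]; congr 3; omega
    · rw [map_sub, map_sub, h3, g3, hL'.x_succ_all]; abel
  have hdown : ∀ i < m, ∀ j, Q i (j + 1) → Q (i + 1) j := by
    rintro i hi j ⟨w', g1, g2, g3⟩
    obtain ⟨w, h1, h2, h3⟩ := hz i hi (j + 1)
    refine ⟨w - w', ?_, ?_, ?_⟩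
    · rw [map_sub, h1, g1, smul_sub, show i + 1 + j = i + (j + 1) by omega]
    · rw [map_sub, h2, g2, smul_sub, show i + 1 + j = i + (j + 1) by omega]
    · rw [map_sub, map_sub, h3, g3, hL'.x_succ_all]; abel
  have hlow : ∀ j i, i + j < m → Q i j := by
    intro j
    induction j with
    | zero => exact h0
    | succ j ih => intro i hi; exact hup i (by omega) j (ih (i + 1) (by omega))
  have hhigh : ∀ t i j, j + 1 + t = n → t ≤ i → i < m → Q (i + 1) j := by
    intro t
    induction t with
    | zero => intro i j hj _ hi; exact hn i hi j hj
    | succ t ih =>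
      intro i j hj hti hi
      obtain ⟨i, rfl⟩ : ∃ k, i = k + 1 := ⟨i - 1, by omega⟩
      exact hdown _ hi j (ih i (j + 1) (by omega) (by omega) (by omega))
  have hQ : ∀ i j, i < m + 1 → j < n → Q i j := by
    intro i j hi hj
    rcases Nat.lt_or_ge (i + j) m with hij | hij
    · exact hlow j i hij
    · obtain ⟨i, rfl⟩ : ∃ k, i = k + 1 := ⟨i - 1, by omega⟩
      exact hhigh (n - 1 - j) i j (by omega) (by omega) (by omega)
  choose! w hw using hQ
  refine ⟨w, fun i hi j hj => ?_⟩
  simpa using hw i j hi hj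

end

/-- The socle of the projective part consists of all `v_i ⊗ v'_j`. The upper layer of the complement
consists of the sums of `u_i ⊗ u'_j` over those antidiagonals which contain all `j ≤ n`. -/
theorem IsM.tensor_isW_of_gt [CharZero K] {m n k l : ℕ} {L : Layer A (m + n) (m + n + 1)}
    (hL : L.IsM) {L' : Layer B (n + 1) n} (hL' : L'.IsW) (sL : L.Signs 1 1 (-1) 1)
    (sL' : L'.Signs 1 1 1 (-1)) (hm : 1 ≤ m) {LZ : Layer Z m (m + 1)} (hZ : LZ.IsM)
    (sZ : LZ.Signs (sgn n) (sgn n) (-sgn n) (sgn n)) (hkl : Halves 1 ((m + n + 1) * n) k l) :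
    A ⊗ₕ B ≅ₕ P K ^⊕ k ⊕ₕ (P K).twist (-1) (-1) ^⊕ l ⊕ₕ Z := by
  have := L.finite; have := L'.finite
  have := finite_tensor (A := A) (B := B)
  have hj : ∀ l j, j ∈ Finset.range (n + 1) → ∃ i, l + n - j = i ∧ l + n = i + j := by
    intro l j hj
    exact ⟨l + n - j, rfl, by have := Finset.mem_range.mp hj; omega⟩
  refine hZ.splitting (p := sgn n) (q := sgn n) (s := 1) (a := m + n + 1) (b := n) hm
    sZ hkl (hL.board_isW_of_gt hL' sL sL' (by omega))
    (fun l => ∑ j ∈ Finset.range (n + 1), tm (L.u (l + n - j)) (L'.u j))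
    (fun l => ∑ j ∈ Finset.range (n + 1), tm (L.v (l + n - j)) (L'.u j) +
      ∑ j ∈ Finset.range n, (-1 : K) ^ (l + n - (j + 1)) • tm (L.u (l + n - (j + 1))) (L'.v j))
    ?_ ?_ ?_ ?_ ?_ ?_ ?_
  · intro l hl
    rw [map_sum, Finset.smul_sum]
    refine Finset.sum_congr rfl fun j hj' => ?_
    obtain ⟨i, h1, h2⟩ := hj l j hj'
    rw [h1, opG_tm, sL.gu, sL'.gu, map_smul, map_smul, LinearMap.smul_apply, smul_smul]
    congr 1
    simp only [sc_one, one_mul, sc_pow, sc_neg, ← pow_add, add_comm n l, h2, add_comm j i]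
  · intro l hl
    rw [map_sum, Finset.smul_sum]
    refine Finset.sum_congr rfl fun j hj' => ?_
    obtain ⟨i, h1, h2⟩ := hj l j hj'
    rw [h1, opH_tm, sL.hu, sL'.hu, map_smul, map_smul, LinearMap.smul_apply, smul_smul]
    congr 1
    simp only [sc_one, one_mul, sc_pow, sc_neg, ← pow_add, add_comm n l, h2, add_comm j i]
  · intro l hl
    simp only [map_sum, opX_tm, Finset.sum_add_distrib]
    congr 1
    · exact Finset.sum_congr rfl fun j hj' => by rw [hL.x _ (by omega)]
    · rw [Finset.sum_range_succ']
      simp [hL'.x_zero, hL'.x_succ_all, sL.gu]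
  · intro l hl
    simp only [map_sum, opY_tm, Finset.sum_add_distrib]
    congr 1
    · refine Finset.sum_congr rfl fun j hj' => ?_
      rw [hL.y _ (by omega), show l + n - j + 1 = l + 1 + n - j by
        have := Finset.mem_range.mp hj'; omega]
    · rw [Finset.sum_range_succ, hL'.y_all, L'.v_ge le_rfl, map_zero, add_zero]
      refine Finset.sum_congr rfl fun j hj' => ?_
      rw [hL'.y_all, sL.hu, show l + 1 + n - (j + 1) = l + n - j by omega]
      simp
  · intro l hl
    have h : ∀ j ∈ Finset.range (n + 1),
        (A ⊗ₕ B).opX ((A ⊗ₕ B).opY (tm (L.u (l + n - j)) (L'.u j))) =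
        (-1 : K) ^ (l + n + j) • tm (L.v (l + n + 1 - j)) (B.opX (L'.u j)) -
          (-1 : K) ^ (l + n + (j + 1)) • tm (L.v (l + n + 1 - (j + 1))) (B.opX (L'.u (j + 1))) := by
      intro j hj'
      obtain ⟨i, h1, h2⟩ := hj l j hj'
      have e1 : (-1 : K) ^ (l + n + j) = (-1) ^ i := by
        rw [h2, add_assoc, pow_add, Even.neg_one_pow ⟨j, rfl⟩, mul_one]
      rw [h1, hL.opX_opY_tm_isW hL' sL (by omega), show l + n + 1 - j = i + 1 by omega,
        show l + n + 1 - (j + 1) = i by omega, hL'.x_succ_all, ← add_assoc, pow_succ, e1, smul_add]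
      simp
    rw [map_sum, map_sum, Finset.sum_congr rfl h, Finset.sum_range_sub'
      (fun j => (-1 : K) ^ (l + n + j) • tm (L.v (l + n + 1 - j)) (B.opX (L'.u j))),
      hL'.x_zero, hL'.x_succ_all, L'.v_ge le_rfl]
    simp
  · intro c d hc h
    -- the complement involves no `v_a ⊗ v'_b`, and only the complement involves `v_{j+n} ⊗ u'_0`
    have hc0 : ∀ a < m + n + 1, ∀ b < n, c a b = 0 := by
      intro a ha b hb
      have h1 := congrArg (L.vv L' a b) h
      have hV : ∀ l, L.vv L' a b (∑ j ∈ Finset.range (n + 1), tm (L.v (l + n - j)) (L'.u j) +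
          ∑ j ∈ Finset.range n, (-1 : K) ^ (l + n - (j + 1)) •
            tm (L.u (l + n - (j + 1))) (L'.v j)) = 0 := by
        intro l
        simp [map_sum]
      simpa only [map_add _ (Finset.sum _ _) (Finset.sum (Finset.range (m + 1)) _),
        map_sum _ _ (Finset.range (m + n + 1)), map_sum _ _ (Finset.range (m + 1)),
        map_sum _ (fun j => c _ j • _) (Finset.range n), map_smul,
        hV, vv_tm, L.vc_v ha, L'.vc_v hb, smul_eq_mul, smul_zero, mul_zero, Finset.sum_const_zero,
        add_zero, sum_sum_delta hc, map_zero] using h1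
    refine ⟨hc0, fun j hj' => ?_⟩
    have hf : ∀ i, L'.uc 0 (lc (L.vc (j + n)) (∑ x ∈ Finset.range (n + 1),
        tm (L.v (i + n - x)) (L'.u x) + ∑ x ∈ Finset.range n, (-1 : K) ^ (i + n - (x + 1)) •
          tm (L.u (i + n - (x + 1))) (L'.v x))) = if j = i then 1 else 0 := by
      intro i
      simp only [map_add, map_sum, map_smul, lc_tm, uc_v, Finset.sum_const_zero,
        add_zero, L'.uc_u (Nat.succ_pos n), smul_eq_mul, mul_ite, mul_one, mul_zero,
        Finset.sum_ite_eq, Finset.mem_range, Nat.succ_pos, if_true, Nat.sub_zero,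
        L.vc_v (show j + n < m + n + 1 by omega), Nat.add_right_cancel_iff]
    refine coeff_eq_zero_of_add h hj' (L'.uc 0 ∘ₗ lc (L.vc (j + n))) ?_ ?_ fun i hi hij => ?_
    · simp [map_sum]
    · rw [LinearMap.comp_apply, hf, if_pos rfl]; exact one_ne_zero
    · rw [LinearMap.comp_apply, hf, if_neg hij.symm]
  · rw [finrank_tensor, L.finrank, L'.finrank]; ring

end Layer

namespace Layer

variable {A B Z Z' : HHModule K}

/-! ### Tensor products of two modules of the shape of `N` or `C` with the same parameter -/

/-- The polynomials `1, t, t² - η, t (t² - η), …` in the shift operator. -/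
def basisPoly {n : ℕ} (L : Layer B n n) (η : K) : ℕ → Module.End K B.carrier
  | 0 => 1
  | 1 => L.shift η
  | l + 2 => L.shift η * basisPoly L η (l + 1) - band η (l + 1) • basisPoly L η l

section basisPoly

variable {n : ℕ} {L : Layer B n n} {η : K}

theorem basisPoly_succ (l : ℕ) : L.shift η * L.basisPoly η l =
    L.basisPoly η (l + 1) + band η l • L.basisPoly η (l - 1) := by
  rcases l with _ | l
  · simp [basisPoly]
  · simp [basisPoly]

theorem basisPoly_commute_shift (l : ℕ) : Commute (L.basisPoly η l) (L.shift η) := by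
  induction l using Nat.twoStepInduction with
  | zero => exact Commute.one_left _
  | one => exact Commute.refl _
  | more l h1 h2 => exact ((Commute.refl _).mul_left h2).sub_left (h1.smul_left _)

theorem basisPoly_commute (k l : ℕ) : Commute (L.basisPoly η k) (L.basisPoly η l) := by
  induction l using Nat.twoStepInduction with
  | zero => exact Commute.one_right _
  | one => exact basisPoly_commute_shift k
  | more l h1 h2 =>
    exact ((basisPoly_commute_shift k).mul_right h2).sub_right (h1.smul_right _)

theorem Signs.opG_basisPoly {a b c d : ℤˣ} (h : L.Signs a b c d) (l : ℕ) (z : B.carrier) :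
    B.opG (L.basisPoly η l z) = (-1 : K) ^ l • L.basisPoly η l (B.opG z) := by
  induction l using Nat.twoStepInduction with
  | zero => simp [basisPoly]
  | one => simp [basisPoly, h.opG_shift]
  | more l h1 h2 =>
    simp only [basisPoly, LinearMap.sub_apply, Module.End.mul_apply, LinearMap.smul_apply, map_sub,
      map_smul, h.opG_shift, h1, h2, smul_sub, smul_smul, pow_succ]
    congr 1
    · simp
    · congr 1; ring

theorem Signs.opH_basisPoly {a b c d : ℤˣ} (h : L.Signs a b c d) (l : ℕ) (z : B.carrier) :
    B.opH (L.basisPoly η l z) = (-1 : K) ^ l • L.basisPoly η l (B.opH z) := by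
  induction l using Nat.twoStepInduction with
  | zero => simp [basisPoly]
  | one => simp [basisPoly, h.opH_shift]
  | more l h1 h2 =>
    simp only [basisPoly, LinearMap.sub_apply, Module.End.mul_apply, LinearMap.smul_apply, map_sub,
      map_smul, h.opH_shift, h1, h2, smul_sub, smul_smul, pow_succ]
    congr 1
    · simp
    · congr 1; ring

theorem basisPoly_u (hn : band η n = 0) {a : ℕ} (ha : ∀ l, band η (a + l) = band η l) (l : ℕ) :
    L.basisPoly η l (L.u a) = L.u (a + l) := by
  have hs : ∀ i, L.shift η (L.u (a + i)) = L.u (a + i + 1) + band η i • L.u (a + i - 1) := by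
    intro i
    rcases Nat.lt_or_ge (a + i) n with hi | hi
    · rw [shift_u hi, ha]
    · rw [L.u_ge hi, L.u_ge (show n ≤ a + i + 1 by omega), map_zero, zero_add]
      rcases hi.lt_or_eq with hi | hi
      · rw [L.u_ge (by omega), smul_zero]
      · rw [← ha, ← hi, hn, zero_smul]
  induction l using Nat.twoStepInduction with
  | zero => simp [basisPoly]
  | one => simpa [basisPoly] using hs 0
  | more l h1 h2 =>
    rw [basisPoly, LinearMap.sub_apply, Module.End.mul_apply, LinearMap.smul_apply, h1, h2, hs]
    simp [add_assoc]

/-- The polynomial of degree `m` kills the last `m` basis vectors. -/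
theorem basisPoly_u_eq_zero (hn : band η n = 0) {m a : ℕ} (hm : m ≤ n)
    (h : ∀ l, band η (n - m + l) = band η l) (ha : n - m ≤ a) : L.basisPoly η m (L.u a) = 0 := by
  obtain ⟨l, rfl⟩ := Nat.exists_eq_add_of_le ha
  rw [← basisPoly_u hn h, ← Module.End.mul_apply, basisPoly_commute, Module.End.mul_apply,
    basisPoly_u hn h, L.u_ge (by omega), map_zero]

end basisPoly

/-- The vector `∑ u_i ⊗ f u'_{n - 1 - i}`. For `f` in the commutant of the shift `J`, it satisfies
`y U(f) = x U(J f)`. -/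
def antidiag {m n : ℕ} (L : Layer A m m) (L' : Layer B n n) :
    Module.End K B.carrier →ₗ[K] (A ⊗ₕ B).carrier :=
  ∑ i ∈ Finset.range m, tm (L.u i) ∘ₗ LinearMap.applyₗ (L'.u (n - 1 - i))

section antidiag

variable {m n : ℕ} {η : K} {L : Layer A m m} {L' : Layer B n n} {p q : ℤˣ}

theorem antidiag_apply (f : Module.End K B.carrier) : L.antidiag L' f =
    ∑ i ∈ Finset.range m, tm (L.u i) (f (L'.u (n - 1 - i))) := by
  simp [antidiag, LinearMap.sum_apply]

theorem opX_antidiag (hL : L.IsA η) (sL : L.Signs p p (-p) p) (f : Module.End K B.carrier) :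
    (A ⊗ₕ B).opX (L.antidiag L' f) =
      ∑ i ∈ Finset.range m, tm (L.v i) (f (L'.u (n - 1 - i))) +
      ∑ i ∈ Finset.range m, ((sc p : K) * (-1) ^ i) • tm (L.u i) (B.opX (f (L'.u (n - 1 - i)))) := by
  rw [antidiag_apply, map_sum, ← Finset.sum_add_distrib]
  refine Finset.sum_congr rfl fun i _ => ?_
  rw [opX_tm, hL.x_all, sL.gu, map_smul, LinearMap.smul_apply]

theorem opY_antidiag (hL : L.IsA η) (hL' : L'.IsA η) (sL : L.Signs p p (-p) p) (hmn : m ≤ n)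
    (hm : band η m = 0) (hr : ∀ i < n, band η (n - 1 - i) = band η (i + 1))
    (f : Module.End K B.carrier) (hf : Commute f (L'.shift η)) :
    (A ⊗ₕ B).opY (L.antidiag L' f) = (A ⊗ₕ B).opX (L.antidiag L' (L'.shift η * f)) := by
  rw [opX_antidiag hL sL, antidiag_apply, map_sum]
  simp only [opY_tm, Finset.sum_add_distrib, sL.hu, map_smul, LinearMap.smul_apply]
  congr 1
  · rcases m with _ | m
    · simp
    have h1 : ∀ i ∈ Finset.range (m + 1), tm (A.opY (L.u i)) (f (L'.u (n - 1 - i))) =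
        tm (L.v (i + 1)) (f (L'.u (n - 1 - i))) +
          band η i • tm (L.v (i - 1)) (f (L'.u (n - 1 - i))) := by
      intro i hi
      rw [hL.y i (Finset.mem_range.mp hi), map_add, map_smul, LinearMap.add_apply,
        LinearMap.smul_apply]
    have h2 : ∀ i ∈ Finset.range (m + 1),
        tm (L.v i) ((L'.shift η * f) (L'.u (n - 1 - i))) =
        tm (L.v i) (f (L'.u (n - 1 - i + 1))) +
          band η (i + 1) • tm (L.v i) (f (L'.u (n - 1 - (i + 1)))) := by
      intro i hi
      have := Finset.mem_range.mp hi
      rw [← hf.eq, Module.End.mul_apply, shift_u (show n - 1 - i < n by omega), hr i (by omega)]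
      simp only [map_add, map_smul, show n - 1 - i - 1 = n - 1 - (i + 1) by omega]
    rw [Finset.sum_congr rfl h1, Finset.sum_congr rfl h2, Finset.sum_add_distrib,
      Finset.sum_add_distrib]
    congr 1
    · rw [Finset.sum_range_succ, L.v_ge le_rfl, Finset.sum_range_succ',
        L'.u_ge (show n ≤ n - 1 - 0 + 1 by omega)]
      simp only [map_zero, LinearMap.zero_apply, add_zero]
      refine Finset.sum_congr rfl fun i hi => ?_
      have := Finset.mem_range.mp hi
      rw [show n - 1 - (i + 1) + 1 = n - 1 - i by omega]
    · rw [Finset.sum_range_succ', Finset.sum_range_succ, hm]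
      simp
  · refine Finset.sum_congr rfl fun i hi => ?_
    rw [← hL'.opX_shift, Module.End.mul_apply]

theorem opG_antidiag_basisPoly {a b c d a' b' c' d' : ℤˣ} (sL : L.Signs a b c d)
    (sL' : L'.Signs a' b' c' d') (hmn : m ≤ n) (l : ℕ) :
    (A ⊗ₕ B).opG (L.antidiag L' (L'.basisPoly η l)) =
      ((sc (a * a' * sgn (n - 1)) : K) * (-1) ^ l) • L.antidiag L' (L'.basisPoly η l) := by
  rw [antidiag_apply, map_sum, Finset.smul_sum]
  refine Finset.sum_congr rfl fun i hi => ?_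
  obtain ⟨j, h1, h2⟩ : ∃ j, n - 1 - i = j ∧ n - 1 = i + j :=
    ⟨n - 1 - i, rfl, by have := Finset.mem_range.mp hi; omega⟩
  rw [h1, h2, opG_tm, sL.gu, sL'.opG_basisPoly, sL'.gu]
  simp only [map_smul, LinearMap.smul_apply, smul_smul]
  congr 1
  simp only [sc_mul, sc_pow, sc_neg, sc_one]
  ring

theorem opH_antidiag_basisPoly {a b c d a' b' c' d' : ℤˣ} (sL : L.Signs a b c d)
    (sL' : L'.Signs a' b' c' d') (hmn : m ≤ n) (l : ℕ) :
    (A ⊗ₕ B).opH (L.antidiag L' (L'.basisPoly η l)) =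
      ((sc (b * b' * sgn (n - 1)) : K) * (-1) ^ l) • L.antidiag L' (L'.basisPoly η l) := by
  rw [antidiag_apply, map_sum, Finset.smul_sum]
  refine Finset.sum_congr rfl fun i hi => ?_
  obtain ⟨j, h1, h2⟩ : ∃ j, n - 1 - i = j ∧ n - 1 = i + j :=
    ⟨n - 1 - i, rfl, by have := Finset.mem_range.mp hi; omega⟩
  rw [h1, h2, opH_tm, sL.hu, sL'.opH_basisPoly, sL'.hu]
  simp only [map_smul, LinearMap.smul_apply, smul_smul]
  congr 1
  simp only [sc_mul, sc_pow, sc_neg, sc_one]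
  ring

end antidiag

theorem _root_.HHModule.IsHom.coprod {T : HHModule K} {φ : Z.carrier →ₗ[K] T.carrier}
    {ψ : Z'.carrier →ₗ[K] T.carrier} (hφ : IsHom Z T φ) (hψ : IsHom Z' T ψ) :
    IsHom (Z ⊕ₕ Z') T (φ.coprod ψ : Z.carrier × Z'.carrier →ₗ[K] T.carrier) := by
  constructor <;> intro z
  · change φ (Z.opG z.1) + ψ (Z'.opG z.2) = T.opG (φ z.1 + ψ z.2)
    rw [map_add, hφ.g, hψ.g]
  · change φ (Z.opH z.1) + ψ (Z'.opH z.2) = T.opH (φ z.1 + ψ z.2)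
    rw [map_add, hφ.h, hψ.h]
  · change φ (Z.opX z.1) + ψ (Z'.opX z.2) = T.opX (φ z.1 + ψ z.2)
    rw [map_add, hφ.x, hψ.x]
  · change φ (Z.opY z.1) + ψ (Z'.opY z.2) = T.opY (φ z.1 + ψ z.2)
    rw [map_add, hφ.y, hψ.y]

/-- The criterion `splitting_grid` for a complement with two summands of the shape of `N` or
`C`. -/
theorem IsA.splitting_two [CharZero K] {T : HHModule K} {n : ℕ} {L : Layer Z n n}
    {L' : Layer Z' n n} {η : K} (h : L.IsA η) (h' : L'.IsA η)
    [Module.Finite K T.carrier] {p q p' q' : ℤˣ} (hL : L.Signs p q (-p) q)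
    (hL' : L'.Signs p' q' (-p') q') {s : ℤˣ}
    {a b k l : ℕ} (hkl : Halves s (a * b) k l) {E : ℕ → ℕ → T.carrier} (hE : IsBoard T s a b E)
    (U U' : ℕ → T.carrier)
    (gU : ∀ i < n, T.opG (U i) = ((sc p : K) * (-1) ^ i) • U i)
    (hU : ∀ i < n, T.opH (U i) = ((sc q : K) * (-1) ^ i) • U i)
    (y : ∀ i < n, T.opY (U i) = T.opX (U (i + 1)) + band η i • T.opX (U (i - 1)))
    (last : T.opX (U n) = 0)
    (gU' : ∀ i < n, T.opG (U' i) = ((sc p' : K) * (-1) ^ i) • U' i)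
    (hU' : ∀ i < n, T.opH (U' i) = ((sc q' : K) * (-1) ^ i) • U' i)
    (y' : ∀ i < n, T.opY (U' i) = T.opX (U' (i + 1)) + band η i • T.opX (U' (i - 1)))
    (last' : T.opX (U' n) = 0)
    (inj : ∀ (c : ℕ → ℕ → K) (d e : ℕ → K), (∀ i j, ¬(i < a ∧ j < b) → c i j = 0) →
      ∑ i ∈ Finset.range a, ∑ j ∈ Finset.range b, c i j • E i j +
        (∑ j ∈ Finset.range n, d j • T.opX (U j) + ∑ j ∈ Finset.range n, e j • T.opX (U' j)) = 0 →
        (∀ i < a, ∀ j < b, c i j = 0) ∧ (∀ j < n, d j = 0) ∧ ∀ j < n, e j = 0)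
    (dim : Module.finrank K T.carrier = 4 * (a * b) + ((n + n) + (n + n))) :
    T ≅ₕ P K ^⊕ k ⊕ₕ (P K).twist (-1) (-1) ^⊕ l ⊕ₕ Z ⊕ₕ Z' := by
  obtain ⟨w, hw⟩ := hE
  have := L.finite; have := L'.finite
  have : Module.Finite K (Z ⊕ₕ Z').carrier :=
    inferInstanceAs (Module.Finite K (Z.carrier × Z'.carrier))
  refine splitting_grid s a b hkl.pos hkl.neg hkl.add w E (fun i hi j hj => (hw i hi j hj).1)
    (fun i hi j hj => (hw i hi j hj).2.1) (fun i hi j hj => (hw i hi j hj).2.2) _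
    ((h.isHom_map hL U gU hU y last).coprod (h'.isHom_map hL' U' gU' hU' y' last')) ?_ ?_ ?_
  · rintro ⟨z, z'⟩
    exact Prod.ext (L.opX_opY z h.opX_opY_u) (L'.opX_opY z' h'.opX_opY_u)
  · rintro c hc ⟨z, z'⟩ hx _ hz
    have hu : ∀ {M : Type u} [AddCommGroup M] [Module K M] (f : ℕ → M),
        ∑ i ∈ Finset.range n, L.uc i z • f i = 0 := fun f => Finset.sum_eq_zero fun i hi => by
      rw [L.uc_eq_zero le_rfl h.x (z := z) (congrArg Prod.fst hx) i (Finset.mem_range.mp hi),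
        zero_smul]
    have hu' : ∀ {M : Type u} [AddCommGroup M] [Module K M] (f : ℕ → M),
        ∑ i ∈ Finset.range n, L'.uc i z' • f i = 0 := fun f => Finset.sum_eq_zero fun i hi => by
      rw [L'.uc_eq_zero le_rfl h'.x (z := z') (congrArg Prod.snd hx) i (Finset.mem_range.mp hi),
        zero_smul]
    have hz' : ∑ i ∈ Finset.range a, ∑ j ∈ Finset.range b, c i j • E i j +
      (L.map U (fun i => T.opX (U i)) z + L'.map U' (fun i => T.opX (U' i)) z') = 0 := hz
    rw [L.map_apply, L'.map_apply, hu, hu', zero_add, zero_add] at hz'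
    obtain ⟨h1, h2, h3⟩ := inj c (fun j => L.vc j z) (fun j => L'.vc j z') hc hz'
    refine ⟨h1, Prod.ext ?_ ?_⟩
    · refine (L.decomp z).trans ?_
      rw [hu, zero_add, Finset.sum_eq_zero
        (fun i hi => by rw [h2 i (Finset.mem_range.mp hi), zero_smul])]
      rfl
    · refine (L'.decomp z').trans ?_
      rw [hu', zero_add, Finset.sum_eq_zero
        (fun i hi => by rw [h3 i (Finset.mem_range.mp hi), zero_smul])]
      rfl
  · rw [dim]
    congr 1
    have e : Module.finrank K (Z ⊕ₕ Z').carrier =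
      Module.finrank K Z.carrier + Module.finrank K Z'.carrier := Module.finrank_prod
    rw [e, L.finrank, L'.finrank]

/-- The chessboard consists of the `± u_i ⊗ u'_j` with `j < n - 1`. One summand of the complement is
`A ⊗ v'_0`. The upper layer of the other one is the image under `antidiag` of the polynomials
`basisPoly l` in the shift `J`; as `basisPoly m` kills the last `m` basis vectors, the dimension of
this layer is `m`. -/
theorem IsA.tensor_isA [CharZero K] {m n k l : ℕ} {η : K} {L : Layer A m m} (hL : L.IsA η)
    {L' : Layer B n n} (hL' : L'.IsA η) {p q s : ℤˣ} (sL : L.Signs p p (-p) p)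
    (sL' : L'.Signs q q (-q) q) (hm : 1 ≤ m) (hmn : m ≤ n) (hη : η = 0 ∨ (Even m ∧ Even n))
    {LZ : Layer Z m m} (hZ : LZ.IsA η)
    (sZ : LZ.Signs (p * q * sgn (n - 1)) (p * q * sgn (n - 1)) (-(p * q * sgn (n - 1)))
      (p * q * sgn (n - 1)))
    {LZ' : Layer Z' m m} (hZ' : LZ'.IsA η) (sZ' : LZ'.Signs (-(p * q)) (p * q) (p * q) (p * q))
    (hs : p * q = s) (hkl : Halves s (m * (n - 1)) k l) :
    A ⊗ₕ B ≅ₕ P K ^⊕ k ⊕ₕ (P K).twist (-1) (-1) ^⊕ l ⊕ₕ Z ⊕ₕ Z' := by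
  have := L.finite; have := L'.finite
  have := finite_tensor (A := A) (B := B)
  have hbm : band η m = 0 := by
    rcases hη with h | h
    · simp [h, band]
    · simp [band, h.1]
  have hbn : band η n = 0 := by
    rcases hη with h | h
    · simp [h, band]
    · simp [band, h.2]
  have hr : ∀ i < n, band η (n - 1 - i) = band η (i + 1) := by
    intro i hi
    rcases hη with h | h
    · simp [h, band]
    · have : Odd (n - 1 - i) ↔ Odd (i + 1) := by grind
      simp [band, this]
  have hd : ∀ l, band η (n - m + l) = band η l := by
    intro l
    rcases hη with h | h
    · simp [h, band]
    · have : Odd (n - m + l) ↔ Odd l := by grind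
      simp [band, this]
  have hE := ((L.isBoard L' sL sL' hL.opX_opY_u hL'.opX_opY_u 0).mono le_rfl
    (Nat.sub_le n 1)).congr (E' := fun i j => tm (A.opY (L.u i)) (L'.v j) +
      (tm (L.v i) (L'.v (j + 1)) + band η j • tm (L.v i) (L'.v (j - 1))))
    (fun i hi j hj => by
      simp only [add_zero, hL'.x_all, hL.x_all, hL'.y j (by omega), map_add, map_smul])
  have hX' : ∀ l, (A ⊗ₕ B).opX (tm (L.u l) (L'.v 0)) = tm (L.v l) (L'.v 0) := by
    intro l; rw [opX_tm, hL.x_all, opX_v]; simp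
  refine hZ.splitting_two hZ' sZ (p' := -(p * q)) (q' := p * q) (by simpa using sZ') (s := s)
    (a := m) (b := n - 1) (E := fun i j => tm (A.opY (L.u i)) (L'.v j) +
      (tm (L.v i) (L'.v (j + 1)) + band η j • tm (L.v i) (L'.v (j - 1))))
    hkl (by simpa [hs] using hE) (fun l => L.antidiag L' (L'.basisPoly η l))
    (fun l => tm (L.u l) (L'.v 0))
    (fun l _ => opG_antidiag_basisPoly sL sL' hmn l) (fun l _ => opH_antidiag_basisPoly sL sL' hmn l)
    ?_ ?_ ?_ ?_ ?_ ?_ ?_ ?_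
  · intro l hl
    rw [opY_antidiag hL hL' sL hmn hbm hr _ (basisPoly_commute_shift l), basisPoly_succ, map_add,
      map_smul, map_add, map_smul]
  · rw [antidiag_apply, map_sum]
    refine Finset.sum_eq_zero fun i hi => ?_
    rw [basisPoly_u_eq_zero hbn hmn hd (by have := Finset.mem_range.mp hi; omega), map_zero,
      map_zero]
  · intro l hl
    rw [opG_tm, sL.gu, sL'.gv]
    simp [smul_smul]; ring_nf
  · intro l hl
    rw [opH_tm, sL.hu, sL'.hv]
    simp [smul_smul]; ring_nf
  · intro l hl
    rw [hX', hX', opY_tm, opY_v, hL.y l hl]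
    simp
  · rw [hX', L.v_ge le_rfl]; simp
  · intro c d e hc h
    have hp : ∀ i : ℕ, ((sc p : K) * (-1) ^ i) ≠ 0 := fun i => left_ne_zero_of_mul_eq_one
      (sc_mul_neg_one_pow_self p i)
    -- only the summand given by `antidiag` involves `u_{m-1} ⊗ v'_k`, and `k = n - m + l` for the
    -- polynomial of degree `l`
    have hdz : ∀ j < m, d j = 0 := by
      intro j hj
      have hy : ∀ i ∈ Finset.range m, L.uc (m - 1) (A.opY (L.u i)) = 0 := fun i hi => by
        rw [hL.y i (Finset.mem_range.mp hi)]; simp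
      have h1 := congrArg (lc (L.uc (m - 1))) h
      have h2 : lc (L.uc (m - 1)) (∑ i ∈ Finset.range m, ∑ j ∈ Finset.range (n - 1), c i j •
          (tm (A.opY (L.u i)) (L'.v j) +
            (tm (L.v i) (L'.v (j + 1)) + band η j • tm (L.v i) (L'.v (j - 1))))) = 0 := by
        rw [map_sum]
        refine Finset.sum_eq_zero fun i hi => ?_
        rw [map_sum]
        refine Finset.sum_eq_zero fun j _ => ?_
        rw [map_smul, map_add, map_add, map_smul, lc_tm, lc_tm, lc_tm, hy i hi, uc_v]
        simp
      have h3 : ∀ l, lc (L.uc (m - 1)) ((A ⊗ₕ B).opX (L.antidiag L' (L'.basisPoly η l))) =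
          ((sc p : K) * (-1) ^ (m - 1)) • L'.v (n - m + l) := by
        intro l
        rw [opX_antidiag hL sL, map_add, map_sum, map_sum, Finset.sum_eq_zero
          (fun i _ => by rw [lc_tm, uc_v, zero_smul]), zero_add, Finset.sum_eq_single (m - 1)]
        · rw [map_smul, lc_tm, L.uc_u (by omega), if_pos rfl, one_smul,
            show n - 1 - (m - 1) = n - m by omega, basisPoly_u hbn hd, hL'.x_all]
        · intro i _ hi
          rw [map_smul, lc_tm, L.uc_u (by omega), if_neg hi.symm, zero_smul, smul_zero]
        · intro hi; exact absurd (Finset.mem_range.mpr (by omega)) hi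
      rw [map_add, h2, zero_add, map_add, map_sum, map_sum, map_zero] at h1
      simp only [map_smul, h3, hX', lc_tm, uc_v, zero_smul, smul_zero, Finset.sum_const_zero,
        add_zero] at h1
      refine coeff_eq_zero h1 hj (L'.vc (n - m + j)) ?_ fun i hi hij => ?_
      · rw [map_smul, L'.vc_v (by omega), if_pos rfl]; simpa using hp (m - 1)
      · rw [map_smul, L'.vc_v (by omega), if_neg (by omega), smul_zero]
    rw [Finset.sum_eq_zero (s := Finset.range m) (f := fun j => d j • _)
      (fun j hj => by rw [hdz j (Finset.mem_range.mp hj), zero_smul]), zero_add] at h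
    -- the columns `j` of the chessboard are eliminated from the last to the first, by the coefficients of
    -- `v_i ⊗ v'_{j+1}`, which do not occur in `A ⊗ v'_0`
    have hcz : ∀ t j, n ≤ j + 1 + t → ∀ i, c i j = 0 := by
      intro t
      induction t with
      | zero => intro j hj i; exact hc _ _ (by omega)
      | succ t ih =>
        intro j hj i
        by_cases hij : i < m ∧ j < n - 1
        · have hc' : ∀ i j', j < j' → c i j' = 0 := fun i j' hj' => ih j' (by omega) i
          have h1 := congrArg (rc (L'.vc (j + 1))) h
          simp only [map_add, map_sum, map_smul, rc_tm, hX', L'.vc_v (show j + 1 < n by omega),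
            Nat.succ_ne_zero, if_false, zero_smul, smul_zero, Finset.sum_const_zero, add_zero,
            map_zero] at h1
          have h2 : ∀ i' ∈ Finset.range m, (∑ j' ∈ Finset.range (n - 1), c i' j' •
              ((if j + 1 = j' then (1 : K) else 0) • A.opY (L.u i') +
              ((if j + 1 = j' + 1 then (1 : K) else 0) • L.v i' +
                band η j' • (if j + 1 = j' - 1 then (1 : K) else 0) • L.v i'))) =
                c i' j • L.v i' := by
            intro i' _
            rw [Finset.sum_eq_single j]
            · rw [if_neg (by omega), if_pos rfl, if_neg (by omega)]; simp
            · intro j' _ hj'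
              rcases Nat.lt_or_ge j j' with hlt | hge
              · rw [hc' _ _ hlt, zero_smul]
              · rw [if_neg (by omega), if_neg (by omega), if_neg (by omega)]; simp
            · intro hj'; exact absurd (Finset.mem_range.mpr hij.2) hj'
          rw [Finset.sum_congr rfl h2] at h1
          exact L.uc_eq_zero_of_sum le_rfl h1 hij.1 (f := fun i => c i j)
        · exact hc _ _ hij
    have hcz' : ∀ i j, c i j = 0 := fun i j => hcz n j (by omega) i
    simp only [hcz', zero_smul, Finset.sum_const_zero, zero_add, hX'] at h
    refine ⟨fun i _ j _ => hcz' i j, hdz, fun j hj => ?_⟩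
    refine coeff_eq_zero h hj (L.vv L' j 0) ?_ fun i hi hij => ?_
    · simp [L.vc_v hj, L'.vc_v (show 0 < n by omega)]
    · simp [L.vc_v hj, hij.symm]
  · rw [finrank_tensor, L.finrank, L'.finrank]
    obtain ⟨n, rfl⟩ : ∃ k, n = k + 1 := ⟨n - 1, by omega⟩
    rw [Nat.add_sub_cancel]; ring

end Layer

/-! ### Tensor products without a nonprojective summand -/

section tmap

variable {A B : HHModule K}

theorem tmap_mul (f f' : Module.End K A.carrier) (g g' : Module.End K B.carrier) :
    (tmap f g * tmap f' g' : Module.End K (A ⊗ₕ B).carrier) = tmap (f * f') (g * g') := by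
  refine LinearMap.ext fun z => ?_
  induction z using tensor_induction with
  | h0 => simp only [map_zero]
  | ht a b => rfl
  | ha v w hv hw => simp only [map_add, hv, hw]

theorem tmap_pow (f : Module.End K A.carrier) (g : Module.End K B.carrier) (k : ℕ) :
    (tmap f g ^ k : Module.End K (A ⊗ₕ B).carrier) = tmap (f ^ k) (g ^ k) := by
  induction k with
  | zero =>
    refine LinearMap.ext fun z => ?_
    induction z using tensor_induction with
    | h0 => simp only [map_zero]
    | ht a b => rfl
    | ha v w hv hw => simp only [map_add, hv, hw]
  | succ k ih => rw [pow_succ, ih, tmap_mul, ← pow_succ, ← pow_succ]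

theorem tmap_zero_left (g : Module.End K B.carrier) :
    (tmap 0 g : Module.End K (A ⊗ₕ B).carrier) = 0 :=
  TensorProduct.map_zero_left g

theorem tmap_zero_right (f : Module.End K A.carrier) :
    (tmap f 0 : Module.End K (A ⊗ₕ B).carrier) = 0 :=
  TensorProduct.map_zero_right f

theorem isNilpotent_tmap_left {f : Module.End K A.carrier} (hf : IsNilpotent f)
    (g : Module.End K B.carrier) : IsNilpotent (tmap f g : Module.End K (A ⊗ₕ B).carrier) := by
  obtain ⟨k, hk⟩ := hf
  exact ⟨k, by rw [tmap_pow, hk, tmap_zero_left]⟩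

theorem isNilpotent_tmap_right (f : Module.End K A.carrier) {g : Module.End K B.carrier}
    (hg : IsNilpotent g) : IsNilpotent (tmap f g : Module.End K (A ⊗ₕ B).carrier) := by
  obtain ⟨k, hk⟩ := hg
  exact ⟨k, by rw [tmap_pow, hk, tmap_zero_right]⟩

end tmap

/-- A nilpotent operator has no nonzero eigenvalue. -/
theorem eq_zero_of_isNilpotent {M : Type*} [AddCommGroup M] [Module K M] {N : Module.End K M}
    (hN : IsNilpotent N) {a : K} (ha : a ≠ 0) {z : M} (hz : N z = a • z) : z = 0 := by
  obtain ⟨k, hk⟩ := hN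
  have h : ∀ k, (N ^ k) z = a ^ k • z := by
    intro k
    induction k with
    | zero => simp
    | succ k ih => rw [pow_succ, Module.End.mul_apply, hz, map_smul, ih, smul_smul, pow_succ']
  have h' := h k
  rw [hk, LinearMap.zero_apply] at h'
  exact (smul_eq_zero.mp h'.symm).resolve_left (pow_ne_zero k ha)

namespace Layer

variable {A B : HHModule K}

theorem sum_sum_vv_eq_zero {m n a b : ℕ} (L : Layer A m a) (L' : Layer B n b) {c : ℕ → ℕ → K}
    (h : ∑ i ∈ Finset.range a, ∑ j ∈ Finset.range b, c i j • tm (L.v i) (L'.v j) = 0) :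
    ∀ i < a, ∀ j < b, c i j = 0 := by
  intro i hi j hj
  have h1 := congrArg (L.vv L' i j) h
  simpa [L.vc_v hi, L'.vc_v hj, hi, hj] using h1

/-- `J² - η` shifts the basis by two steps. -/
theorem isNilpotent_shift_sq {n : ℕ} (L : Layer B n n) {η : K} (hn : band η n = 0) :
    IsNilpotent (L.shift η ^ 2 - η • 1) := by
  have hb : ∀ i, band η i + band η (i + 1) = η := by
    intro i
    rcases Nat.even_or_odd i with h | h
    · simp [band, Nat.not_odd_iff_even.mpr h, h.add_one]
    · simp [band, h, Nat.not_odd_iff_even.mpr h.add_one]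
  have hb' : ∀ i, band η (i + 1) * band η i = 0 := by
    intro i
    rcases Nat.even_or_odd i with h | h
    · simp [band, Nat.not_odd_iff_even.mpr h]
    · simp [band, Nat.not_odd_iff_even.mpr h.add_one]
  -- The two layers are treated alike: `e` is one of the families `u`, `v`.
  have key : ∀ e : ℕ → B.carrier, (∀ i, n ≤ i → e i = 0) →
      (∀ i < n, L.shift η (e i) = e (i + 1) + band η i • e (i - 1)) → ∀ i,
      (L.shift η ^ 2 - η • 1 : Module.End K B.carrier) (e i) = e (i + 2) := by
    intro e he hs i
    have hs' : ∀ i, i ≤ n → L.shift η (e i) = e (i + 1) + band η i • e (i - 1) := by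
      intro i hi
      rcases hi.lt_or_eq with hi | rfl
      · exact hs i hi
      · rw [he i le_rfl, he (i + 1) (by omega), hn, map_zero, zero_smul, zero_add]
    rw [LinearMap.sub_apply, LinearMap.smul_apply, Module.End.one_apply, pow_two,
      Module.End.mul_apply]
    rcases Nat.lt_or_ge i n with hi | hi
    · rw [hs i hi, map_add, map_smul, hs' (i + 1) hi, Nat.add_sub_cancel]
      rcases i with _ | i
      · have := hb 0
        rw [band_zero, zero_add] at this
        rw [zero_add, this, band_zero]
        simp
      · rw [Nat.add_sub_cancel, hs i (by omega), smul_add, smul_smul, hb' i, zero_smul]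
        have h2 : η • e (i + 1) = band η (i + 1) • e (i + 1) + band η (i + 1 + 1) • e (i + 1) := by
          rw [← add_smul, hb]
        rw [h2]
        abel
    · rw [he i hi, he (i + 2) (by omega)]; simp
  have pow : ∀ e : ℕ → B.carrier,
      (∀ i, (L.shift η ^ 2 - η • 1 : Module.End K B.carrier) (e i) = e (i + 2)) → ∀ k i,
      ((L.shift η ^ 2 - η • 1 : Module.End K B.carrier) ^ k) (e i) = e (i + 2 * k) := by
    intro e he k
    induction k with
    | zero => simp
    | succ k ih => intro i; rw [pow_succ, Module.End.mul_apply, he, ih]; congr 1; omega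
  refine ⟨n, LinearMap.ext fun z => L.hom_ext (fun i hi => ?_) (fun i hi => ?_) z⟩
  · rw [pow _ (key _ (fun i => L.u_ge) fun i => shift_u), L.u_ge (by omega), LinearMap.zero_apply]
  · rw [pow _ (key _ (fun i => L.v_ge) fun i => shift_v), L.v_ge (by omega), LinearMap.zero_apply]

/-- For different parameters, `J ⊗ 1 + 1 ⊗ J'` is invertible: the eigenvalues of `J² ⊗ 1` and
`1 ⊗ J'²` differ. -/
theorem IsA.tensor_isA_of_ne [CharZero K] {m n k l : ℕ} {η γ : K} {L : Layer A m m}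
    (hL : L.IsA η) {L' : Layer B n n} (hL' : L'.IsA γ) {p q s : ℤˣ} (sL : L.Signs p p (-p) p)
    (sL' : L'.Signs q q (-q) q) (hm : band η m = 0) (hn : band γ n = 0) (hne : η ≠ γ)
    (hs : p * q = s) (hkl : Halves s (m * n) k l) :
    A ⊗ₕ B ≅ₕ P K ^⊕ k ⊕ₕ (P K).twist (-1) (-1) ^⊕ l := by
  have := L.finite; have := L'.finite
  have := finite_tensor (A := A) (B := B)
  let J : Module.End K (A ⊗ₕ B).carrier := tmap (L.shift η) 1
  let J' : Module.End K (A ⊗ₕ B).carrier := tmap 1 (L'.shift γ)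
  have hE := (L.isBoard L' sL sL' hL.opX_opY_u hL'.opX_opY_u 0).congr
    (E' := fun i j => (J + J') (tm (L.v i) (L'.v j)))
    (fun i hi j hj => by
      simp only [add_zero, J, J', LinearMap.add_apply, tmap_tm, Module.End.one_apply,
        ← hL.x_all, ← hL'.x_all, hL.shift_opX, hL'.shift_opX])
  have hE' : IsBoard (A ⊗ₕ B) s m n fun i j => (J + J') (tm (L.v i) (L'.v j)) := by
    simpa [hs] using hE
  obtain ⟨w, hw⟩ := hE'
  refine splitting_projective s m n hkl.pos hkl.neg hkl.add w _ (fun i hi j hj => (hw i hi j hj).1)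
    (fun i hi j hj => (hw i hi j hj).2.1) (fun i hi j hj => (hw i hi j hj).2.2) ?_ ?_
  · intro c h
    refine L.sum_sum_vv_eq_zero L' ?_
    have h' : (J + J') (∑ i ∈ Finset.range m, ∑ j ∈ Finset.range n,
        c i j • tm (L.v i) (L'.v j)) = 0 := by simpa only [map_sum, map_smul] using h
    let N : Module.End K (A ⊗ₕ B).carrier := tmap (L.shift η ^ 2 - η • 1) 1
    let N' : Module.End K (A ⊗ₕ B).carrier := tmap 1 (L'.shift γ ^ 2 - γ • 1)
    have hN : N - N' = (J - J') * (J + J') + (γ - η) • 1 := by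
      refine LinearMap.ext fun z => ?_
      induction z using tensor_induction with
      | h0 => simp only [map_zero]
      | ht a b =>
        simp only [N, N', J, J', LinearMap.sub_apply, LinearMap.add_apply, LinearMap.smul_apply,
          Module.End.mul_apply, Module.End.one_apply, tmap_tm, map_add, map_sub, map_smul,
          pow_two]
        module
      | ha v w hv hw => simp only [map_add, hv, hw]
    have hcomm : Commute N N' := by
      change tmap _ _ * tmap _ _ = tmap _ _ * tmap _ _
      rw [tmap_mul, tmap_mul]; simp
    refine eq_zero_of_isNilpotent (hcomm.isNilpotent_sub
      (isNilpotent_tmap_left (L.isNilpotent_shift_sq hm) 1)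
      (isNilpotent_tmap_right 1 (L'.isNilpotent_shift_sq hn))) (sub_ne_zero.mpr hne.symm) ?_
    rw [hN, LinearMap.add_apply, Module.End.mul_apply, h', map_zero, zero_add]
    rfl
  · rw [finrank_tensor, L.finrank, L'.finrank]; ring

/-- Here `x y` of the chessboard is `1 + J ⊗ D` for the nilpotent operator `D` which sends `v'_{j+1}`
to `v'_j`. -/
theorem IsA.tensor_isW [CharZero K] {m n k l : ℕ} {η : K} {L : Layer A m m}
    (hL : L.IsA η) {L' : Layer B n n} (hL' : L'.IsW) {p q s : ℤˣ} (sL : L.Signs p p (-p) p)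
    (sL' : L'.Signs q q q (-q)) (hs : p * q = s) (hkl : Halves s (m * n) k l) :
    A ⊗ₕ B ≅ₕ P K ^⊕ k ⊕ₕ (P K).twist (-1) (-1) ^⊕ l := by
  have := L.finite; have := L'.finite
  have := finite_tensor (A := A) (B := B)
  let D : Module.End K B.carrier := L'.map (fun _ => 0) fun j => B.opX (L'.u j)
  have hDv : ∀ j < n, D (L'.v j) = B.opX (L'.u j) := fun j hj => L'.map_v _ _ hj
  have hD : IsNilpotent D := by
    have h : ∀ j k, j < k → (D ^ k) (L'.v j) = 0 := by
      intro j
      induction j with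
      | zero =>
        intro k hk
        obtain ⟨k, rfl⟩ : ∃ i, k = i + 1 := ⟨k - 1, by omega⟩
        rcases Nat.eq_zero_or_pos n with hn | hn
        · rw [L'.v_ge (by omega), map_zero]
        · rw [pow_succ, Module.End.mul_apply, hDv 0 hn, hL'.x_zero, map_zero]
      | succ j ih =>
        intro k hk
        obtain ⟨k, rfl⟩ : ∃ i, k = i + 1 := ⟨k - 1, by omega⟩
        rcases Nat.lt_or_ge (j + 1) n with hj | hj
        · rw [pow_succ, Module.End.mul_apply, hDv _ hj, hL'.x_succ j hj, ih k (by omega)]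
        · rw [L'.v_ge hj, map_zero]
    refine ⟨n + 1, LinearMap.ext fun z => L'.hom_ext (fun i hi => ?_) (fun i hi => ?_) z⟩
    · rw [pow_succ, Module.End.mul_apply]
      simp [D, L'.map_u _ _ hi]
    · rw [h i _ (by omega), LinearMap.zero_apply]
  let N : Module.End K (A ⊗ₕ B).carrier := tmap (L.shift η) D
  have hE := (L.isBoard L' sL (c' := q) (d' := -q) sL' hL.opX_opY_u hL'.opX_opY_u 0).congr
    (E' := fun i j => (N + 1) (tm (L.v i) (L'.v j)))
    (fun i hi j hj => by
      simp only [add_zero, N, LinearMap.add_apply, tmap_tm, Module.End.one_apply, hDv j hj,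
        hL'.y j hj, ← hL.x_all, hL.shift_opX])
  have hE' : IsBoard (A ⊗ₕ B) s m n fun i j => (N + 1) (tm (L.v i) (L'.v j)) := by
    simpa [hs] using hE
  obtain ⟨w, hw⟩ := hE'
  refine splitting_projective s m n hkl.pos hkl.neg hkl.add w _ (fun i hi j hj => (hw i hi j hj).1)
    (fun i hi j hj => (hw i hi j hj).2.1) (fun i hi j hj => (hw i hi j hj).2.2) ?_ ?_
  · intro c h
    refine L.sum_sum_vv_eq_zero L' ?_
    have h' : (N + 1) (∑ i ∈ Finset.range m, ∑ j ∈ Finset.range n,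
        c i j • tm (L.v i) (L'.v j)) = 0 := by simpa only [map_sum, map_smul] using h
    refine eq_zero_of_isNilpotent (isNilpotent_tmap_right (L.shift η) hD)
      (neg_ne_zero.mpr (one_ne_zero (α := K))) ?_
    rw [LinearMap.add_apply, Module.End.one_apply] at h'
    rw [neg_smul, one_smul]
    exact eq_neg_of_add_eq_zero_left h'
  · rw [finrank_tensor, L.finrank, L'.finrank]; ring

/-- For `η ≠ 0` the shift is an automorphism up to the signs, as `J² - η` is nilpotent. -/
theorem IsA.twist_neg_iso {n : ℕ} {η : K} {L : Layer A n n} (hL : L.IsA η) {a b c d : ℤˣ}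
    (sL : L.Signs a b c d) (hη : η ≠ 0) (hn : band η n = 0) : A.twist (-1) (-1) ≅ₕ A := by
  have := L.finite
  have inj : Function.Injective (L.shift η) := by
    rw [injective_iff_map_eq_zero]
    intro z hz
    refine eq_zero_of_isNilpotent (L.isNilpotent_shift_sq hn) (neg_ne_zero.mpr hη) ?_
    rw [LinearMap.sub_apply, pow_two, Module.End.mul_apply, hz]
    simp
  refine twist_iso_of (LinearEquiv.ofInjectiveEndo (L.shift η) inj) ?_ ?_ ?_ ?_
  · intro z; simp [sL.opG_shift]
  · intro z; simp [sL.opH_shift]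
  · intro z; simp [hL.shift_opX, hL.opX_shift]
  · intro z; simp [hL.shift_opY]

end Layer

/-! ### The tensor products of the families -/

theorem ceilDiv_two (n : ℕ) : n ⌈/⌉ 2 = (n + 1) / 2 := by
  rw [Nat.ceilDiv_eq_add_pred_div, Nat.add_succ_sub_one]

theorem floorDiv_two (n : ℕ) : n ⌊/⌋ 2 = n / 2 := Nat.floorDiv_eq_div n 2

theorem halves_one (N : ℕ) : Halves 1 N (N ⌈/⌉ 2) (N ⌊/⌋ 2) where
  pos _ := ceilDiv_two N
  neg h := absurd h (by decide)
  add := by rw [ceilDiv_two, floorDiv_two]; omega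

theorem halves_neg_one (N : ℕ) : Halves (-1) N (N ⌊/⌋ 2) (N ⌈/⌉ 2) where
  pos h := absurd h (by decide)
  neg _ := ceilDiv_two N
  add := by rw [ceilDiv_two, floorDiv_two]; omega

theorem halves_two_mul (s : ℤˣ) {N k : ℕ} (h : N = 2 * k) : Halves s N k k where
  pos _ := by omega
  neg _ := by omega
  add := by omega

/-- The number of squares of a chessboard is even if opposite corners have different signs, so that the
sign in the corner does not matter in this case. -/
theorem halves_sgn (r s : ℕ) (hr : 1 ≤ r) (hs : 1 ≤ s) :
    Halves (sgn (r - 1) * sgn (s - 1)) (r * s) ((r * s) ⌈/⌉ 2) ((r * s) ⌊/⌋ 2) := by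
  obtain ⟨r, rfl⟩ := Nat.exists_eq_add_of_le' hr
  obtain ⟨s, rfl⟩ := Nat.exists_eq_add_of_le' hs
  rw [Nat.add_sub_cancel, Nat.add_sub_cancel, ← pow_add]
  rcases Nat.even_or_odd (r + s) with h | h
  · rw [Even.neg_one_pow h]; exact halves_one _
  · have he : Even ((r + 1) * (s + 1)) := by
      rw [Nat.even_mul, Nat.even_add_one, Nat.even_add_one, Nat.not_even_iff_odd,
        Nat.not_even_iff_odd]
      by_contra hc
      rw [not_or, Nat.not_odd_iff_even, Nat.not_odd_iff_even] at hc
      exact Nat.not_odd_iff_even.mpr (hc.1.add hc.2) h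
    obtain ⟨k, hk⟩ := he
    rw [hk, ceilDiv_two, floorDiv_two, show (k + k + 1) / 2 = k by omega,
      show (k + k) / 2 = k by omega]
    exact halves_two_mul _ (by omega)

theorem Halves.of_neg {s : ℤˣ} {N k l : ℕ} (h : Halves (-s) N k l) : Halves s N l k where
  pos hs := h.neg (by rw [hs])
  neg hs := h.pos (by rw [hs, neg_neg])
  add := by rw [add_comm]; exact h.add

theorem sgn_pred {r : ℕ} (hr : 1 ≤ r) : sgn (r - 1) = -sgn r := by
  obtain ⟨r, rfl⟩ := Nat.exists_eq_add_of_le' hr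
  simp [sgn, pow_succ]

theorem sgn_mul_self (r : ℕ) : sgn r * sgn r = 1 := Int.units_mul_self _

theorem halves_sgn_pred (r s : ℕ) (hr : 1 ≤ r) (hs : 1 ≤ s) :
    Halves (sgn (r - 1) * sgn (s - 1)) (r * (s - 1)) ((r * s - r) ⌊/⌋ 2) ((r * s - r) ⌈/⌉ 2) := by
  obtain ⟨s, rfl⟩ := Nat.exists_eq_add_of_le' hs
  rw [Nat.add_sub_cancel, show r * (s + 1) - r = r * s by rw [mul_add, mul_one, Nat.add_sub_cancel]]
  rcases Nat.eq_zero_or_pos s with rfl | hs'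
  · simpa using halves_two_mul (sgn (r - 1)) (N := 0) (k := 0) rfl
  · have h := halves_sgn r s hr hs'
    rw [sgn_pred hs', mul_neg] at h
    exact h.of_neg

/-- A decomposition may be proved after exchanging `(g, x)` with `(h, y)`, which only interchanges the
summands `P_{+-}` and `P_{-+}` of the projective modules. -/
theorem splitting_of_swap [CharZero K] {A B Z : HHModule K} {k l : ℕ}
    (h : A.swap ⊗ₕ B.swap ≅ₕ P K ^⊕ k ⊕ₕ (P K).twist (-1) (-1) ^⊕ l ⊕ₕ Z.swap) :
    A ⊗ₕ B ≅ₕ P K ^⊕ k ⊕ₕ (P K).twist (-1) (-1) ^⊕ l ⊕ₕ Z := by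
  refine Iso.of_swap ((swap_tensor A B).trans (h.trans (Iso.symm ?_)))
  refine (swap_sum _ _).trans (Iso.sum ((swap_power _ _).trans (swap_P.power _)) ?_)
  exact (swap_sum _ _).trans (Iso.sum ((swap_power _ _).trans ((swap_twist_P _ _).power _))
    (Iso.refl _))

theorem Iso.splitting {T Z Z' : HHModule K} {k l : ℕ}
    (h : T ≅ₕ P K ^⊕ k ⊕ₕ (P K).twist (-1) (-1) ^⊕ l ⊕ₕ Z) (e : Z ≅ₕ Z') :
    T ≅ₕ P K ^⊕ k ⊕ₕ (P K).twist (-1) (-1) ^⊕ l ⊕ₕ Z' :=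
  h.trans ((Iso.refl _).sum ((Iso.refl _).sum e))

theorem Layer.tensor_P_of_pos [CharZero K] {A : HHModule K} {m n : ℕ} (L : Layer A m n)
    (hL : L.Signs 1 1 1 (-1)) : A ⊗ₕ P K ≅ₕ
      P K ^⊕ ((m + 1) / 2) ⊕ₕ (P K).twist (-1) (-1) ^⊕ (m / 2) ⊕ₕ
        (P K).twist 1 (-1) ^⊕ ((n + 1) / 2) ⊕ₕ (P K).twist (-1) 1 ^⊕ (n / 2) := by
  have h := L.tensor_P hL
  rw [neg_neg] at h
  exact h.trans (((twist_one _).power _).sum (Iso.refl _))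

theorem Layer.tensor_P_of_neg [CharZero K] {A : HHModule K} {m n : ℕ} (L : Layer A m n)
    (hL : L.Signs 1 1 (-1) 1) : A ⊗ₕ P K ≅ₕ
      P K ^⊕ ((m + 1) / 2) ⊕ₕ (P K).twist (-1) (-1) ^⊕ (m / 2) ⊕ₕ
        (P K).twist 1 (-1) ^⊕ (n / 2) ⊕ₕ (P K).twist (-1) 1 ^⊕ ((n + 1) / 2) := by
  have h := L.tensor_P hL
  rw [neg_neg] at h
  exact h.trans (((twist_one _).power _).sum ((Iso.refl _).sum (sum_comm _ _)))

theorem band_two_mul (η : K) (r : ℕ) : band η (2 * r) = 0 := by simp [band]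

theorem C_twist_neg (r : ℕ) (hr : 1 ≤ r) (η : Kˣ) : (C K r η).twist (-1) (-1) ≅ₕ C K r η :=
  (layerC_isA r η).twist_neg_iso (layerC_signs hr η) η.ne_zero (band_two_mul _ _)

theorem C_twist_sgn (r : ℕ) (hr : 1 ≤ r) (η : Kˣ) (i : ℕ) :
    (C K r η).twist (sgn i) (sgn i) ≅ₕ C K r η := by
  rcases Nat.even_or_odd i with h | h
  · rw [sgn, Even.neg_one_pow h]; exact twist_one _
  · rw [sgn, Odd.neg_one_pow h]; exact C_twist_neg r hr η

theorem C_twist_comm (r : ℕ) (hr : 1 ≤ r) (η : Kˣ) :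
    (C K r η).twist (-1) 1 ≅ₕ (C K r η).twist 1 (-1) := by
  have h := (twist_twist (A := C K r η) (s := -1) (t := -1) (s' := 1) (t' := -1)).symm.trans
    ((C_twist_neg r hr η).twist 1 (-1))
  rwa [mul_one, mul_neg, mul_one, neg_neg] at h

theorem swap_rev_layerM_signs {r : ℕ} (hr : 1 ≤ r) : (layerM K r).swap.rev.Signs
    (sgn (r - 1)) (sgn (r - 1)) (-sgn (r - 1)) (sgn (r - 1)) := by
  simpa [sgn_pred hr] using (layerM_signs (K := K) r).swap.rev

theorem swap_rev_layerW_signs {r : ℕ} (hr : 1 ≤ r) : (layerW K r).swap.rev.Signs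
    (sgn r) (sgn r) (sgn r) (-sgn r) := by
  simpa [sgn_pred hr] using (layerW_signs (K := K) r).swap.rev

theorem swap_rev_layerN'_signs (r : ℕ) : (layerN' K r).swap.rev.Signs
    (sgn (r - 1)) (sgn (r - 1)) (-sgn (r - 1)) (sgn (r - 1)) := by
  simpa using (layerN'_signs (K := K) r).swap.rev

theorem swap_rev_twist_layerN'_signs (r : ℕ) (a b : ℤˣ) :
    ((layerN' K r).twist a b).swap.rev.Signs
      (b * sgn (r - 1)) (a * sgn (r - 1)) (-(b * sgn (r - 1))) (a * sgn (r - 1)) := by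
  simpa using ((layerN'_signs (K := K) r).twist a b).swap.rev

theorem M_tensor_N' [CharZero K] (r s : ℕ) (hr : 1 ≤ r) (hs : 1 ≤ s) : M K r ⊗ₕ N' K s ≅ₕ
    P K ^⊕ ((r * s) ⌈/⌉ 2) ⊕ₕ (P K).twist (-1) (-1) ^⊕ ((r * s) ⌊/⌋ 2) ⊕ₕ
      (N' K s).twist (sgn (r - 1)) (sgn r) := by
  refine splitting_of_swap ((layerM_isM r).swap_rev.tensor_isA (layerN'_isW s).swap_rev_isA
    (swap_rev_layerM_signs hr) (swap_rev_layerN'_signs s)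
    ((layerN'_isW s).twist _ _).swap_rev_isA ?_ rfl (halves_sgn r s hr hs))
  have h := swap_rev_twist_layerN'_signs (K := K) s (sgn (r - 1)) (sgn r)
  rw [sgn_pred hr] at h ⊢
  simpa using h

theorem W_tensor_N' [CharZero K] (r s : ℕ) (hr : 1 ≤ r) (hs : 1 ≤ s) : W K r ⊗ₕ N' K s ≅ₕ
    P K ^⊕ ((r * s) ⌊/⌋ 2) ⊕ₕ (P K).twist (-1) (-1) ^⊕ ((r * s) ⌈/⌉ 2) ⊕ₕ N' K s := by
  refine splitting_of_swap ((layerW_isW r).swap_rev.tensor_isA (layerN'_isW s).swap_rev_isA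
    (swap_rev_layerW_signs hr) (swap_rev_layerN'_signs s)
    (layerN'_isW s).swap_rev_isA ?_ rfl ?_)
  · have h : sgn r * sgn (s - 1) * sgn r = sgn (s - 1) := by
      rw [mul_right_comm, sgn_mul_self, one_mul]
    rw [h]
    exact swap_rev_layerN'_signs s
  · have h := halves_sgn r s hr hs
    rw [sgn_pred hr, neg_mul] at h
    exact h.of_neg

theorem N_tensor_N [CharZero K] (r s : ℕ) (hr : 1 ≤ r) (hrs : r ≤ s) : N K r ⊗ₕ N K s ≅ₕ
    P K ^⊕ ((r * s - r) ⌈/⌉ 2) ⊕ₕ (P K).twist (-1) (-1) ^⊕ ((r * s - r) ⌊/⌋ 2) ⊕ₕ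
      (N K r).twist (sgn (s - 1)) (sgn (s - 1)) ⊕ₕ (N K r).twist (-1) 1 := by
  refine (layerN_isA r).tensor_isA (layerN_isA s) (layerN_signs r) (layerN_signs s) hr hrs
    (Or.inl rfl) ((layerN_isA r).twist (sgn (s - 1)) (sgn (s - 1))) ?_
    ((layerN_isA r).twist (-1) 1) ?_ rfl ?_
  · simpa using (layerN_signs (K := K) r).twist (sgn (s - 1)) (sgn (s - 1))
  · simpa using (layerN_signs (K := K) r).twist (-1) 1
  · rw [mul_one, show r * s - r = r * (s - 1) by rw [Nat.mul_sub, mul_one]]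
    exact halves_one _

theorem N'_tensor_N' [CharZero K] (r s : ℕ) (hr : 1 ≤ r) (hrs : r ≤ s) : N' K r ⊗ₕ N' K s ≅ₕ
    P K ^⊕ ((r * s - r) ⌊/⌋ 2) ⊕ₕ (P K).twist (-1) (-1) ^⊕ ((r * s - r) ⌈/⌉ 2) ⊕ₕ
      N' K r ⊕ₕ (N' K r).twist (sgn (s - 1)) (sgn s) := by
  refine splitting_of_swap (((layerN'_isW r).swap_rev_isA.tensor_isA (layerN'_isW s).swap_rev_isA
    (swap_rev_layerN'_signs r) (swap_rev_layerN'_signs s) hr hrs (Or.inl rfl)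
    (layerN'_isW r).swap_rev_isA ?_ ((layerN'_isW r).twist (sgn (s - 1)) (sgn s)).swap_rev_isA ?_ rfl
    (halves_sgn_pred r s hr (hr.trans hrs))).splitting (swap_sum _ _).symm)
  · rw [mul_assoc, sgn_mul_self, mul_one]
    exact swap_rev_layerN'_signs r
  · have h := swap_rev_twist_layerN'_signs (K := K) r (sgn (s - 1)) (sgn s)
    rw [sgn_pred (hr.trans hrs)] at h ⊢
    simpa [mul_comm] using h

theorem C_tensor_C [CharZero K] (r s : ℕ) (hr : 1 ≤ r) (hrs : r ≤ s) (η : Kˣ) :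
    C K r η ⊗ₕ C K s η ≅ₕ
      P K ^⊕ (2 * r * s - r) ⊕ₕ (P K).twist (-1) (-1) ^⊕ (2 * r * s - r) ⊕ₕ
        C K r η ⊕ₕ (C K r η).twist 1 (-1) := by
  refine Iso.splitting ((layerC_isA r η).tensor_isA (layerC_isA s η) (layerC_signs hr η)
    (layerC_signs (hr.trans hrs) η) (by omega) (by omega) (Or.inr ⟨by simp, by simp⟩)
    ((layerC_isA r η).twist (sgn (2 * s - 1)) (sgn (2 * s - 1))) ?_
    ((layerC_isA r η).twist (-1) 1) ?_ rfl ?_)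
    ((C_twist_sgn r hr η _).sum (C_twist_comm r hr η))
  · simpa using (layerC_signs hr η).twist (sgn (2 * s - 1)) (sgn (2 * s - 1))
  · simpa using (layerC_signs hr η).twist (-1) 1
  · refine halves_two_mul _ ?_
    obtain ⟨s, rfl⟩ := Nat.exists_eq_add_of_le' (hr.trans hrs)
    rw [show 2 * (s + 1) - 1 = 2 * s + 1 by omega,
      show 2 * r * (s + 1) - r = 2 * r * s + r by rw [mul_add]; omega]
    ring

end HHModule

end

open HHModule in
theorem theorem5p7 {K : Type u} [Field K] [IsAlgClosed K] [CharZero K]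
    (r s : ℕ) (hr : 1 ≤ r) (hs : 1 ≤ s) (η γ : Kˣ) :
    -- (1)
    (P K ⊗ₕ P K ≅ₕ
      P K ⊕ₕ (P K).twist (-1) (-1) ⊕ₕ (P K).twist 1 (-1) ⊕ₕ (P K).twist (-1) 1) ∧
    -- (2)
    (M K r ⊗ₕ P K ≅ₕ
      P K ^⊕ (r ⌈/⌉ 2) ⊕ₕ (P K).twist (-1) (-1) ^⊕ (r ⌊/⌋ 2) ⊕ₕ
        (P K).twist 1 (-1) ^⊕ (r ⌈/⌉ 2) ⊕ₕ (P K).twist (-1) 1 ^⊕ ((r + 1) ⌈/⌉ 2)) ∧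
    (W K r ⊗ₕ P K ≅ₕ
      P K ^⊕ ((r + 1) ⌈/⌉ 2) ⊕ₕ (P K).twist (-1) (-1) ^⊕ (r ⌈/⌉ 2) ⊕ₕ
        (P K).twist 1 (-1) ^⊕ (r ⌈/⌉ 2) ⊕ₕ (P K).twist (-1) 1 ^⊕ (r ⌊/⌋ 2)) ∧
    -- (3)
    (N K r ⊗ₕ P K ≅ₕ
      P K ^⊕ (r ⌈/⌉ 2) ⊕ₕ (P K).twist (-1) (-1) ^⊕ (r ⌊/⌋ 2) ⊕ₕ
        (P K).twist 1 (-1) ^⊕ (r ⌊/⌋ 2) ⊕ₕ (P K).twist (-1) 1 ^⊕ (r ⌈/⌉ 2)) ∧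
    (N' K r ⊗ₕ P K ≅ₕ
      P K ^⊕ (r ⌈/⌉ 2) ⊕ₕ (P K).twist (-1) (-1) ^⊕ (r ⌊/⌋ 2) ⊕ₕ
        (P K).twist 1 (-1) ^⊕ (r ⌈/⌉ 2) ⊕ₕ (P K).twist (-1) 1 ^⊕ (r ⌊/⌋ 2)) ∧
    (C K r η ⊗ₕ P K ≅ₕ
      P K ^⊕ r ⊕ₕ (P K).twist (-1) (-1) ^⊕ r ⊕ₕ
        (P K).twist 1 (-1) ^⊕ r ⊕ₕ (P K).twist (-1) 1 ^⊕ r) ∧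
    (C K r η ⊗ₕ S K (-1) (-1) ≅ₕ C K r η) ∧
    -- (4)
    (M K r ⊗ₕ M K s ≅ₕ
      P K ^⊕ ((r * s) ⌈/⌉ 2) ⊕ₕ (P K).twist (-1) (-1) ^⊕ ((r * s) ⌊/⌋ 2) ⊕ₕ
        (M K (r + s)).twist (-1) 1) ∧
    -- (5)
    (W K r ⊗ₕ W K s ≅ₕ
      P K ^⊕ ((r * s) ⌊/⌋ 2) ⊕ₕ (P K).twist (-1) (-1) ^⊕ ((r * s) ⌈/⌉ 2) ⊕ₕ W K (r + s)) ∧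
    -- (6)
    (r < s → M K r ⊗ₕ W K s ≅ₕ
      P K ^⊕ ((r * (s + 1)) ⌈/⌉ 2) ⊕ₕ (P K).twist (-1) (-1) ^⊕ ((r * (s + 1)) ⌊/⌋ 2) ⊕ₕ
        (W K (s - r)).twist (sgn (r - 1)) (sgn r)) ∧
    (r = s → M K r ⊗ₕ W K s ≅ₕ
      P K ^⊕ (r * (r + 1) / 2) ⊕ₕ (P K).twist (-1) (-1) ^⊕ (r * (r + 1) / 2) ⊕ₕ
        S K (sgn (r - 1)) (sgn r)) ∧
    (s < r → M K r ⊗ₕ W K s ≅ₕ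
      P K ^⊕ (((r + 1) * s) ⌈/⌉ 2) ⊕ₕ (P K).twist (-1) (-1) ^⊕ (((r + 1) * s) ⌊/⌋ 2) ⊕ₕ
        (M K (r - s)).twist (sgn s) (sgn s)) ∧
    -- (7)
    (M K r ⊗ₕ C K s η ≅ₕ
      P K ^⊕ (r * s) ⊕ₕ (P K).twist (-1) (-1) ^⊕ (r * s) ⊕ₕ (C K s η).twist 1 (-1)) ∧
    -- (8)
    (W K r ⊗ₕ C K s η ≅ₕ
      P K ^⊕ (r * s) ⊕ₕ (P K).twist (-1) (-1) ^⊕ (r * s) ⊕ₕ C K s η) ∧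
    -- (9)
    (M K r ⊗ₕ N K s ≅ₕ
      P K ^⊕ ((r * s) ⌈/⌉ 2) ⊕ₕ (P K).twist (-1) (-1) ^⊕ ((r * s) ⌊/⌋ 2) ⊕ₕ
        (N K s).twist (-1) 1) ∧
    (M K r ⊗ₕ N' K s ≅ₕ
      P K ^⊕ ((r * s) ⌈/⌉ 2) ⊕ₕ (P K).twist (-1) (-1) ^⊕ ((r * s) ⌊/⌋ 2) ⊕ₕ
        (N' K s).twist (sgn (r - 1)) (sgn r)) ∧
    -- (10)
    (W K r ⊗ₕ N K s ≅ₕ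
      P K ^⊕ ((r * s) ⌈/⌉ 2) ⊕ₕ (P K).twist (-1) (-1) ^⊕ ((r * s) ⌊/⌋ 2) ⊕ₕ
        (N K s).twist (sgn r) (sgn r)) ∧
    (W K r ⊗ₕ N' K s ≅ₕ
      P K ^⊕ ((r * s) ⌊/⌋ 2) ⊕ₕ (P K).twist (-1) (-1) ^⊕ ((r * s) ⌈/⌉ 2) ⊕ₕ N' K s) ∧
    -- (11)
    (η ≠ γ → C K r η ⊗ₕ C K s γ ≅ₕ
      P K ^⊕ (2 * r * s) ⊕ₕ (P K).twist (-1) (-1) ^⊕ (2 * r * s)) ∧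
    (η = γ → C K r η ⊗ₕ C K s γ ≅ₕ
      P K ^⊕ (2 * r * s - min r s) ⊕ₕ (P K).twist (-1) (-1) ^⊕ (2 * r * s - min r s) ⊕ₕ
        C K (min r s) η ⊕ₕ (C K (min r s) η).twist 1 (-1)) ∧
    -- (12)
    (N K r ⊗ₕ N K s ≅ₕ
      P K ^⊕ ((r * s - min r s) ⌈/⌉ 2) ⊕ₕ
        (P K).twist (-1) (-1) ^⊕ ((r * s - min r s) ⌊/⌋ 2) ⊕ₕ
        (N K (min r s)).twist (sgn (max r s - 1)) (sgn (max r s - 1)) ⊕ₕ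
        (N K (min r s)).twist (-1) 1) ∧
    -- (13)
    (N' K r ⊗ₕ N' K s ≅ₕ
      P K ^⊕ ((r * s - min r s) ⌊/⌋ 2) ⊕ₕ
        (P K).twist (-1) (-1) ^⊕ ((r * s - min r s) ⌈/⌉ 2) ⊕ₕ
        N' K (min r s) ⊕ₕ
        (N' K (min r s)).twist (sgn (max r s - 1)) (sgn (max r s))) ∧
    -- (14)
    (N K r ⊗ₕ N' K s ≅ₕ
      P K ^⊕ ((r * s) ⌈/⌉ 2) ⊕ₕ (P K).twist (-1) (-1) ^⊕ ((r * s) ⌊/⌋ 2)) ∧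
    (C K r η ⊗ₕ N K s ≅ₕ P K ^⊕ (r * s) ⊕ₕ (P K).twist (-1) (-1) ^⊕ (r * s)) ∧
    (C K r η ⊗ₕ N' K s ≅ₕ P K ^⊕ (r * s) ⊕ₕ (P K).twist (-1) (-1) ^⊕ (r * s)) := by
  refine ⟨P_tensor_P, ?_, ?_, ?_, ?_, ?_, ?_, ?_, ?_, ?_, ?_, ?_, ?_, ?_, ?_, M_tensor_N' r s hr hs, ?_,
    W_tensor_N' r s hr hs, ?_, ?_, ?_, ?_, ?_, ?_, ?_⟩
  · rw [ceilDiv_two, floorDiv_two, ceilDiv_two]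
    exact (layerM K r).tensor_P_of_neg (layerM_signs r)
  · rw [ceilDiv_two, floorDiv_two, ceilDiv_two]
    exact (layerW K r).tensor_P_of_pos (layerW_signs r)
  · rw [ceilDiv_two, floorDiv_two]
    exact (layerN K r).tensor_P_of_neg (layerN_signs r)
  · rw [ceilDiv_two, floorDiv_two]
    exact (layerN' K r).tensor_P_of_pos (layerN'_signs r)
  · have h := (layerC K r η).tensor_P_of_neg (layerC_signs hr η)
    rwa [show (2 * r + 1) / 2 = r by omega, show 2 * r / 2 = r by omega] at h
  · exact C_twist_neg r hr η
  · exact (layerM_isM r).tensor_isM (layerM_isM s) (layerM_signs r) (layerM_signs s) hr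
      ((layerM_isM (r + s)).twist (-1) 1) (by simpa using (layerM_signs (r + s)).twist (-1) 1)
      (halves_one _)
  · exact (layerW_isW r).tensor_isW (layerW_isW s) (layerW_signs r) (layerW_signs s) hr hs
      (layerW_isW (r + s)) (layerW_signs (r + s)) (halves_neg_one _)
  · intro hrs
    obtain ⟨n, rfl⟩ := Nat.exists_eq_add_of_lt hrs
    rw [show r + n + 1 - r = n + 1 by omega]
    exact (layerM_isM r).tensor_isW_of_lt (n := n + 1) (layerW_isW (r + (n + 1))) (layerM_signs r)
      (layerW_signs (r + (n + 1))) hr (by omega)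
      ((layerW_isW (n + 1)).twist (sgn (r - 1)) (sgn r))
      (by simpa using (layerW_signs (n + 1)).twist (sgn (r - 1)) (sgn r)) (halves_one _)
  · rintro rfl
    refine (layerM_isM r).tensor_isW_of_eq (layerW_isW r) (layerM_signs r) (layerW_signs r) hr
      (halves_two_mul _ ?_)
    rw [Nat.mul_div_cancel' (Nat.even_mul_succ_self r).two_dvd]
  · intro hrs
    obtain ⟨m, hm, rfl⟩ : ∃ m, 1 ≤ m ∧ r = m + s := ⟨r - s, by omega, by omega⟩
    rw [Nat.add_sub_cancel]
    exact (layerM_isM (m + s)).tensor_isW_of_gt (layerW_isW s) (layerM_signs (m + s))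
      (layerW_signs s) hm ((layerM_isM m).twist (sgn s) (sgn s))
      (by simpa using (layerM_signs m).twist (sgn s) (sgn s)) (halves_one _)
  · refine Iso.splitting ((layerM_isM r).tensor_isA (layerC_isA s η) (layerM_signs r)
      (layerC_signs hs η) ((layerC_isA s η).twist (-1) 1) ?_ rfl (halves_two_mul _ (by ring)))
      (C_twist_comm s hs η)
    simpa using (layerC_signs hs η).twist (-1) 1
  · refine Iso.splitting ((layerW_isW r).tensor_isA (layerC_isA s η) (layerW_signs r)
      (layerC_signs hs η) ((layerC_isA s η).twist (sgn r) (sgn r)) ?_ rfl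
      (halves_two_mul _ (by ring))) (C_twist_sgn s hs η r)
    simpa using (layerC_signs hs η).twist (sgn r) (sgn r)
  · exact (layerM_isM r).tensor_isA (layerN_isA s) (layerM_signs r) (layerN_signs s)
      ((layerN_isA s).twist (-1) 1) (by simpa using (layerN_signs s).twist (-1) 1) rfl
      (by simpa using halves_one (r * s))
  · exact (layerW_isW r).tensor_isA (layerN_isA s) (layerW_signs r) (layerN_signs s)
      ((layerN_isA s).twist (sgn r) (sgn r))
      (by simpa using (layerN_signs s).twist (sgn r) (sgn r)) rfl
      (by simpa using halves_one (r * s))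
  · intro hne
    exact (layerC_isA r η).tensor_isA_of_ne (layerC_isA s γ) (layerC_signs hr η)
      (layerC_signs hs γ) (band_two_mul _ _) (band_two_mul _ _) (fun h => hne (Units.ext h)) rfl
      (halves_two_mul _ (by ring))
  · rintro rfl
    rcases le_total r s with h | h
    · rw [min_eq_left h]
      exact C_tensor_C r s hr h η
    · rw [min_eq_right h, mul_right_comm]
      exact tensor_comm.trans (C_tensor_C s r hs h η)
  · rcases le_total r s with h | h
    · rw [min_eq_left h, max_eq_right h]
      exact N_tensor_N r s hr h
    · rw [min_eq_right h, max_eq_left h, mul_comm r s]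
      exact tensor_comm.trans (N_tensor_N s r hs h)
  · rcases le_total r s with h | h
    · rw [min_eq_left h, max_eq_right h]
      exact N'_tensor_N' r s hr h
    · rw [min_eq_right h, max_eq_left h, mul_comm r s]
      exact tensor_comm.trans (N'_tensor_N' s r hs h)
  · exact (layerN_isA r).tensor_isW (layerN'_isW s) (layerN_signs r) (layerN'_signs s) rfl
      (by simpa using halves_one (r * s))
  · exact (layerC_isA r η).tensor_isA_of_ne (layerN_isA s) (layerC_signs hr η) (layerN_signs s)
      (band_two_mul _ _) (band_zero_left s) η.ne_zero rfl (halves_two_mul _ (by ring))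
  · exact (layerC_isA r η).tensor_isW (layerN'_isW s) (layerC_signs hr η) (layerN'_signs s) rfl
      (halves_two_mul _ (by ring))
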